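/- Let $1\le k\le n$, let $\mu$ be a finite Borel measure on the unit sphere $S^{n-1}$ of $\mathbb{R}^n$ that is isotropic, i.e. $\int_{S^{n-1}}u\otimes u\,d\mu(u)=I_n$, and whose centroid $\frac{1}{\mu(S^{n-1})}\int_{S^{n-1}}u\,d\mu(u)$ is the origin. Let $K\subset\mathbb{R}^n$ be a convex body (a compact convex set with non-empty interior) with $K\supseteq \mathrm{conv}(\mathrm{supp}\,\mu)$, and let $H$ be a $k$-dimensional linear subspace of $\mathbb{R}^n$, with orthogonal projection $\mathrm{P}_H:\mathbb{R}^n\to H$. For a convex body $L$ in a $d$-dimensional Euclidean space $E$ with unit sphere $S(E)$, let $h_L(x)=\max_{y\in L}\langle x,y\rangle$ and let $$W(L)=\frac{1}{d\,\omega_d}\int_{S(E)}\big(h_L(u)+h_L(-u)\big)\,du$$ be its mean width, where $\omega_d$ is the volume of the $d$-dimensional unit ball and $du$ is the spherical Lebesgue measure on $S(E)$, of total mass $d\,\omega_d$. The sets $\mathrm{P}_HK$ and $K^\circ\cap H$, where $K^\circ=\{x\in\mathbb{R}^n:\langle x,y\rangle\le 1\text{ for all }y\in K\}$, are regarded as convex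 bodies in the Euclidean space $E=H$. In $\mathbb{R}^k$ let $\triangle_k$ be a regular $k$-dimensional simplex inscribed in the Euclidean unit ball (all vertices on the unit sphere, all edges of equal length), and let $B_1^k=\{x:\sum_i|x_i|\le1\}$ and $B_\infty^k=\{x:\max_i|x_i|\le1\}$. For $A\subset H$ and $B\subset\mathbb{R}^k$ write $A\cong B$ if $A=\varphi(B)$ for some linear isometry $\varphi$ of $\mathbb{R}^k$ onto $H$. Then $$W(\mathrm{P}_HK)\ \ge\ \sqrt{\tfrac kn}\;W(\triangle_k),$$ with equality if and only if $\mathrm{P}_HK\cong\sqrt{\tfrac kn}\,\triangle_k$. If moreover $\mu$ is even (i.e. $\mu(-A)=\mu(A)$ for every Borel set $A\subseteq S^{n-1}$), then $$W(\mathrm{P}_HK)\ \ge\ \sqrt{\tfrac kn}\;W(B_1^k),$$ with equality if and only if $\mathrm{P}_HK\cong\sqrt{\tfrac kn}\,B_1^k$; and $$W(K^\circ\cap H)\ \le\ \sqrt{\tfrac nk}\;W(B_\infty^k),$$ with equality if and only if $K^\circ\cap H\cong\sqrt{\tfrac nk}\,B_\infty^k$. -/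

import Mathlib

open MeasureTheory Metric Module
open scoped Pointwise RealInnerProductSpace

noncomputable section

/-- The support function `h_K(x) = sup {⟪x, y⟫ : y ∈ K}` (a maximum when `K` is compact and
nonempty). -/
def supportFn {E : Type*} [NormedAddCommGroup E] [InnerProductSpace ℝ E] (K : Set E) (x : E) : ℝ :=
  sSup ((fun y : E => ⟪x, y⟫) '' K)

/-- The mean width of a set `K` in a Euclidean space `E` of dimension `d`:
`W(K) = (d ω_d)⁻¹ ∫_{S(E)} (h_K(u) + h_K(-u)) du`, where `ω_d` is the volume of the unit ball of `E`
and `du` is the spherical Lebesgue measure, of total mass `d ω_d`. -/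
def meanWidth {E : Type*} [NormedAddCommGroup E] [InnerProductSpace ℝ E] [FiniteDimensional ℝ E]
    [MeasurableSpace E] [BorelSpace E] (K : Set E) : ℝ :=
  (finrank ℝ E * (volume : Measure E).real (closedBall 0 1))⁻¹ *
    ∫ u : sphere (0 : E) 1, (supportFn K (u : E) + supportFn K (-(u : E)))
      ∂((volume : Measure E).toSphere)

/-- The polar set `K° = {x : ⟪x, y⟫ ≤ 1 for all y ∈ K}`. -/
def polarBody {E : Type*} [NormedAddCommGroup E] [InnerProductSpace ℝ E] (K : Set E) : Set E :=
  {x | ∀ y ∈ K, ⟪x, y⟫ ≤ 1}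

/-- The orthogonal projection `P_H K`, as a subset of the Euclidean space `H`. -/
def projBody {E : Type*} [NormedAddCommGroup E] [InnerProductSpace ℝ E] [FiniteDimensional ℝ E]
    (H : Submodule ℝ E) (K : Set E) : Set H :=
  (fun x : E => H.orthogonalProjectionOnto x) '' K

/-- The section `K ∩ H`, as a subset of the Euclidean space `H`. -/
def sectionBody {E : Type*} [NormedAddCommGroup E] [InnerProductSpace ℝ E]
    (H : Submodule ℝ E) (K : Set E) : Set H :=
  {x | (x : E) ∈ K}

/-- A measure on the unit sphere is isotropic if `∫ u ⊗ u dμ(u)` is the identity. -/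
def IsIsotropic {E : Type*} [NormedAddCommGroup E] [InnerProductSpace ℝ E] [MeasurableSpace E]
    (μ : Measure (sphere (0 : E) 1)) : Prop :=
  ∫ u : sphere (0 : E) 1, InnerProductSpace.rankOne ℝ (u : E) (u : E) ∂μ =
    ContinuousLinearMap.id ℝ E

/-- The centroid `μ(S)⁻¹ ∫ u dμ(u)` of a measure on the unit sphere. -/
def sphereCentroid {E : Type*} [NormedAddCommGroup E] [InnerProductSpace ℝ E] [MeasurableSpace E]
    (μ : Measure (sphere (0 : E) 1)) : E :=
  (μ.real Set.univ)⁻¹ • ∫ u : sphere (0 : E) 1, (u : E) ∂μ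

/-- A measure on the unit sphere is even if antipodal sets have the same measure. -/
def IsEvenMeasure {E : Type*} [NormedAddCommGroup E] [InnerProductSpace ℝ E] [MeasurableSpace E]
    (μ : Measure (sphere (0 : E) 1)) : Prop :=
  ∀ A : Set (sphere (0 : E) 1), MeasurableSet A → μ (-A) = μ A

/-- `conv (supp μ)` for a measure on the unit sphere. -/
def convSupport {E : Type*} [NormedAddCommGroup E] [InnerProductSpace ℝ E] [MeasurableSpace E]
    (μ : Measure (sphere (0 : E) 1)) : Set E :=
  convexHull ℝ ((fun u : sphere (0 : E) 1 => (u : E)) '' μ.support)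

/-- The unit cross-polytope `B_1^k`. -/
def crossPolytope (k : ℕ) : Set (EuclideanSpace ℝ (Fin k)) :=
  {x | ∑ i, |x i| ≤ 1}

/-- The unit cube `B_∞^k = [-1, 1]^k`. -/
def unitCube (k : ℕ) : Set (EuclideanSpace ℝ (Fin k)) :=
  {x | ∀ i, |x i| ≤ 1}

/-- `Δ` is a regular simplex in `ℝ^k` inscribed in the unit ball: a `k`-dimensional simplex, all of
whose edges have the same length and all of whose vertices are on the unit sphere. -/
def IsInscribedRegularSimplex (k : ℕ) (Δ : Set (EuclideanSpace ℝ (Fin k))) : Prop :=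
  ∃ s : Affine.Simplex ℝ (EuclideanSpace ℝ (Fin k)) k,
    s.Equilateral ∧ (∀ i, ‖s.points i‖ = 1) ∧ Δ = convexHull ℝ (Set.range s.points)

/-- `A` is the body `B ⊆ ℝ^k` placed in the `k`-dimensional Euclidean space `F`, that is,
`A = B` after an identification of `F` with `ℝ^k` by the choice of an orthonormal basis. -/
def IsCopyOf {k : ℕ} {F : Type*} [NormedAddCommGroup F] [InnerProductSpace ℝ F]
    (A : Set F) (B : Set (EuclideanSpace ℝ (Fin k))) : Prop :=
  ∃ φ : EuclideanSpace ℝ (Fin k) ≃ₗᵢ[ℝ] F, A = φ '' B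

/-- There is a regular simplex in `ℝ^k` inscribed in the unit ball, for every `k ≥ 1`. -/
theorem exists_isInscribedRegularSimplex (k : ℕ) (hk : 1 ≤ k) :
    ∃ Δ, IsInscribedRegularSimplex k Δ := by
  have hk0 : (0 : ℝ) < k := by exact_mod_cast hk
  obtain ⟨s, hs0, hs⟩ : ∃ s : ℝ, 0 < s ∧ s ^ 2 = 1 / k :=
    ⟨√(1 / k), by positivity, Real.sq_sqrt (by positivity)⟩
  obtain ⟨a, ha⟩ : ∃ a : ℝ, a ^ 2 = 1 + 1 / k := ⟨√(1 + 1 / k), Real.sq_sqrt (by positivity)⟩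
  obtain ⟨b, hb⟩ : ∃ b : ℝ, k * b = s - a := ⟨(s - a) / k, by field_simp⟩
  have hkinv : (k : ℝ) * (1 / k) = 1 := by field_simp
  have h1 : 2 * a * b + k * b ^ 2 = -(1 / k) := by
    have : (k : ℝ) * (2 * a * b + k * b ^ 2) = k * -(1 / k) := by
      have e : (k : ℝ) * (2 * a * b + k * b ^ 2) = 2 * a * (k * b) + (k * b) ^ 2 := by ring
      rw [e, hb]
      linarith
    exact mul_left_cancel₀ hk0.ne' this
  let v : Fin (k + 1) → EuclideanSpace ℝ (Fin k) :=
    Fin.cons (WithLp.toLp 2 fun _ => -s)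
      (fun i => WithLp.toLp 2 fun j => a * (if j = i then 1 else 0) + b)
  have hv0 : ∀ j, v 0 j = -s := fun j => rfl
  have hvs : ∀ i j, v (Fin.succ i) j = a * (if j = i then 1 else 0) + b := fun i j => rfl
  have hg : ∀ i j, ⟪v i, v j⟫ = if i = j then 1 else -(1 / (k : ℝ)) := by
    have key : ∀ i : Fin k, ∑ j : Fin k, -s * (a * (if j = i then 1 else 0) + b) = -(1 / k) := by
      intro i
      rw [← Finset.mul_sum, Finset.sum_add_distrib, ← Finset.mul_sum]
      simp only [Finset.sum_ite_eq', Finset.mem_univ, if_true, Finset.sum_const,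
        Finset.card_univ, Fintype.card_fin, nsmul_eq_mul]
      rw [hb]
      linarith
    intro i j
    rw [PiLp.inner_apply]
    simp only [RCLike.inner_apply, conj_trivial]
    refine Fin.cases ?_ (fun i => ?_) i <;> refine Fin.cases ?_ (fun j => ?_) j
    · simp only [hv0, Finset.sum_const, Finset.card_univ, Fintype.card_fin, nsmul_eq_mul, if_true]
      linear_combination k * hs + hkinv
    · simp only [hv0, hvs, (Fin.succ_ne_zero j).symm, if_false]
      rw [← key j]
      exact Finset.sum_congr rfl fun _ _ => by ring
    · simp only [hv0, hvs, Fin.succ_ne_zero i, if_false]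
      rw [← key i]
    · simp only [hvs, Fin.succ_inj]
      have e : ∀ x : Fin k, (a * (if x = j then 1 else 0) + b) * (a * (if x = i then 1 else 0) + b) =
          (if x = j then (if i = j then a ^ 2 else 0) + a * b else 0) +
            (if x = i then a * b else 0) + b ^ 2 := by
        intro x
        split_ifs <;> first | (exfalso; simp_all; done) | ring
      simp only [e, Finset.sum_add_distrib, Finset.sum_ite_eq', Finset.mem_univ, if_true,
        Finset.sum_const, Finset.card_univ, Fintype.card_fin, nsmul_eq_mul]
      split_ifs <;> linarith
  have hnorm : ∀ i, ‖v i‖ = 1 := by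
    intro i
    have h := hg i i
    rw [if_pos rfl, real_inner_self_eq_norm_sq] at h
    nlinarith [norm_nonneg (v i)]
  have haff : AffineIndependent ℝ v := by
    rw [affineIndependent_iff]
    intro t w hw hwv j hj
    have h := congrArg (fun x => ⟪x, v j⟫) hwv
    simp only [sum_inner, real_inner_smul_left, hg, inner_zero_left] at h
    have e : ∀ i ∈ t, w i * (if i = j then 1 else -(1 / (k : ℝ))) =
        (if i = j then (1 + 1 / (k : ℝ)) * w i else 0) - w i * (1 / (k : ℝ)) := by
      intro i _
      split_ifs <;> ring
    rw [Finset.sum_congr rfl e, Finset.sum_sub_distrib, ← Finset.sum_mul, hw,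
      Finset.sum_ite_eq', if_pos hj, zero_mul, sub_zero] at h
    exact (mul_eq_zero.1 h).resolve_left (by positivity)
  refine ⟨_, ⟨v, haff⟩, ⟨√(2 + 2 / k), ?_⟩, hnorm, rfl⟩
  intro i j hij
  have h := norm_sub_sq_real (v i) (v j)
  rw [hg i j, if_neg hij, hnorm, hnorm] at h
  rw [dist_eq_norm, ← Real.sqrt_sq (norm_nonneg (v i - v j)), h]
  congr 1
  ring

end

/-!
The mean width of a body is a dimensional constant times the mean of its support function under the
standard Gaussian measure (`meanWidth_eq_integral_stdGaussian`), so the three inequalities compare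
Gaussian means of support functions.

*Reduction to finitely many vectors.* By Carathéodory's theorem the isotropic centred measure may be
replaced by one which is supported on finitely many points `uᵢ` of its support, with weights `cᵢ` of
total weight `n` (`exists_isIdentityDecomposition_of_isIsotropic`). The projections `yᵢ` of the `uᵢ`
to `H` are centred and satisfy `∑ cᵢ yᵢ ⊗ yᵢ = Id`. They belong to the projection of `K`, and so do
the `-yᵢ` if the measure is even; in that case the section of the polar body is contained in the
intersection of the slabs `|⟨x, yᵢ⟩| ≤ 1`.

*The lower bounds.* The support function of the hull of the `±yᵢ` is `maxᵢ |⟨x, yᵢ⟩|`. The Gaussian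
measure of the set where it is less than `t` is that of an intersection of slabs, which the Gaussian
Brascamp-Lieb inequality bounds by a product of measures of intervals (`stdGaussian_real_le_prod`).
That inequality is proved by transport: monotone maps `Tᵢ` of the line push the Gaussian measures
conditioned to the intervals onto the Gaussian measure, and `x ↦ ∑ cᵢ Tᵢ(⟨x, vᵢ⟩) vᵢ`, for the
normalised vectors `vᵢ` and their weights, is a change of variables whose Jacobian is controlled by
the determinant inequality `IsIdentityDecomposition.prod_rpow_le_det`. Integration over the levels
`t`, the arithmetic-geometric mean inequality and the convexity of the cube of the norm as a
function of its square compare the expected maximum with the one for an orthogonal basis of vectors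
of length `√(k/n)` (`sqrt_mul_gaussianMax_le_integral_gaugeMax`). This is the inequality for the
cross-polytope. For the simplex the same argument, with half-lines in place of slabs, is applied to
the vectors `(yᵢ, 1/√n)` of `H × ℝ`: as the `yᵢ` are centred these decompose the identity, the extra
coordinate does not change the expected maximum, and orthogonality of the lifted vectors means that
the `yᵢ` are the vertices of a regular simplex.

*Equality.* Equality in the lower bounds forces equal lengths and, at some level `t > 0`, equality
in the Brascamp-Lieb inequality. Then `T(⟨x, vᵢ⟩)` is the linear function `⟨·, vᵢ⟩` of the
transported point for each `i`. As `T` blows up at the end of the interval, any two of the vectors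
are orthogonal or parallel (`inner_eq_zero_of_transport_rigid`). The body is the hull of the vectors
because the Gaussian mean of the support function is strictly monotone
(`eq_of_integral_supportFn_le`).

*The upper bound.* The support function of the intersection of the slabs is at most
`∑ cᵢ |⟨x, yᵢ⟩|`, whose Gaussian mean is evaluated exactly and estimated by the Cauchy-Schwarz
inequality (`le_unitCube_of_subset_slabIntersection`). Equality gives equal lengths and equality of
the two functions everywhere; at `x = yⱼ` this forces the other vectors to be orthogonal or parallel
to `yⱼ`.
-/

open ProbabilityTheory Filter Topology

/-! ### Transport of Gaussian measures on the line -/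

section GaussianTransport

theorem gaussianReal_real_pos_of_isOpen {J : Set ℝ} (hJ : IsOpen J) (hn : J.Nonempty) :
    0 < (gaussianReal 0 1).real J := by
  rw [measureReal_def, ENNReal.toReal_pos_iff]
  refine ⟨?_, measure_lt_top _ _⟩
  rw [pos_iff_ne_zero]
  intro h
  exact hJ.measure_ne_zero volume hn (gaussianReal_absolutelyContinuous' 0 one_ne_zero h)

theorem hasDerivAt_cdf_gaussianReal (x : ℝ) :
    HasDerivAt (cdf (gaussianReal 0 1)) (gaussianPDFReal 0 1 x) x := by
  have hc : Continuous (gaussianPDFReal 0 1) := by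
    unfold gaussianPDFReal; fun_prop
  have hint : ∀ s, IntegrableOn (gaussianPDFReal 0 1) s := fun s =>
    (integrable_gaussianPDFReal 0 1).integrableOn
  have e : (cdf (gaussianReal 0 1) : ℝ → ℝ) = fun y =>
      (∫ t in Set.Iic 0, gaussianPDFReal 0 1 t) + ∫ t in (0 : ℝ)..y, gaussianPDFReal 0 1 t := by
    funext y
    rw [← intervalIntegral.integral_Iic_sub_Iic (hint _) (hint _), cdf_eq_real, measureReal_def,
      gaussianReal_apply_eq_integral 0 one_ne_zero, ENNReal.toReal_ofReal]
    · ring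
    · exact integral_nonneg fun _ => gaussianPDFReal_nonneg _ _ _
  rw [e]
  exact (intervalIntegral.integral_hasDerivAt_right (hc.intervalIntegrable _ _)
    (hc.stronglyMeasurableAtFilter _ _) hc.continuousAt).const_add _

theorem strictMono_cdf_gaussianReal : StrictMono (cdf (gaussianReal 0 1)) :=
  strictMono_of_hasDerivAt_pos hasDerivAt_cdf_gaussianReal
    fun x => gaussianPDFReal_pos 0 1 x one_ne_zero

theorem continuous_cdf_gaussianReal : Continuous (cdf (gaussianReal 0 1)) :=
  continuous_iff_continuousAt.2 fun x => (hasDerivAt_cdf_gaussianReal x).continuousAt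

theorem exists_cdf_gaussianReal_eq {p : ℝ} (hp : p ∈ Set.Ioo (0 : ℝ) 1) :
    ∃ y, cdf (gaussianReal 0 1) y = p := by
  obtain ⟨a, ha⟩ := ((tendsto_cdf_atBot (gaussianReal 0 1)).eventually_lt_const hp.1).exists
  obtain ⟨b, hb⟩ := ((tendsto_cdf_atTop (gaussianReal 0 1)).eventually_const_lt hp.2).exists
  obtain ⟨y, -, hy⟩ := intermediate_value_uIcc (a := a) (b := b)
    (continuous_cdf_gaussianReal.continuousOn) (Set.mem_uIcc.2 (Or.inl ⟨ha.le, hb.le⟩))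
  exact ⟨y, hy⟩

theorem cdf_gaussianReal_mem_Ioo (y : ℝ) : cdf (gaussianReal 0 1) y ∈ Set.Ioo (0 : ℝ) 1 :=
  ⟨(cdf_nonneg _ (y - 1)).trans_lt (strictMono_cdf_gaussianReal (by linarith)),
    (strictMono_cdf_gaussianReal (by linarith : y < y + 1)).trans_le (cdf_le_one _ _)⟩

/-- The quantile function of the standard Gaussian measure of the line: the inverse of the
distribution function, with its derivative. -/
theorem exists_gaussian_quantile : ∃ Q : ℝ → ℝ,
    (∀ y, Q (cdf (gaussianReal 0 1) y) = y) ∧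
    (∀ p ∈ Set.Ioo (0 : ℝ) 1, cdf (gaussianReal 0 1) (Q p) = p) ∧
    ∀ p ∈ Set.Ioo (0 : ℝ) 1, HasDerivAt Q (gaussianPDFReal 0 1 (Q p))⁻¹ p := by
  choose! Q hQ using fun p (hp : p ∈ Set.Ioo (0 : ℝ) 1) => exists_cdf_gaussianReal_eq hp
  have hQl : ∀ y, Q (cdf (gaussianReal 0 1) y) = y := fun y =>
    strictMono_cdf_gaussianReal.injective (hQ _ (cdf_gaussianReal_mem_Ioo y))
  refine ⟨Q, hQl, hQ, fun p hp => ?_⟩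
  have hmono : StrictMonoOn Q (Set.Ioo 0 1) := by
    intro a ha b hb hab
    rw [← strictMono_cdf_gaussianReal.lt_iff_lt, hQ a ha, hQ b hb]
    exact hab
  have himg : Q '' Set.Ioo 0 1 = Set.univ :=
    Set.eq_univ_of_forall fun y => ⟨_, cdf_gaussianReal_mem_Ioo y, hQl y⟩
  have hcont : ContinuousAt Q p := hmono.continuousAt_of_image_mem_nhds (isOpen_Ioo.mem_nhds hp)
    (himg ▸ univ_mem)
  exact HasDerivAt.of_local_left_inverse hcont (hasDerivAt_cdf_gaussianReal _)
    (gaussianPDFReal_pos 0 1 _ one_ne_zero).ne'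
    (eventually_of_mem (isOpen_Ioo.mem_nhds hp) hQ)

/-- The monotone transport `T` of the standard Gaussian measure conditioned to a bounded above open
interval `J` onto the standard Gaussian measure of the line. The identity relating the two
densities is the change of variables equation, and `T` is unbounded above on `J`. -/
theorem exists_gaussian_transport {J : Set ℝ} (hJo : IsOpen J) (hJc : J.OrdConnected)
    (hJn : J.Nonempty) {τ : ℝ} (hτ : IsLUB J τ) :
    ∃ T T' : ℝ → ℝ, (∀ s ∈ J, HasDerivAt T (T' s) s ∧ 0 < T' s ∧
      gaussianPDFReal 0 1 s =
        (gaussianReal 0 1).real J * (T' s * gaussianPDFReal 0 1 (T s))) ∧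
      ∀ A, ∃ s ∈ J, A < T s := by
  obtain ⟨Q, hQl, hQr, hQd⟩ := exists_gaussian_quantile
  set γ := gaussianReal 0 1
  set Z := γ.real J
  have hZ : 0 < Z := gaussianReal_real_pos_of_isOpen hJo hJn
  -- the part of the line to the left of the interval
  set B : Set ℝ := {x | x ∉ J ∧ ∃ j ∈ J, x < j}
  have hIic : ∀ s ∈ J, cdf γ s - γ.real B = γ.real (J ∩ Set.Iic s) := by
    intro s hs
    have hB : Set.Iic s \ J = B := by
      ext x
      constructor
      · rintro ⟨hxs, hx⟩
        exact ⟨hx, s, hs, lt_of_le_of_ne hxs fun h => hx (h ▸ hs)⟩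
      · rintro ⟨hx, j, hj, hxj⟩
        refine ⟨?_, hx⟩
        by_contra hxs
        exact hx (hJc.out hs hj ⟨(not_le.1 hxs).le, hxj.le⟩)
    rw [cdf_eq_real, ← measureReal_inter_add_sdiff (s := Set.Iic s) hJo.measurableSet, hB,
      Set.inter_comm]
    ring
  have hIoi : ∀ s ∈ J, Z - (cdf γ s - γ.real B) = γ.real (J ∩ Set.Ioi s) := by
    intro s hs
    have h := measureReal_inter_add_sdiff (μ := γ) (s := J) (t := Set.Iic s) measurableSet_Iic
    rw [hIic s hs]
    have e : J \ Set.Iic s = J ∩ Set.Ioi s := by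
      ext x; simp
    rw [e] at h
    simp only [Z]
    linarith
  have hG : ∀ s ∈ J, (cdf γ s - γ.real B) / Z ∈ Set.Ioo (0 : ℝ) 1 := by
    intro s hs
    have hnhds := Metric.isOpen_iff.1 hJo s hs
    obtain ⟨ε, hε, hball⟩ := hnhds
    constructor
    · refine div_pos ?_ hZ
      rw [hIic s hs]
      refine (gaussianReal_real_pos_of_isOpen (hJo.inter isOpen_Iio)
        ⟨s - ε / 2, hball ?_, ?_⟩).trans_le
        (measureReal_mono (Set.inter_subset_inter_right _ (Set.Iio_subset_Iic_self (a := s))))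
      · rw [Metric.mem_ball, Real.dist_eq, abs_lt]; constructor <;> linarith
      · simp [hε]
    · rw [div_lt_one hZ, ← sub_pos, hIoi s hs]
      refine gaussianReal_real_pos_of_isOpen (hJo.inter isOpen_Ioi) ⟨s + ε / 2, hball ?_, ?_⟩
      · rw [Metric.mem_ball, Real.dist_eq, abs_lt]; constructor <;> linarith
      · simp [hε]
  refine ⟨fun s => Q ((cdf γ s - γ.real B) / Z),
    fun s => (gaussianPDFReal 0 1 (Q ((cdf γ s - γ.real B) / Z)))⁻¹ *
      (gaussianPDFReal 0 1 s / Z), fun s hs => ⟨?_, ?_, ?_⟩, fun A => ?_⟩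
  · exact (hQd _ (hG s hs)).comp s (((hasDerivAt_cdf_gaussianReal s).sub_const _).div_const _)
  · have h1 := gaussianPDFReal_pos 0 1 s one_ne_zero
    have h2 := gaussianPDFReal_pos 0 1 (Q ((cdf γ s - γ.real B) / Z)) one_ne_zero
    positivity
  · have h2 := (gaussianPDFReal_pos 0 1 (Q ((cdf γ s - γ.real B) / Z)) one_ne_zero).ne'
    field_simp
  -- `T s > A` once the mass of the part of `J` above `s` is less than `Z` times that of `(A, ∞)`
  · have hA := (cdf_gaussianReal_mem_Ioo A).2
    have hlim : ∀ᶠ s in 𝓝 τ, cdf γ τ - cdf γ s < Z * (1 - cdf γ A) := by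
      have : Tendsto (fun s => cdf γ τ - cdf γ s) (𝓝 τ) (𝓝 (cdf γ τ - cdf γ τ)) :=
        tendsto_const_nhds.sub (continuous_cdf_gaussianReal.tendsto τ)
      rw [sub_self] at this
      exact this.eventually_lt_const (mul_pos hZ (by linarith))
    obtain ⟨s, hs, hsJ⟩ := (hτ.frequently_mem hJn).and_eventually
      (mem_nhdsWithin_of_mem_nhds hlim) |>.exists
    refine ⟨s, hs, ?_⟩
    rw [← strictMono_cdf_gaussianReal.lt_iff_lt, hQr _ (hG s hs), lt_div_iff₀ hZ]
    have h1 : γ.real (J ∩ Set.Ioi s) ≤ cdf γ τ - cdf γ s := by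
      have h2 : γ.real (Set.Ioc s τ) = cdf γ τ - cdf γ s := by
        rw [← Set.Iic_sdiff_Iic, measureReal_sdiff (Set.Iic_subset_Iic.2 (hτ.1 hs))
          measurableSet_Iic, cdf_eq_real, cdf_eq_real]
      rw [← h2]
      exact measureReal_mono fun x hx => ⟨hx.2, hτ.1 hx.1⟩
    have h3 := hIoi s hs
    have h4 : cdf γ τ - cdf γ s < Z * (1 - cdf γ A) := hsJ
    have h5 : cdf (gaussianReal 0 1) A = cdf γ A := rfl
    rw [h5]
    nlinarith

end GaussianTransport

/-! ### The density of the standard Gaussian measure -/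

section GaussianDensity

variable (E : Type*) [NormedAddCommGroup E] [InnerProductSpace ℝ E]

/-- The density of the standard Gaussian measure of a Euclidean space. -/
noncomputable def stdGaussianDensity (x : E) : ℝ :=
  (√(2 * Real.pi))⁻¹ ^ finrank ℝ E * Real.exp (-‖x‖ ^ 2 / 2)

theorem stdGaussianDensity_pos (x : E) : 0 < stdGaussianDensity E x := by
  unfold stdGaussianDensity; positivity

theorem continuous_stdGaussianDensity : Continuous (stdGaussianDensity E) := by
  unfold stdGaussianDensity; fun_prop

variable [FiniteDimensional ℝ E] [MeasurableSpace E] [BorelSpace E]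

theorem integral_stdGaussianDensity : ∫ x, stdGaussianDensity E x = 1 := by
  unfold stdGaussianDensity
  rw [integral_const_mul]
  have h := GaussianFourier.integral_rexp_neg_mul_sq_norm (V := E) (b := 1 / 2) (by norm_num)
  have e : (fun x : E => Real.exp (-‖x‖ ^ 2 / 2)) = fun x => Real.exp (-(1 / 2) * ‖x‖ ^ 2) := by
    funext x; congr 1; ring
  rw [e, h, inv_pow, Real.sqrt_eq_rpow, ← Real.rpow_natCast, ← Real.rpow_mul (by positivity)]
  have e2 : Real.pi / (1 / 2) = 2 * Real.pi := by ring
  rw [e2, show 1 / 2 * (finrank ℝ E : ℝ) = finrank ℝ E / 2 by ring]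
  exact inv_mul_cancel₀ (by positivity)

theorem integrable_stdGaussianDensity : Integrable (stdGaussianDensity E) := by
  by_contra h
  have := integral_stdGaussianDensity E
  rw [integral_undef h] at this
  exact zero_ne_one this

/-- The standard Gaussian measure has the standard Gaussian density: both measures have the same
characteristic function. -/
theorem stdGaussian_eq_withDensity :
    stdGaussian E = volume.withDensity fun x => ENNReal.ofReal (stdGaussianDensity E x) := by
  have : IsFiniteMeasure (volume.withDensity fun x : E =>
      ENNReal.ofReal (stdGaussianDensity E x)) :=
    isFiniteMeasure_withDensity_ofReal (integrable_stdGaussianDensity E).2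
  refine Measure.ext_of_charFun ?_
  ext t
  rw [charFun_stdGaussian, charFun_apply, integral_withDensity_eq_integral_toReal_smul₀
    (continuous_stdGaussianDensity E).measurable.ennreal_ofReal.aemeasurable
    (ae_of_all _ fun _ => ENNReal.ofReal_lt_top)]
  simp only [ENNReal.toReal_ofReal (stdGaussianDensity_pos E _).le]
  have h := GaussianFourier.integral_cexp_neg_mul_sq_norm_add (V := E) (b := 1 / 2)
    (by norm_num) Complex.I t
  have h0 := GaussianFourier.integral_cexp_neg_mul_sq_norm_add (V := E) (b := 1 / 2)
    (by norm_num) 0 (0 : E)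
  have h1 : ((∫ x, stdGaussianDensity E x : ℝ) : ℂ) = 1 := by
    rw [integral_stdGaussianDensity]; simp
  have e : ∀ x : E, ((stdGaussianDensity E x : ℝ) : ℂ) =
      (((√(2 * Real.pi))⁻¹ ^ finrank ℝ E : ℝ) : ℂ) *
        Complex.exp (-(1 / 2) * ‖x‖ ^ 2 + 0 * ⟪(0 : E), x⟫) := by
    intro x
    unfold stdGaussianDensity
    push_cast
    congr 2
    ring
  rw [← integral_complex_ofReal] at h1
  simp only [e] at h1
  rw [integral_const_mul, h0] at h1
  have e2 : ∀ x : E, stdGaussianDensity E x • Complex.exp (⟪x, t⟫ * Complex.I) =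
      (((√(2 * Real.pi))⁻¹ ^ finrank ℝ E : ℝ) : ℂ) *
        Complex.exp (-(1 / 2) * ‖x‖ ^ 2 + Complex.I * ⟪t, x⟫) := by
    intro x
    rw [Complex.real_smul, e, mul_assoc, ← Complex.exp_add, real_inner_comm t x]
    congr 2
    simp
    ring
  simp only [e2]
  rw [integral_const_mul, h, ← mul_assoc]
  simp only [norm_zero] at h1
  have h2 : Complex.exp (0 ^ 2 * ((0 : ℝ) : ℂ) ^ 2 / (4 * (1 / 2))) = 1 := by simp
  rw [h2, mul_one] at h1
  rw [h1, one_mul, Complex.I_sq]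
  congr 1
  ring

instance isOpenPosMeasure_stdGaussian : (stdGaussian E).IsOpenPosMeasure := by
  have : (volume : Measure E) ≪ stdGaussian E := by
    rw [stdGaussian_eq_withDensity]
    refine withDensity_absolutelyContinuous' ?_ (ae_of_all _ fun x => ?_)
    · exact (continuous_stdGaussianDensity E).measurable.ennreal_ofReal.aemeasurable
    · simpa using stdGaussianDensity_pos E x
  exact this.isOpenPosMeasure

theorem stdGaussian_real_eq_setIntegral {A : Set E} (hA : MeasurableSet A) :
    (stdGaussian E).real A = ∫ x in A, stdGaussianDensity E x := by
  rw [stdGaussian_eq_withDensity, measureReal_def, withDensity_apply _ hA,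
    integral_eq_lintegral_of_nonneg_ae (ae_of_all _ fun x => (stdGaussianDensity_pos E x).le)
      (continuous_stdGaussianDensity E).aestronglyMeasurable]

end GaussianDensity

/-! ### Decompositions of the identity -/

section Decomposition

variable {E : Type*} [NormedAddCommGroup E] [InnerProductSpace ℝ E] {ι : Type*} [Fintype ι]

/-- A finite family of weighted vectors decomposes the identity: `∑ cᵢ vᵢ ⊗ vᵢ = Id`. -/
def IsIdentityDecomposition (c : ι → ℝ) (v : ι → E) : Prop :=
  ∀ x, ∑ i, (c i * ⟪x, v i⟫) • v i = x

variable {c : ι → ℝ} {v : ι → E}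

theorem IsIdentityDecomposition.sum_inner_mul_inner (h : IsIdentityDecomposition c v) (x y : E) :
    ∑ i, c i * ⟪x, v i⟫ * ⟪y, v i⟫ = ⟪x, y⟫ := by
  conv_rhs => rw [← h x, sum_inner]
  refine Finset.sum_congr rfl fun i _ => ?_
  rw [real_inner_smul_left, real_inner_comm (v i) y]

theorem IsIdentityDecomposition.sum_inner_sq (h : IsIdentityDecomposition c v) (x : E) :
    ∑ i, c i * ⟪x, v i⟫ ^ 2 = ‖x‖ ^ 2 := by
  rw [← real_inner_self_eq_norm_sq, ← h.sum_inner_mul_inner x x]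
  exact Finset.sum_congr rfl fun i _ => by ring

/-- The trace of the identity. -/
theorem IsIdentityDecomposition.sum_norm_sq [FiniteDimensional ℝ E]
    (h : IsIdentityDecomposition c v) :
    ∑ i, c i * ‖v i‖ ^ 2 = finrank ℝ E := by
  have b := stdOrthonormalBasis ℝ E
  calc ∑ i, c i * ‖v i‖ ^ 2 = ∑ i, c i * ∑ j, ⟪b j, v i⟫ ^ 2 := by
        refine Finset.sum_congr rfl fun i _ => ?_
        rw [← b.sum_sq_norm_inner_right (v i)]
        simp
    _ = ∑ j, ∑ i, c i * ⟪b j, v i⟫ ^ 2 := by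
        simp only [Finset.mul_sum]
        exact Finset.sum_comm
    _ = finrank ℝ E := by
        simp [h.sum_inner_sq]

/-- `|∑ cᵢ aᵢ vᵢ|² ≤ ∑ cᵢ aᵢ²`, with the defect as a sum of squares. -/
theorem IsIdentityDecomposition.sum_sq_sub_norm_sq (h : IsIdentityDecomposition c v) (a : ι → ℝ) :
    ∑ i, c i * a i ^ 2 - ‖∑ i, (c i * a i) • v i‖ ^ 2 =
      ∑ i, c i * (a i - ⟪∑ j, (c j * a j) • v j, v i⟫) ^ 2 := by
  set y := ∑ j, (c j * a j) • v j with hy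
  have h1 : ∑ i, c i * a i * ⟪y, v i⟫ = ‖y‖ ^ 2 := by
    rw [← real_inner_self_eq_norm_sq]
    nth_rw 3 [hy]
    rw [inner_sum]
    exact Finset.sum_congr rfl fun i _ => by rw [real_inner_smul_right]
  have h2 := h.sum_inner_sq y
  have e : ∀ i ∈ Finset.univ, c i * (a i - ⟪y, v i⟫) ^ 2 =
      c i * a i ^ 2 - 2 * (c i * a i * ⟪y, v i⟫) + c i * ⟪y, v i⟫ ^ 2 := fun i _ => by ring
  rw [Finset.sum_congr rfl e, Finset.sum_add_distrib, Finset.sum_sub_distrib, ← Finset.mul_sum,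
    h1, h2]
  ring

/-- The determinant inequality `∏ τᵢ ^ cᵢ ≤ det (∑ cᵢ τᵢ vᵢ ⊗ vᵢ)` for a decomposition of the
identity by unit vectors: the weighted arithmetic-geometric mean inequality, applied to the
eigenvalues. -/
theorem IsIdentityDecomposition.prod_rpow_le_det [FiniteDimensional ℝ E]
    (h : IsIdentityDecomposition c v)
    (hc : ∀ i, 0 ≤ c i) (hv : ∀ i, ‖v i‖ = 1) {τ : ι → ℝ} (hτ : ∀ i, 0 < τ i) {A : E →ₗ[ℝ] E}
    (hA : ∀ x, A x = ∑ i, (c i * τ i * ⟪x, v i⟫) • v i) :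
    ∏ i, τ i ^ c i ≤ LinearMap.det A := by
  have hsymm : A.IsSymmetric := by
    intro x y
    rw [hA, hA, sum_inner, inner_sum]
    refine Finset.sum_congr rfl fun i _ => ?_
    rw [real_inner_smul_left, real_inner_smul_right, real_inner_comm y (v i)]
    ring
  set b := hsymm.eigenvectorBasis rfl
  have hb : ∀ j, ‖b j‖ = 1 := b.orthonormal.1
  -- an eigenvalue is an average of the `τᵢ`, with the weights `cᵢ ⟨bⱼ, vᵢ⟩²`
  have hlam : ∀ j, hsymm.eigenvalues rfl j = ∑ i, (c i * ⟪b j, v i⟫ ^ 2) * τ i := by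
    intro j
    have h1 : ⟪A (b j), b j⟫ = hsymm.eigenvalues rfl j := by
      rw [hsymm.apply_eigenvectorBasis, real_inner_smul_left, real_inner_self_eq_norm_sq, hb]
      simp
    rw [← h1, hA, sum_inner]
    refine Finset.sum_congr rfl fun i _ => ?_
    rw [real_inner_smul_left, real_inner_comm (b j) (v i)]
    ring
  have hamgm : ∀ j, ∏ i, τ i ^ (c i * ⟪b j, v i⟫ ^ 2) ≤ hsymm.eigenvalues rfl j := by
    intro j
    rw [hlam]
    refine Real.geom_mean_le_arith_mean_weighted _ _ _ (fun i _ => ?_) ?_ fun i _ => (hτ i).le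
    · exact mul_nonneg (hc i) (sq_nonneg _)
    · rw [h.sum_inner_sq, hb, one_pow]
  calc ∏ i, τ i ^ c i = ∏ i, τ i ^ (∑ j, c i * ⟪b j, v i⟫ ^ 2) := by
        refine Finset.prod_congr rfl fun i _ => ?_
        rw [← Finset.mul_sum]
        have := b.sum_sq_norm_inner_right (v i)
        simp only [Real.norm_eq_abs, sq_abs, hv, one_pow] at this
        rw [this, mul_one]
    _ = ∏ j, ∏ i, τ i ^ (c i * ⟪b j, v i⟫ ^ 2) := by
        rw [Finset.prod_comm]
        exact Finset.prod_congr rfl fun i _ => Real.rpow_sum_of_pos (hτ i) _ _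
    _ ≤ ∏ j, hsymm.eigenvalues rfl j :=
        Finset.prod_le_prod (fun j _ => Finset.prod_nonneg fun i _ =>
          Real.rpow_nonneg (hτ i).le _) fun j _ => hamgm j
    _ = LinearMap.det A := by
        rw [hsymm.det_eq_prod_eigenvalues rfl]
        simp

end Decomposition

/-! ### The Gaussian Brascamp-Lieb inequality for slabs -/

section BrascampLieb

/-- The standard Gaussian density of a space of dimension `m = ∑ cᵢ` factors through the weighted
product of one-dimensional densities: for `aᵢ = ⟨x, vᵢ⟩` the exponent is `-|x|²/2`. -/
theorem prod_gaussianPDFReal_rpow {ι : Type*} [Fintype ι] {c : ι → ℝ} {m : ℕ}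
    (hc : ∑ i, c i = m) (a : ι → ℝ) :
    ∏ i, gaussianPDFReal 0 1 (a i) ^ c i =
      (√(2 * Real.pi))⁻¹ ^ m * Real.exp (-(∑ i, c i * a i ^ 2) / 2) := by
  have e : ∀ i, gaussianPDFReal 0 1 (a i) ^ c i =
      (√(2 * Real.pi))⁻¹ ^ c i * Real.exp (-(c i * a i ^ 2) / 2) := by
    intro i
    rw [gaussianPDFReal_def]
    simp only [NNReal.coe_one, mul_one, sub_zero]
    rw [Real.mul_rpow (by positivity) (Real.exp_pos _).le, ← Real.exp_mul]
    congr 2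
    ring
  rw [Finset.prod_congr rfl fun i _ => e i, Finset.prod_mul_distrib,
    ← Real.rpow_sum_of_pos (by positivity), hc, Real.rpow_natCast, ← Real.exp_sum,
    ← Finset.sum_div, Finset.sum_neg_distrib]

variable {E : Type*} [NormedAddCommGroup E] [InnerProductSpace ℝ E] {ι : Type*} [Fintype ι]
  {c : ι → ℝ} {v : ι → E} {J : ι → Set ℝ} {Z : ι → ℝ} {T T' : ι → ℝ → ℝ}

/-- The map `x ↦ ∑ cᵢ Tᵢ(⟨x, vᵢ⟩) vᵢ` assembled from maps of the line. -/
noncomputable def assembledMap (c : ι → ℝ) (v : ι → E) (T : ι → ℝ → ℝ) (x : E) : E :=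
  ∑ i, (c i * T i ⟪x, v i⟫) • v i

/-- The derivative of `assembledMap`. -/
noncomputable def assembledDeriv (c : ι → ℝ) (v : ι → E) (T' : ι → ℝ → ℝ) (x : E) : E →L[ℝ] E :=
  ∑ i, (c i * T' i ⟪x, v i⟫) • (innerSL ℝ (v i)).smulRight (v i)

theorem hasFDerivAt_assembledMap {x : E} (hT : ∀ i, HasDerivAt (T i) (T' i ⟪x, v i⟫) ⟪x, v i⟫) :
    HasFDerivAt (assembledMap c v T) (assembledDeriv c v T' x) x := by
  unfold assembledMap assembledDeriv
  refine HasFDerivAt.fun_sum fun i _ => ?_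
  have h1 : HasFDerivAt (fun y : E => ⟪y, v i⟫) (innerSL ℝ (v i)) x := by
    have : (fun y : E => ⟪y, v i⟫) = innerSL ℝ (v i) := by
      funext y; rw [innerSL_apply_apply, real_inner_comm]
    rw [this]
    exact (innerSL ℝ (v i)).hasFDerivAt
  have h2 := (((hT i).comp_hasFDerivAt x h1).const_mul (c i)).smul_const (v i)
  refine h2.congr_fderiv ?_
  ext y
  simp [smul_smul]

/-- Injectivity is monotonicity: `⟨A x - A y, x - y⟩` is a sum of nonnegative terms, which vanish
only if `⟨x, vᵢ⟩ = ⟨y, vᵢ⟩` for all `i`. -/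
theorem injOn_assembledMap (h : IsIdentityDecomposition c v) (hc : ∀ i, 0 < c i)
    (hT : ∀ i, StrictMonoOn (T i) (J i)) :
    Set.InjOn (assembledMap c v T) {x | ∀ i, ⟪x, v i⟫ ∈ J i} := by
  intro x hx y hy hxy
  have hnn : ∀ i, 0 ≤ c i * ((T i ⟪x, v i⟫ - T i ⟪y, v i⟫) * (⟪x, v i⟫ - ⟪y, v i⟫)) := by
    intro i
    refine mul_nonneg (hc i).le ?_
    rcases le_total ⟪x, v i⟫ ⟪y, v i⟫ with hle | hle
    · exact mul_nonneg_of_nonpos_of_nonpos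
        (sub_nonpos.2 ((hT i).monotoneOn (hx i) (hy i) hle)) (sub_nonpos.2 hle)
    · exact mul_nonneg (sub_nonneg.2 ((hT i).monotoneOn (hy i) (hx i) hle)) (sub_nonneg.2 hle)
  have hsum : ∑ i, c i * ((T i ⟪x, v i⟫ - T i ⟪y, v i⟫) * (⟪x, v i⟫ - ⟪y, v i⟫)) = 0 := by
    have h0 : ⟪assembledMap c v T x - assembledMap c v T y, x - y⟫ = 0 := by
      rw [hxy, sub_self, inner_zero_left]
    rw [← h0]
    unfold assembledMap
    rw [← Finset.sum_sub_distrib, sum_inner]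
    refine Finset.sum_congr rfl fun i _ => ?_
    rw [← sub_smul, real_inner_smul_left, real_inner_comm (x - y), inner_sub_left]
    ring
  have hzero := (Finset.sum_eq_zero_iff_of_nonneg fun i _ => hnn i).1 hsum
  have heq : ∀ i, ⟪x, v i⟫ = ⟪y, v i⟫ := by
    intro i
    have h1 := (mul_eq_zero.1 (hzero i (Finset.mem_univ i))).resolve_left (hc i).ne'
    rcases mul_eq_zero.1 h1 with h2 | h2
    · exact (hT i).injOn (hx i) (hy i) (sub_eq_zero.1 h2)
    · exact sub_eq_zero.1 h2
  rw [← h x, ← h y]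
  exact Finset.sum_congr rfl fun i _ => by rw [heq i]

variable [FiniteDimensional ℝ E]

/-- The pointwise form of the transport argument for the Brascamp-Lieb inequality. The exponential
factor records the defect in `|∑ cᵢ tᵢ vᵢ|² ≤ ∑ cᵢ tᵢ²`. -/
theorem stdGaussianDensity_le_transport (h : IsIdentityDecomposition c v) (hc : ∀ i, 0 < c i)
    (hv : ∀ i, ‖v i‖ = 1) (hZ : ∀ i, 0 < Z i) {x : E}
    (hT' : ∀ i, 0 < T' i ⟪x, v i⟫)
    (hφ : ∀ i, gaussianPDFReal 0 1 ⟪x, v i⟫ =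
      Z i * (T' i ⟪x, v i⟫ * gaussianPDFReal 0 1 (T i ⟪x, v i⟫))) :
    stdGaussianDensity E x ≤ (∏ i, Z i ^ c i) *
      (|(assembledDeriv c v T' x).det| * stdGaussianDensity E (assembledMap c v T x)) *
      Real.exp (-(∑ i, c i * (T i ⟪x, v i⟫ - ⟪assembledMap c v T x, v i⟫) ^ 2) / 2) := by
  have hsum : ∑ i, c i = (finrank ℝ E : ℝ) := by
    rw [← h.sum_norm_sq]; simp [hv]
  have hD : stdGaussianDensity E x = ∏ i, gaussianPDFReal 0 1 ⟪x, v i⟫ ^ c i := by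
    rw [prod_gaussianPDFReal_rpow hsum, h.sum_inner_sq, stdGaussianDensity]
  have hprod : ∏ i, gaussianPDFReal 0 1 ⟪x, v i⟫ ^ c i =
      (∏ i, Z i ^ c i) * ((∏ i, T' i ⟪x, v i⟫ ^ c i) *
        ∏ i, gaussianPDFReal 0 1 (T i ⟪x, v i⟫) ^ c i) := by
    rw [← Finset.prod_mul_distrib, ← Finset.prod_mul_distrib]
    refine Finset.prod_congr rfl fun i _ => ?_
    have hp := gaussianPDFReal_pos 0 1 (T i ⟪x, v i⟫) one_ne_zero
    rw [hφ i, Real.mul_rpow (hZ i).le (mul_pos (hT' i) hp).le, Real.mul_rpow (hT' i).le hp.le]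
  have hdet : ∏ i, T' i ⟪x, v i⟫ ^ c i ≤ |(assembledDeriv c v T' x).det| := by
    refine (h.prod_rpow_le_det (fun i => (hc i).le) hv hT' (A := (assembledDeriv c v T' x :
      E →ₗ[ℝ] E)) fun y => ?_).trans (le_abs_self _)
    simp only [assembledDeriv, ContinuousLinearMap.coe_coe]
    rw [_root_.sum_apply]
    refine Finset.sum_congr rfl fun i _ => ?_
    simp [smul_smul, real_inner_comm]
  have hdef := h.sum_sq_sub_norm_sq fun i => T i ⟪x, v i⟫
  have hexp : Real.exp (-(∑ i, c i * T i ⟪x, v i⟫ ^ 2) / 2) =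
      Real.exp (-‖assembledMap c v T x‖ ^ 2 / 2) * Real.exp
        (-(∑ i, c i * (T i ⟪x, v i⟫ - ⟪assembledMap c v T x, v i⟫) ^ 2) / 2) := by
    rw [← Real.exp_add]
    congr 1
    unfold assembledMap
    linarith
  rw [hD, hprod, prod_gaussianPDFReal_rpow hsum, hexp, stdGaussianDensity, mul_assoc]
  have hP : 0 ≤ ∏ i, Z i ^ c i := Finset.prod_nonneg fun i _ => Real.rpow_nonneg (hZ i).le _
  refine mul_le_mul_of_nonneg_left ?_ hP
  rw [← mul_assoc ((√(2 * Real.pi))⁻¹ ^ finrank ℝ E), ← mul_assoc]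
  gcongr

variable [MeasurableSpace E] [BorelSpace E]

/-- The Gaussian Brascamp-Lieb inequality for slabs: the inequality, and the rigidity of the
transport map in the case of equality. -/
theorem stdGaussian_real_le_prod (h : IsIdentityDecomposition c v) (hc : ∀ i, 0 < c i)
    (hv : ∀ i, ‖v i‖ = 1) (hZ : ∀ i, 0 < Z i) (hJo : ∀ i, IsOpen (J i))
    (hJc : ∀ i, (J i).OrdConnected)
    (hT : ∀ i, ∀ s ∈ J i, HasDerivAt (T i) (T' i s) s ∧ 0 < T' i s ∧
      gaussianPDFReal 0 1 s = Z i * (T' i s * gaussianPDFReal 0 1 (T i s))) :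
    (stdGaussian E).real {x | ∀ i, ⟪x, v i⟫ ∈ J i} ≤ ∏ i, Z i ^ c i ∧
    ((stdGaussian E).real {x | ∀ i, ⟪x, v i⟫ ∈ J i} = ∏ i, Z i ^ c i →
      ∀ x, (∀ i, ⟪x, v i⟫ ∈ J i) → ∀ i, T i ⟪x, v i⟫ = ⟪assembledMap c v T x, v i⟫) := by
  set Ω : Set E := {x | ∀ i, ⟪x, v i⟫ ∈ J i} with hΩ
  set P := ∏ i, Z i ^ c i with hPdef
  have hΩo : IsOpen Ω := by
    have : Ω = ⋂ i, (fun x : E => ⟪x, v i⟫) ⁻¹' J i := by ext; simp [hΩ]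
    rw [this]
    exact isOpen_iInter_of_finite fun i => (hJo i).preimage (by fun_prop)
  have hmono : ∀ i, StrictMonoOn (T i) (J i) := fun i => by
    refine strictMonoOn_of_deriv_pos (hJc i).convex
      (fun s hs => (hT i s hs).1.continuousAt.continuousWithinAt) fun s hs => ?_
    rw [(hT i s (interior_subset hs)).1.deriv]
    exact (hT i s (interior_subset hs)).2.1
  have hderiv : ∀ x ∈ Ω, HasFDerivWithinAt (assembledMap c v T) (assembledDeriv c v T' x) Ω x :=
    fun x hx => (hasFDerivAt_assembledMap fun i => (hT i _ (hx i)).1).hasFDerivWithinAt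
  have hinj : Set.InjOn (assembledMap c v T) Ω := injOn_assembledMap h hc hmono
  have hint : IntegrableOn (fun x => |(assembledDeriv c v T' x).det| *
      stdGaussianDensity E (assembledMap c v T x)) Ω := by
    have := (integrableOn_image_iff_integrableOn_abs_det_fderiv_smul volume hΩo.measurableSet
      hderiv hinj (stdGaussianDensity E)).1 (integrable_stdGaussianDensity E).integrableOn
    simpa only [smul_eq_mul] using this
  -- change of variables: the left side is the Gaussian measure of the image of `Ω`
  have hle1 : ∫ x in Ω, |(assembledDeriv c v T' x).det| *
      stdGaussianDensity E (assembledMap c v T x) ≤ 1 := by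
    have := integral_image_eq_integral_abs_det_fderiv_smul volume hΩo.measurableSet
      hderiv hinj (stdGaussianDensity E)
    simp only [smul_eq_mul] at this
    rw [← this, ← integral_stdGaussianDensity E]
    exact setIntegral_le_integral (integrable_stdGaussianDensity E)
      (ae_of_all _ fun x => (stdGaussianDensity_pos E x).le)
  have hP : 0 < P := Finset.prod_pos fun i _ => Real.rpow_pos_of_pos (hZ i) _
  have hpt : ∀ x ∈ Ω, stdGaussianDensity E x ≤ P *
      (|(assembledDeriv c v T' x).det| * stdGaussianDensity E (assembledMap c v T x)) *
      Real.exp (-(∑ i, c i * (T i ⟪x, v i⟫ - ⟪assembledMap c v T x, v i⟫) ^ 2) / 2) :=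
    fun x hx => stdGaussianDensity_le_transport h hc hv hZ (fun i => (hT i _ (hx i)).2.1)
      fun i => (hT i _ (hx i)).2.2
  have hdefnn : ∀ x, 0 ≤ ∑ i, c i * (T i ⟪x, v i⟫ - ⟪assembledMap c v T x, v i⟫) ^ 2 := fun x =>
    Finset.sum_nonneg fun i _ => mul_nonneg (hc i).le (sq_nonneg _)
  have hpt' : ∀ x ∈ Ω, stdGaussianDensity E x ≤ P *
      (|(assembledDeriv c v T' x).det| * stdGaussianDensity E (assembledMap c v T x)) := by
    intro x hx
    refine (hpt x hx).trans (mul_le_of_le_one_right ?_ ?_)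
    · have := (stdGaussianDensity_pos E (assembledMap c v T x)).le
      positivity
    · rw [Real.exp_le_one_iff]
      linarith [hdefnn x]
  have hDint : IntegrableOn (stdGaussianDensity E) Ω :=
    (integrable_stdGaussianDensity E).integrableOn
  rw [stdGaussian_real_eq_setIntegral E hΩo.measurableSet]
  refine ⟨?_, fun heq => ?_⟩
  · calc ∫ x in Ω, stdGaussianDensity E x
        ≤ ∫ x in Ω, P * (|(assembledDeriv c v T' x).det| *
          stdGaussianDensity E (assembledMap c v T x)) :=
          setIntegral_mono_on hDint (hint.const_mul P) hΩo.measurableSet hpt'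
      _ ≤ P := by
          rw [integral_const_mul]
          exact mul_le_of_le_one_right hP.le hle1
  -- equality forces the exponential factor to be `1` almost everywhere, hence everywhere by
  -- continuity
  · have hae : ∀ᵐ x ∂(volume.restrict Ω), P * (|(assembledDeriv c v T' x).det| *
        stdGaussianDensity E (assembledMap c v T x)) - stdGaussianDensity E x = 0 := by
      have hnn : 0 ≤ᵐ[volume.restrict Ω] fun x => P * (|(assembledDeriv c v T' x).det| *
          stdGaussianDensity E (assembledMap c v T x)) - stdGaussianDensity E x := by
        filter_upwards [ae_restrict_mem hΩo.measurableSet] with x hx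
        exact sub_nonneg.2 (hpt' x hx)
      refine (integral_eq_zero_iff_of_nonneg_ae hnn ((hint.const_mul P).sub hDint)).1
        (le_antisymm ?_ (integral_nonneg_of_ae hnn))
      rw [integral_sub (hint.const_mul P) hDint, heq, integral_const_mul]
      have := mul_le_of_le_one_right hP.le hle1
      linarith
    have hdef : (fun x => ∑ i, c i * (T i ⟪x, v i⟫ - ⟪assembledMap c v T x, v i⟫) ^ 2)
        =ᵐ[volume.restrict Ω] fun _ => 0 := by
      filter_upwards [hae, ae_restrict_mem hΩo.measurableSet] with x hx hxΩ
      have h1 := hpt x hxΩ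
      rw [sub_eq_zero.1 hx] at h1
      have h2 := Real.one_le_exp_iff.1 (one_le_of_le_mul_left₀ (stdGaussianDensity_pos E x) h1)
      linarith [hdefnn x]
    have hcont : ContinuousOn (assembledMap c v T) Ω := fun x hx =>
      (hderiv x hx).continuousWithinAt
    have hTc : ∀ i, ContinuousOn (fun x : E => T i ⟪x, v i⟫) Ω := fun i x hx =>
      (ContinuousAt.comp (f := fun x : E => ⟪x, v i⟫) (hT i _ (hx i)).1.continuousAt
        (by fun_prop)).continuousWithinAt
    have hall := Measure.eqOn_open_of_ae_eq hdef hΩo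
      (continuousOn_finsetSum _ fun i _ => continuousOn_const.mul
        (((hTc i).sub (hcont.inner continuousOn_const)).pow 2)) continuousOn_const
    intro x hx i
    have h1 := (Finset.sum_eq_zero_iff_of_nonneg fun i _ =>
      mul_nonneg (hc i).le (sq_nonneg _)).1 (hall hx) i (Finset.mem_univ i)
    have h2 := (mul_eq_zero.1 h1).resolve_left (hc i).ne'
    exact sub_eq_zero.1 (pow_eq_zero_iff two_ne_zero |>.1 h2)

end BrascampLieb

/-! ### Means and distribution functions -/

section LayerCake

variable {α : Type*} [MeasurableSpace α] {γ : Measure α}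

theorem integrableOn_measureReal_lt [IsFiniteMeasure γ] {f : α → ℝ} (hf : Integrable f γ)
    (hnn : 0 ≤ f) : IntegrableOn (fun t => γ.real {a | t < f a}) (Set.Ioi 0) := by
  have hanti : Antitone fun t => γ.real {a | t < f a} := fun s t hst =>
    measureReal_mono fun a ha => hst.trans_lt ha
  refine ⟨hanti.measurable.aestronglyMeasurable, ?_⟩
  rw [hasFiniteIntegral_iff_ofReal (ae_of_all _ fun t => measureReal_nonneg)]
  have h := lintegral_eq_lintegral_meas_lt γ (ae_of_all _ hnn) hf.aemeasurable
  have hfin : ∫⁻ a, ENNReal.ofReal (f a) ∂γ < ⊤ := hf.lintegral_lt_top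
  rw [h] at hfin
  refine lt_of_eq_of_lt (lintegral_congr fun t => ?_) hfin
  rw [measureReal_def, ENNReal.ofReal_toReal (measure_ne_top _ _)]

/-- The layer cake formula for a signed function, in terms of its distribution function. -/
theorem integral_eq_integral_measureReal_lt [IsProbabilityMeasure γ] {f : α → ℝ}
    (hfm : Measurable f) (hf : Integrable f γ) :
    IntegrableOn (fun t => 1 - γ.real {a | f a < t}) (Set.Ioi 0) ∧
    IntegrableOn (fun t => γ.real {a | f a < -t}) (Set.Ioi 0) ∧
    ∫ a, f a ∂γ = (∫ t in Set.Ioi 0, (1 - γ.real {a | f a < t})) -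
      ∫ t in Set.Ioi 0, γ.real {a | f a < -t} := by
  have hp : Integrable (fun a => max (f a) 0) γ := hf.pos_part
  have hn : Integrable (fun a => max (-f a) 0) γ := hf.neg_part
  have hpnn : 0 ≤ fun a => max (f a) 0 := fun a => le_max_right _ _
  have hnnn : 0 ≤ fun a => max (-f a) 0 := fun a => le_max_right _ _
  have e1 : (fun t => γ.real {a | t < max (f a) 0}) =ᵐ[volume.restrict (Set.Ioi 0)]
      fun t => 1 - γ.real {a | f a < t} := by
    filter_upwards [meas_le_ae_eq_meas_lt γ (volume.restrict (Set.Ioi 0)) (fun a => max (f a) 0),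
      ae_restrict_mem measurableSet_Ioi] with t ht ht0
    rw [measureReal_def, ← ht, ← measureReal_def, ← probReal_compl_eq_one_sub
      (measurableSet_lt hfm measurable_const)]
    congr 1
    ext a
    have : ¬ t ≤ 0 := not_le.2 ht0
    simp [this]
  have e2 : (fun t => γ.real {a | t < max (-f a) 0}) =ᵐ[volume.restrict (Set.Ioi 0)]
      fun t => γ.real {a | f a < -t} := by
    filter_upwards [ae_restrict_mem measurableSet_Ioi] with t ht0
    congr 1
    ext a
    have : ¬ t < 0 := not_lt.2 (le_of_lt ht0)
    simp only [lt_max_iff, this, or_false, Set.mem_ofPred_eq]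
    constructor <;> intro h <;> linarith
  refine ⟨(integrableOn_measureReal_lt hp hpnn).congr e1,
    (integrableOn_measureReal_lt hn hnnn).congr e2, ?_⟩
  rw [← integral_congr_ae e1, ← integral_congr_ae e2,
    ← hp.integral_eq_integral_meas_lt (ae_of_all _ hpnn),
    ← hn.integral_eq_integral_meas_lt (ae_of_all _ hnnn), ← integral_sub hp hn]
  refine integral_congr_ae (ae_of_all _ fun a => ?_)
  simp only
  rcases le_total 0 (f a) with h | h
  · rw [max_eq_left h, max_eq_right (by linarith), sub_zero]
  · rw [max_eq_right h, max_eq_left (by linarith)]; ring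

/-- Comparison of means from comparison of distribution functions with a mixture. In the case of
equality the distribution functions agree at almost every positive level. -/
theorem sum_mul_integral_le_of_measureReal_lt_le [IsProbabilityMeasure γ] {β : Type*}
    [MeasurableSpace β] {ν : Measure β} [IsProbabilityMeasure ν] {ι : Type*} [Fintype ι]
    {p : ι → ℝ} (hp1 : ∑ i, p i = 1) {f : α → ℝ} {F : ι → β → ℝ}
    (hfm : Measurable f) (hf : Integrable f γ) (hFm : ∀ i, Measurable (F i))
    (hF : ∀ i, Integrable (F i) ν)
    (hle : ∀ t, γ.real {a | f a < t} ≤ ∑ i, p i * ν.real {b | F i b < t}) :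
    ∑ i, p i * ∫ b, F i b ∂ν ≤ ∫ a, f a ∂γ ∧
    (∑ i, p i * ∫ b, F i b ∂ν = ∫ a, f a ∂γ → ∀ᵐ t ∂(volume.restrict (Set.Ioi (0 : ℝ))),
      γ.real {a | f a < t} = ∑ i, p i * ν.real {b | F i b < t}) := by
  obtain ⟨hf1, hf2, hf3⟩ := integral_eq_integral_measureReal_lt hfm hf
  have hFi := fun i => integral_eq_integral_measureReal_lt (hFm i) (hF i)
  have hA1 : ∀ t, ∑ i, p i * (1 - ν.real {b | F i b < t}) =
      1 - ∑ i, p i * ν.real {b | F i b < t} := by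
    intro t
    simp only [mul_sub, mul_one, Finset.sum_sub_distrib, hp1]
  have hint1 : IntegrableOn (fun t => 1 - ∑ i, p i * ν.real {b | F i b < t}) (Set.Ioi 0) := by
    simp only [← hA1]
    exact integrable_finsetSum _ fun i _ => (hFi i).1.const_mul (p i)
  have hint2 : IntegrableOn (fun t => ∑ i, p i * ν.real {b | F i b < -t}) (Set.Ioi 0) :=
    integrable_finsetSum _ fun i _ => (hFi i).2.1.const_mul (p i)
  have hsum : ∑ i, p i * ∫ b, F i b ∂ν =
      (∫ t in Set.Ioi 0, (1 - ∑ i, p i * ν.real {b | F i b < t})) -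
        ∫ t in Set.Ioi 0, ∑ i, p i * ν.real {b | F i b < -t} := by
    simp only [← hA1]
    rw [integral_finsetSum _ fun i _ => (hFi i).1.const_mul (p i),
      integral_finsetSum _ fun i _ => (hFi i).2.1.const_mul (p i), ← Finset.sum_sub_distrib]
    refine Finset.sum_congr rfl fun i _ => ?_
    rw [(hFi i).2.2, integral_const_mul, integral_const_mul]
    ring
  have hle1 : ∫ t in Set.Ioi 0, (1 - ∑ i, p i * ν.real {b | F i b < t}) ≤
      ∫ t in Set.Ioi 0, (1 - γ.real {a | f a < t}) :=
    integral_mono hint1 hf1 fun t => sub_le_sub_left (hle t) 1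
  have hle2 : ∫ t in Set.Ioi 0, γ.real {a | f a < -t} ≤
      ∫ t in Set.Ioi 0, ∑ i, p i * ν.real {b | F i b < -t} :=
    integral_mono hf2 hint2 fun t => hle (-t)
  refine ⟨by rw [hsum, hf3]; linarith, fun heq => ?_⟩
  rw [hsum, hf3] at heq
  have hnn : 0 ≤ᵐ[volume.restrict (Set.Ioi 0)] fun t => (1 - γ.real {a | f a < t}) -
      (1 - ∑ i, p i * ν.real {b | F i b < t}) :=
    ae_of_all _ fun t => sub_nonneg.2 (sub_le_sub_left (hle t) 1)
  have hz := (integral_eq_zero_iff_of_nonneg_ae hnn (hf1.sub hint1)).1 (by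
    rw [integral_sub hf1 hint1]; linarith)
  filter_upwards [hz] with t ht
  have : (1 - γ.real {a | f a < t}) - (1 - ∑ i, p i * ν.real {b | F i b < t}) = 0 := ht
  linarith

end LayerCake

/-! ### Gaussian maxima -/

section GaugeMax

/-- The functions of the line that are used to cut out half-lines and symmetric slabs: continuous
sublinear functions `g` with `s ≤ g s ≤ |s|`. Both the identity and the absolute value qualify. -/
structure IsSlabGauge (g : ℝ → ℝ) : Prop where
  continuous : Continuous g
  convexOn : ConvexOn ℝ Set.univ g
  map_mul : ∀ r s, 0 ≤ r → g (r * s) = r * g s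
  le_map : ∀ s, s ≤ g s
  map_le : ∀ s, g s ≤ |s|

theorem isSlabGauge_id : IsSlabGauge id :=
  ⟨continuous_id, convexOn_id convex_univ, fun _ _ _ => rfl, fun _ => le_rfl, le_abs_self⟩

theorem isSlabGauge_abs : IsSlabGauge abs :=
  ⟨continuous_abs, convexOn_univ_norm, fun r s hr => by rw [abs_mul, abs_of_nonneg hr],
    le_abs_self, fun _ => le_rfl⟩

namespace IsSlabGauge

variable {g : ℝ → ℝ}

theorem abs_map_le (hg : IsSlabGauge g) (s : ℝ) : |g s| ≤ |s| :=
  abs_le.2 ⟨(neg_abs_le s).trans (hg.le_map s), hg.map_le s⟩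

theorem map_of_nonneg (hg : IsSlabGauge g) {s : ℝ} (hs : 0 ≤ s) : g s = s :=
  le_antisymm ((hg.map_le s).trans_eq (abs_of_nonneg hs)) (hg.le_map s)

theorem isOpen_slab (hg : IsSlabGauge g) (r t : ℝ) : IsOpen {s | g (r * s) < t} :=
  isOpen_lt (hg.continuous.comp (continuous_const.mul continuous_id)) continuous_const

theorem ordConnected_slab (hg : IsSlabGauge g) {r : ℝ} (hr : 0 ≤ r) (t : ℝ) :
    {s | g (r * s) < t}.OrdConnected := by
  simp only [hg.map_mul r _ hr]
  have := (hg.convexOn.smul hr).convex_lt t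
  simp only [Set.mem_univ, true_and, smul_eq_mul] at this
  exact this.ordConnected

end IsSlabGauge

variable {V : Type*} [NormedAddCommGroup V] [InnerProductSpace ℝ V] {ι : Type*} [Fintype ι]
  [Nonempty ι]

/-- The function `x ↦ maxᵢ g(⟨x, vᵢ⟩)`. -/
noncomputable def gaugeMax (g : ℝ → ℝ) (v : ι → V) (x : V) : ℝ :=
  Finset.univ.sup' Finset.univ_nonempty fun i => g ⟪x, v i⟫

theorem gaugeMax_lt_iff {g : ℝ → ℝ} {v : ι → V} {x : V} {t : ℝ} :
    gaugeMax g v x < t ↔ ∀ i, g ⟪x, v i⟫ < t := by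
  simp [gaugeMax, Finset.sup'_lt_iff]

theorem gaugeMax_le_iff {g : ℝ → ℝ} {v : ι → V} {x : V} {t : ℝ} :
    gaugeMax g v x ≤ t ↔ ∀ i, g ⟪x, v i⟫ ≤ t := by
  simp [gaugeMax, Finset.sup'_le_iff]

theorem le_gaugeMax (g : ℝ → ℝ) (v : ι → V) (x : V) (i : ι) : g ⟪x, v i⟫ ≤ gaugeMax g v x :=
  gaugeMax_le_iff.1 le_rfl i

theorem continuous_gaugeMax {g : ℝ → ℝ} (hg : Continuous g) (v : ι → V) :
    Continuous (gaugeMax g v) := by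
  unfold gaugeMax
  refine Continuous.finset_sup'_apply _ fun i _ => ?_
  fun_prop

theorem IsSlabGauge.gaugeMax_smul {g : ℝ → ℝ} (hg : IsSlabGauge g) {r : ℝ} (hr : 0 ≤ r)
    (v : ι → V) (x : V) : gaugeMax g (fun i => r • v i) x = r * gaugeMax g v x := by
  apply le_antisymm
  · refine gaugeMax_le_iff.2 fun i => ?_
    rw [real_inner_smul_right, hg.map_mul _ _ hr]
    exact mul_le_mul_of_nonneg_left (le_gaugeMax g v x i) hr
  · obtain ⟨i, -, hi⟩ := Finset.exists_mem_eq_sup' Finset.univ_nonempty fun i => g ⟪x, v i⟫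
    rw [gaugeMax, hi, ← hg.map_mul _ _ hr, ← real_inner_smul_right]
    exact le_gaugeMax g (fun i => r • v i) x i

variable [FiniteDimensional ℝ V] [MeasurableSpace V] [BorelSpace V]

theorem integrable_stdGaussian_of_le_norm {f : V → ℝ} (hf : Continuous f) {C : ℝ}
    (h : ∀ x, |f x| ≤ C * ‖x‖) : Integrable f (stdGaussian V) :=
  ((IsGaussian.integrable_id (μ := stdGaussian V)).norm.const_mul C).mono'
    hf.aestronglyMeasurable (ae_of_all _ h)

theorem integrable_inner_stdGaussian (y : V) :
    Integrable (fun x => ⟪x, y⟫) (stdGaussian V) :=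
  integrable_stdGaussian_of_le_norm (by fun_prop) (C := ‖y‖) fun x => by
    rw [mul_comm]; exact abs_real_inner_le_norm x y

theorem integral_inner_stdGaussian (y : V) : ∫ x, ⟪x, y⟫ ∂(stdGaussian V) = 0 := by
  rw [← integral_strongDual_stdGaussian (innerSL ℝ y)]
  refine integral_congr_ae (ae_of_all _ fun x => ?_)
  rw [innerSL_apply_apply, real_inner_comm]

theorem IsSlabGauge.integrable_gaugeMax {g : ℝ → ℝ} (hg : IsSlabGauge g) (v : ι → V) :
    Integrable (gaugeMax g v) (stdGaussian V) := by
  refine integrable_stdGaussian_of_le_norm (continuous_gaugeMax hg.continuous v)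
    (C := ∑ i, ‖v i‖) fun x => ?_
  obtain ⟨i, -, hi⟩ := Finset.exists_mem_eq_sup' Finset.univ_nonempty fun i => g ⟪x, v i⟫
  rw [gaugeMax, hi, mul_comm]
  refine (hg.abs_map_le _).trans ((abs_real_inner_le_norm _ _).trans ?_)
  exact mul_le_mul_of_nonneg_left
    (Finset.single_le_sum (f := fun i => ‖v i‖) (fun i _ => norm_nonneg _) (Finset.mem_univ i))
    (norm_nonneg x)

/-- The expectation of `maxⱼ g(xⱼ)` over independent standard Gaussian variables `xⱼ`. -/
noncomputable def gaussianMax (g : ℝ → ℝ) (ι : Type*) [Fintype ι] [Nonempty ι] : ℝ :=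
  ∫ x, gaugeMax g (EuclideanSpace.basisFun ι ℝ) x ∂(stdGaussian (EuclideanSpace ℝ ι))

theorem integral_gaugeMax_orthonormalBasis (g : ℝ → ℝ) (b : OrthonormalBasis ι ℝ V) :
    ∫ x, gaugeMax g b x ∂(stdGaussian V) = gaussianMax g ι := by
  rw [gaussianMax, ← stdGaussian_map b.repr]
  have := b.repr.toHomeomorph.measurableEmbedding.integral_map (μ := stdGaussian V)
    (gaugeMax g (EuclideanSpace.basisFun ι ℝ))
  refine Eq.trans ?_ this.symm
  refine integral_congr_ae (ae_of_all _ fun x => ?_)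
  simp only [gaugeMax]
  congr 1
  funext i
  simp [b.repr_apply_apply, real_inner_comm]

theorem IsSlabGauge.stdGaussian_real_gaugeMax_basisFun_lt {g : ℝ → ℝ} (hg : IsSlabGauge g)
    (r t : ℝ) (hr : 0 ≤ r) :
    (stdGaussian (EuclideanSpace ℝ ι)).real
      {x | r * gaugeMax g (EuclideanSpace.basisFun ι ℝ) x < t} =
      (gaussianReal 0 1).real {s | g (r * s) < t} ^ Fintype.card ι := by
  rw [← map_pi_eq_stdGaussian, measureReal_def, measureReal_def, Measure.map_apply (by fun_prop)
    (measurableSet_lt ((continuous_gaugeMax hg.continuous _).measurable.const_mul r)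
      measurable_const)]
  have e : WithLp.toLp 2 ⁻¹' {x : EuclideanSpace ℝ ι |
      r * gaugeMax g (EuclideanSpace.basisFun ι ℝ) x < t} =
      Set.pi Set.univ fun _ => {s | g (r * s) < t} := by
    ext x
    simp only [Set.mem_preimage, Set.mem_ofPred_eq, Set.mem_pi, Set.mem_univ, true_implies]
    rw [← hg.gaugeMax_smul hr, gaugeMax_lt_iff]
    simp [real_inner_smul_right]
  rw [e, Measure.pi_pi]
  simp

end GaugeMax

/-! ### The smallest expected maximum -/

section MeanOfMaximum

variable {V : Type*} [NormedAddCommGroup V] [InnerProductSpace ℝ V] {ι : Type*} [Fintype ι]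
  {c : ι → ℝ} {v : ι → V} {g : ℝ → ℝ}

/-- Unit vectors still decompose the identity, with the weights `cᵢ |vᵢ|²`, of total weight the
dimension. -/
theorem IsIdentityDecomposition.normalize (h : IsIdentityDecomposition c v) (hv : ∀ i, v i ≠ 0) :
    IsIdentityDecomposition (fun i => c i * ‖v i‖ ^ 2) (fun i => ‖v i‖⁻¹ • v i) := by
  intro x
  conv_rhs => rw [← h x]
  refine Finset.sum_congr rfl fun i _ => ?_
  have := norm_ne_zero_iff.2 (hv i)
  rw [real_inner_smul_right, smul_smul]
  congr 1
  field_simp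

theorem real_inner_abs_le_one {x y : V} (hx : ‖x‖ = 1) (hy : ‖y‖ = 1) : |⟪x, y⟫| ≤ 1 := by
  simpa [hx, hy] using abs_real_inner_le_norm x y

theorem eq_inner_smul_of_abs_inner_eq_one {x y : V} (hx : ‖x‖ = 1) (hy : ‖y‖ = 1)
    (h : |⟪x, y⟫| = 1) : y = ⟪x, y⟫ • x := by
  have h1 : ‖y - ⟪x, y⟫ • x‖ ^ 2 = 0 := by
    rw [norm_sub_sq_real, norm_smul, hx, hy, real_inner_smul_right, real_inner_comm x y,
      Real.norm_eq_abs, h]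
    have h2 : ⟪x, y⟫ ^ 2 = 1 := by rw [← sq_abs, h, one_pow]
    linear_combination -2 * h2
  exact sub_eq_zero.1 (norm_eq_zero.1 (pow_eq_zero_iff two_ne_zero |>.1 h1))

/-- Rigidity in the Brascamp-Lieb inequality for equal slabs: if one transport map `T`, unbounded
above, satisfies the equality condition, then the unit vectors are orthogonal or parallel. Along
the ray through `wᵢ` the vector `∑ d_l T(⟨x, w_l⟩) w_l` grows like `T` in the direction of `wᵢ`,
whereas its component along `wⱼ` stays bounded. -/
theorem inner_eq_zero_of_transport_rigid (hg : IsSlabGauge g) {d : ι → ℝ} {w : ι → V}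
    (hd : ∀ i, 0 < d i) (hw : ∀ i, ‖w i‖ = 1) {r t : ℝ} (hr : 0 < r) (ht : 0 < t) {T : ℝ → ℝ}
    (hTmono : StrictMonoOn T {s | g (r * s) < t}) (hTcont : ContinuousOn T {s | g (r * s) < t})
    (hTunb : ∀ A, ∃ s, g (r * s) < t ∧ A < T s)
    (hrigid : ∀ x, (∀ i, g (r * ⟪x, w i⟫) < t) →
      ∀ i, T ⟪x, w i⟫ = ⟪assembledMap d w (fun _ => T) x, w i⟫)
    {i j : ι} (hij : g ⟪w i, w j⟫ < 1) : ⟪w i, w j⟫ = 0 := by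
  have hgr : ∀ s a, 0 ≤ s → g (r * (s * a)) = r * s * g a := fun s a hs => by
    rw [← mul_assoc, hg.map_mul _ _ (by positivity)]
  have hnn : ∀ s, 0 ≤ s → g (r * s) = r * s := fun s hs => hg.map_of_nonneg (by positivity)
  -- boundedness of `T` along rays that stay inside the slab
  have hbdd : ∀ a, g a < 1 → ∃ C, ∀ s, 0 ≤ s → g (r * s) < t → |T (s * a)| ≤ C := by
    intro a ha
    have hcomp : IsCompact ((fun s => s * a) '' Set.Icc 0 (t / r)) :=
      isCompact_Icc.image (by fun_prop)
    have hsub : (fun s => s * a) '' Set.Icc 0 (t / r) ⊆ {s | g (r * s) < t} := by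
      rintro _ ⟨s, ⟨hs0, hs1⟩, rfl⟩
      simp only [Set.mem_ofPred_eq]
      rw [hgr s a hs0]
      have hrs : r * s ≤ t := by rwa [le_div_iff₀' hr] at hs1
      rcases hs0.eq_or_lt with h0 | h0
      · rw [← h0]; simpa using ht
      · have : 0 < r * s := by positivity
        nlinarith
    obtain ⟨C, hC⟩ := hcomp.exists_bound_of_continuousOn (hTcont.mono hsub)
    refine ⟨C, fun s hs0 hs => hC _ ⟨s, ⟨hs0, ?_⟩, rfl⟩⟩
    rw [hnn s hs0] at hs
    rw [le_div_iff₀' hr]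
    exact hs.le
  by_contra hne
  set a := ⟪w i, w j⟫ with ha
  have hself : ∀ l, ⟪w l, w l⟫ = 1 := fun l => by rw [real_inner_self_eq_norm_sq, hw, one_pow]
  have hgc : ∀ l, g ⟪w i, w l⟫ ≤ 1 := fun l =>
    (hg.map_le _).trans (real_inner_abs_le_one (hw i) (hw l))
  have hmem : ∀ s, 0 ≤ s → g (r * s) < t → ∀ l, g (r * ⟪s • w i, w l⟫) < t := by
    intro s hs0 hs l
    rw [real_inner_smul_left, hgr s _ hs0]
    rw [hnn s hs0] at hs
    have : 0 ≤ r * s := by positivity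
    nlinarith [hgc l]
  choose! C hC using hbdd
  obtain ⟨Cj, hCj⟩ : ∃ C, ∀ s, 0 ≤ s → g (r * s) < t → |T (s * a)| ≤ C := ⟨_, hC a hij⟩
  classical
  -- `D` is the total weight of the vectors equal to `wᵢ` or, for the absolute value, to `-wᵢ`; the
  -- others contribute at most `B`
  set D := ∑ l with ¬ g ⟪w i, w l⟫ < 1, d l with hD
  have hDpos : 0 < D := by
    refine Finset.sum_pos (fun l _ => hd l) ⟨i, ?_⟩
    rw [Finset.mem_filter, hself, hg.map_of_nonneg zero_le_one]
    exact ⟨Finset.mem_univ i, lt_irrefl 1⟩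
  set B := ∑ l with g ⟪w i, w l⟫ < 1, d l * C ⟪w i, w l⟫ with hB
  have key : ∀ s, 0 ≤ s → g (r * s) < t → D * |a| * |T s| ≤ Cj + B := by
    intro s hs0 hs
    have hr1 := hrigid (s • w i) (hmem s hs0 hs)
    have hrj := hr1 j
    have hri := hr1 i
    simp only [real_inner_smul_left, hself, mul_one] at hri
    have hparallel : ∀ l, ¬ g ⟪w i, w l⟫ < 1 →
        d l * T (s * ⟪w i, w l⟫) * ⟪w l, w j⟫ = d l * (T s * a) := by
      intro l hl
      have h1 : |⟪w i, w l⟫| = 1 := le_antisymm (real_inner_abs_le_one (hw i) (hw l))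
        ((not_lt.1 hl).trans (hg.map_le _))
      have h2 := eq_inner_smul_of_abs_inner_eq_one (hw i) (hw l) h1
      have hrl := hr1 l
      have hsq : ⟪w i, w l⟫ * ⟪w i, w l⟫ = 1 := by rw [← abs_mul_abs_self, h1, one_mul]
      rw [real_inner_smul_left] at hrl
      rw [hrl]
      generalize ⟪w i, w l⟫ = b at h2 hsq
      rw [h2, real_inner_smul_right, real_inner_smul_left, ← hri]
      linear_combination d l * T s * a * hsq
    have hsum : T (s * a) = (∑ l with g ⟪w i, w l⟫ < 1,
        d l * T (s * ⟪w i, w l⟫) * ⟪w l, w j⟫) + D * (T s * a) := by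
      rw [real_inner_smul_left] at hrj
      rw [hrj, assembledMap, sum_inner, ← Finset.sum_filter_add_sum_filter_not Finset.univ
        fun l => g ⟪w i, w l⟫ < 1]
      congr 1
      · refine Finset.sum_congr rfl fun l _ => ?_
        rw [real_inner_smul_left, real_inner_smul_left]
      · rw [hD, Finset.sum_mul]
        refine Finset.sum_congr rfl fun l hl => ?_
        rw [real_inner_smul_left, real_inner_smul_left]
        exact hparallel l (Finset.mem_filter.1 hl).2
    have hBbound : |∑ l with g ⟪w i, w l⟫ < 1, d l * T (s * ⟪w i, w l⟫) * ⟪w l, w j⟫| ≤ B := by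
      refine (Finset.abs_sum_le_sum_abs _ _).trans (Finset.sum_le_sum fun l hl => ?_)
      have h1 := hC _ (Finset.mem_filter.1 hl).2 s hs0 hs
      rw [abs_mul, abs_mul, abs_of_pos (hd l)]
      have h2 : d l * |T (s * ⟪w i, w l⟫)| ≤ d l * C ⟪w i, w l⟫ :=
        mul_le_mul_of_nonneg_left h1 (hd l).le
      exact (mul_le_of_le_one_right (mul_nonneg (hd l).le (abs_nonneg _))
        (real_inner_abs_le_one (hw l) (hw j))).trans h2
    have h3 : D * |a| * |T s| = |T (s * a) - ∑ l with g ⟪w i, w l⟫ < 1,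
        d l * T (s * ⟪w i, w l⟫) * ⟪w l, w j⟫| := by
      rw [hsum, add_sub_cancel_left, abs_mul, abs_mul, abs_of_pos hDpos]
      ring
    rw [h3]
    exact (abs_sub _ _).trans (add_le_add (hCj s hs0 hs) hBbound)
  have hDa : 0 < D * |a| := mul_pos hDpos (abs_pos.2 hne)
  obtain ⟨s, hs, hsA⟩ := hTunb (max (T 0) ((Cj + B) / (D * |a|)))
  have h0mem : g (r * 0) < t := by rw [hnn 0 le_rfl, mul_zero]; exact ht
  have hs0 : 0 < s := by
    by_contra hneg
    exact absurd (hTmono.monotoneOn (a := s) (b := 0) hs h0mem (not_lt.1 hneg))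
      (not_le.2 ((le_max_left _ _).trans_lt hsA))
  have h1 := key s hs0.le hs
  have h2 := (le_max_right _ _).trans_lt hsA
  rw [div_lt_iff₀' hDa] at h2
  nlinarith [mul_le_mul_of_nonneg_left (le_abs_self (T s)) hDa.le]

variable [FiniteDimensional ℝ V] [MeasurableSpace V] [BorelSpace V]

/-- The Brascamp-Lieb inequality for the slabs `{g(⟨x, vᵢ⟩) < t}`, at a fixed level `t`, for vectors
of arbitrary length. In the case of equality at a positive level, vectors of equal length are
orthogonal or parallel. -/
theorem stdGaussian_real_slabs_le (hg : IsSlabGauge g) (h : IsIdentityDecomposition c v)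
    (hc : ∀ i, 0 < c i) (hv : ∀ i, v i ≠ 0) (t : ℝ)
    (hne : ∀ i, {s | g (‖v i‖ * s) < t}.Nonempty) :
    (stdGaussian V).real {x | ∀ i, g ⟪x, v i⟫ < t} ≤
      ∏ i, (gaussianReal 0 1).real {s | g (‖v i‖ * s) < t} ^ (c i * ‖v i‖ ^ 2) ∧
    ((stdGaussian V).real {x | ∀ i, g ⟪x, v i⟫ < t} =
      ∏ i, (gaussianReal 0 1).real {s | g (‖v i‖ * s) < t} ^ (c i * ‖v i‖ ^ 2) → 0 < t →
      ∀ r, (∀ i, ‖v i‖ = r) → ∀ i j, g ⟪(‖v i‖⁻¹ • v i), (‖v j‖⁻¹ • v j)⟫ < 1 →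
        ⟪(‖v i‖⁻¹ • v i), (‖v j‖⁻¹ • v j)⟫ = 0) := by
  set J : ℝ → Set ℝ := fun ρ => {s | g (ρ * s) < t} with hJ
  have hpos : ∀ i, 0 < ‖v i‖ := fun i => norm_pos_iff.2 (hv i)
  have hbdd : ∀ i, BddAbove (J ‖v i‖) := fun i => ⟨t / ‖v i‖, fun s hs => by
    rw [le_div_iff₀' (hpos i)]
    exact (hg.le_map _).trans (le_of_lt hs)⟩
  -- the transport map is chosen as a function of the length only, so that it is the same for all
  -- vectors of equal length
  have hex : ∀ ρ : ℝ, ∃ T T' : ℝ → ℝ, ∀ i, ‖v i‖ = ρ → (∀ s ∈ J ρ, HasDerivAt T (T' s) s ∧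
      0 < T' s ∧ gaussianPDFReal 0 1 s =
        (gaussianReal 0 1).real (J ρ) * (T' s * gaussianPDFReal 0 1 (T s))) ∧
      ∀ A, ∃ s ∈ J ρ, A < T s := by
    intro ρ
    by_cases hi : ∃ i, ‖v i‖ = ρ
    · obtain ⟨i, rfl⟩ := hi
      obtain ⟨T, T', hT, hA⟩ := exists_gaussian_transport (hg.isOpen_slab ‖v i‖ t)
        (hg.ordConnected_slab (norm_nonneg _) t) (hne i) (isLUB_csSup (hne i) (hbdd i))
      exact ⟨T, T', fun _ _ => ⟨hT, hA⟩⟩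
    · exact ⟨id, id, fun i hi' => absurd ⟨i, hi'⟩ hi⟩
  choose T T' hT using hex
  have hset : {x : V | ∀ i, ⟪x, ‖v i‖⁻¹ • v i⟫ ∈ J ‖v i‖} = {x | ∀ i, g ⟪x, v i⟫ < t} := by
    ext x
    simp only [hJ, Set.mem_ofPred_eq, real_inner_smul_right]
    refine forall_congr' fun i => ?_
    rw [mul_inv_cancel_left₀ (hpos i).ne']
  have hd : ∀ i, 0 < c i * ‖v i‖ ^ 2 := fun i => mul_pos (hc i) (pow_pos (hpos i) 2)
  have hw : ∀ i, ‖‖v i‖⁻¹ • v i‖ = 1 := fun i => norm_smul_inv_norm (𝕜 := ℝ) (hv i)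
  have hBL := stdGaussian_real_le_prod (h.normalize hv) hd hw (J := fun i => J ‖v i‖)
    (Z := fun i => (gaussianReal 0 1).real (J ‖v i‖)) (T := fun i => T ‖v i‖)
    (T' := fun i => T' ‖v i‖)
    (fun i => gaussianReal_real_pos_of_isOpen (hg.isOpen_slab _ _) (hne i))
    (fun i => hg.isOpen_slab _ _) (fun i => hg.ordConnected_slab (norm_nonneg _) _)
    fun i => (hT ‖v i‖ i rfl).1
  rw [hset] at hBL
  refine ⟨hBL.1, fun heq ht r hr i j hij => ?_⟩
  have hrpos : 0 < r := hr i ▸ hpos i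
  have hTr := hT r i (hr i)
  refine inner_eq_zero_of_transport_rigid hg (w := fun i => ‖v i‖⁻¹ • v i) hd hw hrpos ht (T := T r)
    ?_ (fun s hs => (hTr.1 s hs).1.continuousAt.continuousWithinAt)
    (fun A => hTr.2 A) (fun x hx l => ?_) hij
  · refine strictMonoOn_of_deriv_pos (hg.ordConnected_slab hrpos.le t).convex
      (fun s hs => (hTr.1 s hs).1.continuousAt.continuousWithinAt) fun s hs => ?_
    rw [(hTr.1 s (interior_subset hs)).1.deriv]
    exact (hTr.1 s (interior_subset hs)).2.1
  · have := hBL.2 heq x (fun l => by simpa only [hJ, hr l, Set.mem_ofPred_eq] using hx l) l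
    simpa only [hr] using this

variable [Nonempty ι]

/-- Among the decompositions of the identity of given total weight `N`, the expectation of
`maxᵢ g(⟨x, vᵢ⟩)` is smallest for an orthogonal basis of vectors of equal length. At every level the
Brascamp-Lieb inequality and the arithmetic-geometric mean inequality with the weights
`pᵢ = cᵢ |vᵢ|² / m`, where `m` is the dimension, bound the distribution function of the maximum by
the mixture of those of `|vᵢ| maxⱼ g(xⱼ)`. The mean of the mixture is `∑ pᵢ |vᵢ|` times
`gaussianMax`, and convexity bounds this sum by `√(m/N)` from below. -/
theorem sqrt_mul_gaussianMax_le_integral_gaugeMax (hg : IsSlabGauge g)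
    (h : IsIdentityDecomposition c v) (hc : ∀ i, 0 < c i) (hv : ∀ i, v i ≠ 0)
    {κ : Type*} [Fintype κ] [Nonempty κ] (hκ : Fintype.card κ = finrank ℝ V)
    (hM : 0 < gaussianMax g κ) :
    √((finrank ℝ V : ℝ) / ∑ i, c i) * gaussianMax g κ ≤ ∫ x, gaugeMax g v x ∂(stdGaussian V) ∧
    (√((finrank ℝ V : ℝ) / ∑ i, c i) * gaussianMax g κ = ∫ x, gaugeMax g v x ∂(stdGaussian V) →
      (∀ i, ‖v i‖ = √((finrank ℝ V : ℝ) / ∑ i, c i)) ∧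
      ∀ i j, ⟪v i, v j⟫ = 0 ∨ v j = v i ∨ (v j = -v i ∧ 1 ≤ g (-1))) := by
  set m : ℝ := (finrank ℝ V : ℝ) with hm
  set N := ∑ i, c i with hN
  have hm0 : 0 < m := by
    rw [hm, ← hκ]; exact_mod_cast Fintype.card_pos
  have hN0 : 0 < N := Finset.sum_pos (fun i _ => hc i) Finset.univ_nonempty
  set r := √(m / N) with hr
  have hr0 : 0 < r := Real.sqrt_pos.2 (by positivity)
  have hr2 : r ^ 2 * N = m := by
    rw [hr, Real.sq_sqrt (by positivity)]; field_simp
  have hpos : ∀ i, 0 < ‖v i‖ := fun i => norm_pos_iff.2 (hv i)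
  have hsum := h.sum_norm_sq
  rw [← hm] at hsum
  set p : ι → ℝ := fun i => c i * ‖v i‖ ^ 2 / m with hp
  have hp0 : ∀ i, 0 < p i := fun i => by have := hpos i; have := hc i; positivity
  have hp1 : ∑ i, p i = 1 := by
    rw [hp, ← Finset.sum_div, hsum, div_self hm0.ne']
  have hset : ∀ t, {x : V | gaugeMax g v x < t} = {x | ∀ i, g ⟪x, v i⟫ < t} := fun t => by
    ext x; exact gaugeMax_lt_iff
  have hslab : ∀ i t, (stdGaussian (EuclideanSpace ℝ κ)).real
      {x | ‖v i‖ * gaugeMax g (EuclideanSpace.basisFun κ ℝ) x < t} =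
      (gaussianReal 0 1).real {s | g (‖v i‖ * s) < t} ^ finrank ℝ V := fun i t => by
    rw [hg.stdGaussian_real_gaugeMax_basisFun_lt _ _ (norm_nonneg _), hκ]
  have hamgm : ∀ t, ∏ i, (gaussianReal 0 1).real {s | g (‖v i‖ * s) < t} ^ (c i * ‖v i‖ ^ 2) ≤
      ∑ i, p i * (stdGaussian (EuclideanSpace ℝ κ)).real
        {x | ‖v i‖ * gaugeMax g (EuclideanSpace.basisFun κ ℝ) x < t} := by
    intro t
    refine le_trans (le_of_eq ?_) (Real.geom_mean_le_arith_mean_weighted Finset.univ p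
      (fun i => (stdGaussian (EuclideanSpace ℝ κ)).real
        {x | ‖v i‖ * gaugeMax g (EuclideanSpace.basisFun κ ℝ) x < t}) (fun i _ => (hp0 i).le)
      hp1 fun i _ => measureReal_nonneg)
    refine Finset.prod_congr rfl fun i _ => ?_
    rw [hslab, ← Real.rpow_natCast _ (finrank ℝ V), ← Real.rpow_mul measureReal_nonneg, ← hm, hp]
    congr 1
    field_simp
  have hle : ∀ t, (stdGaussian V).real {x | gaugeMax g v x < t} ≤
      ∑ i, p i * (stdGaussian (EuclideanSpace ℝ κ)).real
        {x | ‖v i‖ * gaugeMax g (EuclideanSpace.basisFun κ ℝ) x < t} := by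
    intro t
    rw [hset]
    by_cases hne : ∀ i, {s | g (‖v i‖ * s) < t}.Nonempty
    · exact (stdGaussian_real_slabs_le hg h hc hv t hne).1.trans (hamgm t)
    -- at a level `t ≤ 0` a symmetric slab is empty, and so is the intersection
    · push Not at hne
      obtain ⟨i, hi⟩ := hne
      have : {x : V | ∀ i, g ⟪x, v i⟫ < t} = ∅ := by
        refine Set.eq_empty_of_forall_notMem fun x hx => ?_
        have h1 : ‖v i‖⁻¹ * ⟪x, v i⟫ ∈ {s | g (‖v i‖ * s) < t} := by
          simp only [Set.mem_ofPred_eq]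
          rw [mul_inv_cancel_left₀ (hpos i).ne']
          exact hx i
        rw [hi] at h1
        exact h1
      rw [this, measureReal_empty]
      exact Finset.sum_nonneg fun i _ => mul_nonneg (hp0 i).le measureReal_nonneg
  have hcmp := sum_mul_integral_le_of_measureReal_lt_le (γ := stdGaussian V)
    (ν := stdGaussian (EuclideanSpace ℝ κ)) hp1
    (F := fun i x => ‖v i‖ * gaugeMax g (EuclideanSpace.basisFun κ ℝ) x)
    (continuous_gaugeMax hg.continuous v).measurable (hg.integrable_gaugeMax v)
    (fun i => (continuous_gaugeMax hg.continuous _).measurable.const_mul _)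
    (fun i => (hg.integrable_gaugeMax _).const_mul _) hle
  have hmean : ∑ i, p i * ∫ x, ‖v i‖ * gaugeMax g (EuclideanSpace.basisFun κ ℝ) x
      ∂(stdGaussian (EuclideanSpace ℝ κ)) = (∑ i, c i * ‖v i‖ ^ 3) / m * gaussianMax g κ := by
    rw [Finset.sum_div, Finset.sum_mul]
    refine Finset.sum_congr rfl fun i _ => ?_
    rw [integral_const_mul, ← gaussianMax, hp]
    ring
  rw [hmean] at hcmp
  -- the tangent line inequality `2 ρ³ - 3 r ρ² + r³ = (ρ - r)² (2 ρ + r) ≥ 0`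
  have hjensen : (∑ i, c i * ‖v i‖ ^ 3) / m - r =
      (∑ i, c i * ((‖v i‖ - r) ^ 2 * (2 * ‖v i‖ + r))) / (2 * m) := by
    have e : ∀ i ∈ Finset.univ, c i * ((‖v i‖ - r) ^ 2 * (2 * ‖v i‖ + r)) =
        2 * (c i * ‖v i‖ ^ 3) - 3 * r * (c i * ‖v i‖ ^ 2) + r ^ 3 * c i := fun i _ => by ring
    rw [Finset.sum_congr rfl e, Finset.sum_add_distrib, Finset.sum_sub_distrib, ← Finset.mul_sum,
      ← Finset.mul_sum, ← Finset.mul_sum, hsum, ← hN, show r ^ 3 * N = r * m by rw [← hr2]; ring]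
    field_simp
    ring
  have hterm : ∀ i, 0 ≤ c i * ((‖v i‖ - r) ^ 2 * (2 * ‖v i‖ + r)) := fun i => by
    have := hpos i; have := hc i; positivity
  have hjle : r ≤ (∑ i, c i * ‖v i‖ ^ 3) / m := by
    rw [← sub_nonneg, hjensen]
    exact div_nonneg (Finset.sum_nonneg fun i _ => hterm i) (by positivity)
  have hle1 := mul_le_mul_of_nonneg_right hjle hM.le
  refine ⟨hle1.trans hcmp.1, fun heq => ?_⟩
  have heq1 : (∑ i, c i * ‖v i‖ ^ 3) / m * gaussianMax g κ =
      ∫ x, gaugeMax g v x ∂(stdGaussian V) := le_antisymm hcmp.1 (heq ▸ hle1)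
  have heq2 : (∑ i, c i * ‖v i‖ ^ 3) / m - r = 0 :=
    sub_eq_zero.2 (mul_right_cancel₀ hM.ne' (heq1.trans heq.symm))
  rw [hjensen, div_eq_zero_iff, or_iff_left (by positivity),
    Finset.sum_eq_zero_iff_of_nonneg fun i _ => hterm i] at heq2
  have hnorm : ∀ i, ‖v i‖ = r := by
    intro i
    have h1 := (mul_eq_zero.1 (heq2 i (Finset.mem_univ i))).resolve_left (hc i).ne'
    have h2 : 2 * ‖v i‖ + r ≠ 0 := by have := hpos i; positivity
    exact sub_eq_zero.1 (pow_eq_zero_iff two_ne_zero |>.1 ((mul_eq_zero.1 h1).resolve_right h2))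
  refine ⟨hnorm, fun i j => ?_⟩
  -- a level `t > 0` at which the distribution functions agree
  obtain ⟨t, ht, ht0⟩ : ∃ t : ℝ, ((stdGaussian V).real {x | gaugeMax g v x < t} =
      ∑ i, p i * (stdGaussian (EuclideanSpace ℝ κ)).real
        {x | ‖v i‖ * gaugeMax g (EuclideanSpace.basisFun κ ℝ) x < t}) ∧ 0 < t := by
    have : NeBot (ae (volume.restrict (Set.Ioi (0 : ℝ)))) := by
      rw [ae_neBot, Ne, Measure.restrict_eq_zero]
      simp
    exact ((hcmp.2 heq1).and (ae_restrict_mem measurableSet_Ioi)).exists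
  have hne : ∀ i, {s | g (‖v i‖ * s) < t}.Nonempty := fun i =>
    ⟨0, by simpa [hg.map_of_nonneg le_rfl] using ht0⟩
  obtain ⟨hBL, hrig⟩ := stdGaussian_real_slabs_le hg h hc hv t hne
  rw [hset] at ht
  have horth := hrig (le_antisymm hBL (ht ▸ hamgm t)) ht0 r hnorm i j
  have hw : ∀ i, ‖‖v i‖⁻¹ • v i‖ = 1 := fun i => norm_smul_inv_norm (𝕜 := ℝ) (hv i)
  by_cases hij : g ⟪‖v i‖⁻¹ • v i, ‖v j‖⁻¹ • v j⟫ < 1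
  · left
    have h1 := horth hij
    rw [real_inner_smul_left, real_inner_smul_right] at h1
    have h2 := inv_ne_zero (hpos i).ne'
    have h3 := inv_ne_zero (hpos j).ne'
    simpa [h2, h3] using h1
  · right
    have h1 : |⟪‖v i‖⁻¹ • v i, ‖v j‖⁻¹ • v j⟫| = 1 :=
      le_antisymm (real_inner_abs_le_one (hw i) (hw j)) ((not_lt.1 hij).trans (hg.map_le _))
    have h2 := eq_inner_smul_of_abs_inner_eq_one (hw i) (hw j) h1
    rw [not_lt] at hij
    generalize ⟪‖v i‖⁻¹ • v i, ‖v j‖⁻¹ • v j⟫ = b at h1 h2 hij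
    rw [hnorm, hnorm, smul_comm] at h2
    have h3 := smul_right_injective V (inv_ne_zero hr0.ne') h2
    rcases (abs_eq zero_le_one).1 h1 with rfl | rfl
    · left; simpa using h3
    · right; exact ⟨by simpa using h3, hij⟩

end MeanOfMaximum

/-! ### Support functions -/

section SupportFunction

variable {E : Type*} [NormedAddCommGroup E] [InnerProductSpace ℝ E] {C L : Set E}

theorem IsCompact.image_inner (hC : IsCompact C) (x : E) :
    IsCompact ((fun y : E => ⟪x, y⟫) '' C) := hC.image (by fun_prop)

theorem IsCompact.le_supportFn (hC : IsCompact C) (x : E) {y : E} (hy : y ∈ C) :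
    ⟪x, y⟫ ≤ supportFn C x :=
  le_csSup (hC.image_inner x).bddAbove (Set.mem_image_of_mem _ hy)

theorem supportFn_le (hn : C.Nonempty) {x : E} {t : ℝ} (h : ∀ y ∈ C, ⟪x, y⟫ ≤ t) :
    supportFn C x ≤ t :=
  csSup_le (hn.image _) (by rintro _ ⟨y, hy, rfl⟩; exact h y hy)

theorem IsCompact.exists_supportFn_eq (hC : IsCompact C) (hn : C.Nonempty) (x : E) :
    ∃ y ∈ C, supportFn C x = ⟪x, y⟫ := by
  obtain ⟨y, hy, h⟩ := (hC.image_inner x).sSup_mem (hn.image _)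
  exact ⟨y, hy, h.symm⟩

theorem IsCompact.supportFn_mono (hL : IsCompact L) (hn : C.Nonempty) (h : C ⊆ L) (x : E) :
    supportFn C x ≤ supportFn L x :=
  supportFn_le hn fun _ hy => hL.le_supportFn x (h hy)

theorem IsCompact.continuous_supportFn (hC : IsCompact C) : Continuous (supportFn C) :=
  hC.continuous_sSup (f := fun x y : E => ⟪x, y⟫) (by fun_prop)

theorem supportFn_smul {r : ℝ} (hr : 0 ≤ r) (C : Set E) (x : E) :
    supportFn C (r • x) = r * supportFn C x := by
  simp only [supportFn, real_inner_smul_left]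
  rw [← smul_eq_mul, ← Real.sSup_smul_of_nonneg hr, ← Set.image_smul, Set.image_image]
  simp only [smul_eq_mul]

theorem supportFn_smul_set {r : ℝ} (hr : 0 ≤ r) (C : Set E) (x : E) :
    supportFn (r • C) x = r * supportFn C x := by
  rw [← supportFn_smul hr, supportFn, supportFn, ← Set.image_smul, Set.image_image]
  simp only [real_inner_smul_left, real_inner_smul_right]

theorem supportFn_image {F : Type*} [NormedAddCommGroup F] [InnerProductSpace ℝ F]
    (φ : F ≃ₗᵢ[ℝ] E) (C : Set F) (x : F) : supportFn (φ '' C) (φ x) = supportFn C x := by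
  simp only [supportFn, Set.image_image, LinearIsometryEquiv.inner_map_map]

theorem IsCompact.exists_abs_supportFn_le (hC : IsCompact C) (hn : C.Nonempty) :
    ∃ R, ∀ x, |supportFn C x| ≤ R * ‖x‖ := by
  obtain ⟨R, hR⟩ := hC.isBounded.exists_norm_le
  refine ⟨R, fun x => ?_⟩
  obtain ⟨y, hy, h⟩ := hC.exists_supportFn_eq hn x
  rw [h, mul_comm]
  exact (abs_real_inner_le_norm _ _).trans
    (mul_le_mul_of_nonneg_left (hR y hy) (norm_nonneg _))

theorem supportFn_convexHull (hC : IsCompact (convexHull ℝ C)) (hn : C.Nonempty) (x : E) :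
    supportFn (convexHull ℝ C) x = supportFn C x := by
  have hbdd : BddAbove ((fun y : E => ⟪x, y⟫) '' C) :=
    (hC.image_inner x).bddAbove.mono (Set.image_mono (subset_convexHull ℝ C))
  refine le_antisymm (supportFn_le (hn.mono (subset_convexHull ℝ C)) fun y hy => ?_)
    (supportFn_le hn fun y hy => hC.le_supportFn x (subset_convexHull ℝ C hy))
  have hconv : Convex ℝ {y : E | ⟪x, y⟫ ≤ supportFn C x} :=
    convex_halfSpace_le ((innerSL ℝ x).isLinear) _
  exact convexHull_min (fun z hz => le_csSup hbdd (Set.mem_image_of_mem _ hz)) hconv hy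

theorem supportFn_range {ι : Type*} [Fintype ι] [Nonempty ι] (v : ι → E) :
    supportFn (Set.range v) = gaugeMax id v := by
  funext x
  have hc : IsCompact (Set.range v) := (Set.finite_range v).isCompact
  refine le_antisymm (supportFn_le (Set.range_nonempty v) ?_) (gaugeMax_le_iff.2 fun i => ?_)
  · rintro _ ⟨i, rfl⟩
    exact le_gaugeMax id v x i
  · exact hc.le_supportFn x (Set.mem_range_self i)

theorem supportFn_range_union_neg {ι : Type*} [Fintype ι] [Nonempty ι] (v : ι → E) :
    supportFn (Set.range v ∪ -Set.range v) = gaugeMax abs v := by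
  funext x
  have hc : IsCompact (Set.range v ∪ -Set.range v) :=
    (Set.finite_range v).isCompact.union (Set.finite_range v).isCompact.neg
  refine le_antisymm (supportFn_le ((Set.range_nonempty v).mono Set.subset_union_left) ?_)
    (gaugeMax_le_iff.2 fun i => ?_)
  · rintro y (⟨i, rfl⟩ | ⟨i, hi⟩)
    · exact (le_abs_self _).trans (le_gaugeMax abs v x i)
    · rw [← neg_neg y, inner_neg_right, ← hi]
      exact (neg_le_abs _).trans (le_gaugeMax abs v x i)
  · refine abs_le'.2 ⟨hc.le_supportFn x (Or.inl (Set.mem_range_self i)), ?_⟩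
    rw [← inner_neg_right]
    exact hc.le_supportFn x (Or.inr (by simp))

/-- A compact convex set is the intersection of its supporting half-spaces. -/
theorem mem_of_forall_inner_le_supportFn [CompleteSpace E] (hC : IsCompact C)
    (hconv : Convex ℝ C) (hn : C.Nonempty) {z : E} (h : ∀ x, ⟪x, z⟫ ≤ supportFn C x) : z ∈ C := by
  by_contra hzC
  obtain ⟨f, u, hf1, hf2⟩ := geometric_hahn_banach_closed_point hconv hC.isClosed hzC
  set x := (InnerProductSpace.toDual ℝ E).symm f with hx
  have hfx : ∀ y, f y = ⟪x, y⟫ := fun y => by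
    rw [hx, InnerProductSpace.toDual_symm_apply]
  have h1 : supportFn C x ≤ u := supportFn_le hn fun y hy => by
    rw [← hfx]; exact (hf1 y hy).le
  rw [hfx] at hf2
  linarith [h x]

end SupportFunction

/-! ### The mean width as a Gaussian mean -/

section MeanWidth

variable {E : Type*} [NormedAddCommGroup E] [InnerProductSpace ℝ E] [FiniteDimensional ℝ E]
  [MeasurableSpace E] [BorelSpace E] {C L : Set E}

theorem IsCompact.integrable_supportFn (hC : IsCompact C) (hn : C.Nonempty) :
    Integrable (supportFn C) (stdGaussian E) := by
  obtain ⟨R, hR⟩ := hC.exists_abs_supportFn_le hn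
  exact integrable_stdGaussian_of_le_norm hC.continuous_supportFn hR

/-- Gaussian means as Lebesgue integrals against the density. -/
theorem integral_stdGaussian_eq (f : E → ℝ) :
    ∫ x, f x ∂(stdGaussian E) = ∫ x, stdGaussianDensity E x * f x := by
  rw [stdGaussian_eq_withDensity, integral_withDensity_eq_integral_toReal_smul₀
    (continuous_stdGaussianDensity E).measurable.ennreal_ofReal.aemeasurable
    (ae_of_all _ fun _ => ENNReal.ofReal_lt_top)]
  simp only [ENNReal.toReal_ofReal (stdGaussianDensity_pos E _).le, smul_eq_mul]

/-- Integration in polar coordinates of a product of a function of the direction and a function of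
the norm. -/
theorem integral_eq_toSphere_mul {F : E → ℝ} {f : sphere (0 : E) 1 → ℝ} {q : ℝ → ℝ}
    (h : ∀ x : E, ∀ hx : x ≠ 0, F x = f ((homeomorphUnitSphereProd E ⟨x, hx⟩).1) * q ‖x‖)
    [Nontrivial E] :
    ∫ x, F x = (∫ u, f u ∂(volume : Measure E).toSphere) *
      ∫ r : Set.Ioi (0 : ℝ), q r ∂(Measure.volumeIoiPow (finrank ℝ E - 1)) := by
  calc ∫ x, F x = ∫ x : ({(0 : E)}ᶜ : Set E), F x ∂((volume : Measure E).comap (↑)) := by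
        rw [integral_subtype_comap (measurableSet_singleton _).compl F,
          restrict_compl_singleton]
    _ = ∫ p, f p.1 * q p.2 ∂((volume : Measure E).toSphere.prod
          (Measure.volumeIoiPow (finrank ℝ E - 1))) := by
        rw [← (volume : Measure E).measurePreserving_homeomorphUnitSphereProd.integral_comp
          (Homeomorph.measurableEmbedding _)]
        refine integral_congr_ae (ae_of_all _ fun x => ?_)
        simp only
        rw [h x x.2]
        simp
    _ = _ := integral_prod_mul (fun u => f u) (fun r : Set.Ioi (0 : ℝ) => q r)

theorem integral_norm_stdGaussian_pos [Nontrivial E] : 0 < ∫ x, ‖x‖ ∂(stdGaussian E) := by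
  rw [integral_pos_iff_support_of_nonneg (fun x => norm_nonneg x)
    (IsGaussian.integrable_id (μ := stdGaussian E)).norm]
  obtain ⟨x, hx⟩ := exists_ne (0 : E)
  refine IsOpen.measure_pos _ ?_ ⟨x, by simpa using hx⟩
  exact isOpen_ne_fun continuous_norm continuous_const

/-- The mean width as a Gaussian mean of the support function: the support function is positively
homogeneous of degree one, so that in polar coordinates its Gaussian mean and that of the norm have
the same radial factor. -/
theorem meanWidth_eq_integral_stdGaussian [Nontrivial E] (hC : IsCompact C) (hn : C.Nonempty) :
    meanWidth C = 2 / (∫ x, ‖x‖ ∂(stdGaussian E)) * ∫ x, supportFn C x ∂(stdGaussian E) := by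
  set κ : ℝ := (√(2 * Real.pi))⁻¹ ^ finrank ℝ E with hκ
  set I : ℝ := ∫ r : Set.Ioi (0 : ℝ), κ * Real.exp (-(r : ℝ) ^ 2 / 2) * r
    ∂(Measure.volumeIoiPow (finrank ℝ E - 1)) with hI
  have hnorm : ∫ x, ‖x‖ ∂(stdGaussian E) =
      (finrank ℝ E * (volume : Measure E).real (closedBall 0 1)) * I := by
    rw [integral_stdGaussian_eq, integral_eq_toSphere_mul (f := fun _ => 1)
      (q := fun r => κ * Real.exp (-r ^ 2 / 2) * r) fun x hx => ?_]
    · rw [integral_const, smul_eq_mul, mul_one, Measure.toSphere_real_apply_univ,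
        Measure.addHaar_real_closedBall_eq_addHaar_real_ball]
    · rw [stdGaussianDensity, one_mul]
  have hsupp : ∫ x, (supportFn C x + supportFn C (-x)) ∂(stdGaussian E) =
      (∫ u : sphere (0 : E) 1, (supportFn C (u : E) + supportFn C (-(u : E)))
        ∂((volume : Measure E).toSphere)) * I := by
    rw [integral_stdGaussian_eq, integral_eq_toSphere_mul
      (f := fun u : sphere (0 : E) 1 => supportFn C (u : E) + supportFn C (-(u : E)))
      (q := fun r => κ * Real.exp (-r ^ 2 / 2) * r) fun x hx => ?_]
    have hx0 : ‖x‖ ≠ 0 := norm_ne_zero_iff.2 hx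
    have hu : ((homeomorphUnitSphereProd E ⟨x, hx⟩).1 : E) = ‖x‖⁻¹ • x := by simp
    rw [hu, ← smul_neg, supportFn_smul (by positivity), supportFn_smul (by positivity),
      stdGaussianDensity, ← hκ]
    field_simp
  have hnegint : Integrable (fun x => supportFn C (-x)) (stdGaussian E) := by
    obtain ⟨R, hR⟩ := hC.exists_abs_supportFn_le hn
    exact integrable_stdGaussian_of_le_norm (hC.continuous_supportFn.comp continuous_neg)
      fun x => by simpa using hR (-x)
  have hneg : ∫ x, supportFn C (-x) ∂(stdGaussian E) = ∫ x, supportFn C x ∂(stdGaussian E) := by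
    conv_rhs => rw [← stdGaussian_map (LinearIsometryEquiv.neg ℝ (E := E))]
    exact ((LinearIsometryEquiv.neg ℝ (E := E)).toHomeomorph.measurableEmbedding.integral_map
      (supportFn C)).symm
  rw [integral_add (hC.integrable_supportFn hn) hnegint, hneg] at hsupp
  have hpos := integral_norm_stdGaussian_pos (E := E)
  rw [meanWidth]
  rw [hnorm] at hpos ⊢
  have hI0 : I ≠ 0 := fun h => by simp [h] at hpos
  have hd0 : (finrank ℝ E * (volume : Measure E).real (closedBall 0 1)) ≠ 0 := fun h => by
    simp [h] at hpos
  have h2 : ∫ x, supportFn C x ∂(stdGaussian E) = (∫ u : sphere (0 : E) 1,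
      (supportFn C (u : E) + supportFn C (-(u : E))) ∂((volume : Measure E).toSphere)) * I / 2 := by
    linarith
  rw [h2]
  field_simp

theorem integral_norm_stdGaussian_eq {F : Type*} [NormedAddCommGroup F] [InnerProductSpace ℝ F]
    [FiniteDimensional ℝ F] [MeasurableSpace F] [BorelSpace F] (φ : E ≃ₗᵢ[ℝ] F) :
    ∫ x, ‖x‖ ∂(stdGaussian F) = ∫ x, ‖x‖ ∂(stdGaussian E) := by
  rw [← stdGaussian_map φ]
  refine (φ.toHomeomorph.measurableEmbedding.integral_map (fun x : F => ‖x‖)).trans ?_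
  simp

theorem integral_supportFn_image {F : Type*} [NormedAddCommGroup F] [InnerProductSpace ℝ F]
    [FiniteDimensional ℝ F] [MeasurableSpace F] [BorelSpace F] (φ : E ≃ₗᵢ[ℝ] F) (C : Set E) :
    ∫ x, supportFn (φ '' C) x ∂(stdGaussian F) = ∫ x, supportFn C x ∂(stdGaussian E) := by
  rw [← stdGaussian_map φ]
  refine (φ.toHomeomorph.measurableEmbedding.integral_map (supportFn (φ '' C))).trans ?_
  exact integral_congr_ae (ae_of_all _ fun x => supportFn_image φ C x)

theorem IsCopyOf.integral_supportFn_eq {k : ℕ} {C : Set E} {B : Set (EuclideanSpace ℝ (Fin k))}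
    {r : ℝ} (hr : 0 ≤ r) (h : IsCopyOf C (r • B)) :
    ∫ x, supportFn C x ∂(stdGaussian E) =
      r * ∫ x, supportFn B x ∂(stdGaussian (EuclideanSpace ℝ (Fin k))) := by
  obtain ⟨φ, rfl⟩ := h
  rw [integral_supportFn_image, ← integral_const_mul]
  exact integral_congr_ae (ae_of_all _ fun x => supportFn_smul_set hr B x)

theorem integral_supportFn_mono (hC : IsCompact C) (hL : IsCompact L) (hn : C.Nonempty)
    (h : C ⊆ L) : ∫ x, supportFn C x ∂(stdGaussian E) ≤ ∫ x, supportFn L x ∂(stdGaussian E) :=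
  integral_mono (hC.integrable_supportFn hn) (hL.integrable_supportFn (hn.mono h))
    fun x => hL.supportFn_mono hn h x

/-- The Gaussian mean of the support function is strictly monotone on compact convex sets: if the
means agree, the continuous support functions agree almost everywhere, hence everywhere. -/
theorem eq_of_integral_supportFn_le (hC : IsCompact C) (hconv : Convex ℝ C) (hL : IsCompact L)
    (hn : C.Nonempty) (h : C ⊆ L)
    (hle : ∫ x, supportFn L x ∂(stdGaussian E) ≤ ∫ x, supportFn C x ∂(stdGaussian E)) :
    L = C := by
  have hLi := hL.integrable_supportFn (hn.mono h)
  have hCi := hC.integrable_supportFn hn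
  have hnn : 0 ≤ fun x => supportFn L x - supportFn C x := fun x =>
    sub_nonneg.2 (hL.supportFn_mono hn h x)
  have hz : (fun x => supportFn L x - supportFn C x) =ᵐ[stdGaussian E] 0 := by
    refine (integral_eq_zero_iff_of_nonneg hnn (hLi.sub hCi)).1
      (le_antisymm ?_ (integral_nonneg hnn))
    rw [integral_sub hLi hCi]
    linarith
  have hall := (hL.continuous_supportFn.sub hC.continuous_supportFn).ae_eq_iff_eq
    (stdGaussian E) continuous_zero |>.1 hz
  refine Set.Subset.antisymm (fun z hz => mem_of_forall_inner_le_supportFn hC hconv hn fun x =>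
    (hL.le_supportFn x hz).trans ?_) h
  have := congrFun hall x
  simp only [Pi.sub_apply, Pi.zero_apply] at this
  linarith

end MeanWidth

/-! ### Rigid configurations of vectors -/

section Configuration

variable {V : Type*} [NormedAddCommGroup V] [InnerProductSpace ℝ V] [FiniteDimensional ℝ V]
  {ι : Type*} [Fintype ι] {c : ι → ℝ} {v : ι → V}

/-- A decomposition of the identity by vectors of length `r`, any two of which are orthogonal, equal
or opposite, consists of `r` times the vectors of an orthonormal basis, up to signs and
repetitions. -/
theorem exists_orthonormalBasis_of_orthogonal_or_parallel (h : IsIdentityDecomposition c v) {r : ℝ}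
    (hr : 0 < r) (hnorm : ∀ i, ‖v i‖ = r)
    (hij : ∀ i j, ⟪v i, v j⟫ = 0 ∨ v j = v i ∨ v j = -v i)
    {κ : Type*} [Fintype κ] (hκ : Fintype.card κ = finrank ℝ V) :
    ∃ (b : OrthonormalBasis κ ℝ V) (σ : κ → ι), (∀ a, v (σ a) = r • b a) ∧
      ∀ i, ∃ a, v i = r • b a ∨ v i = -(r • b a) := by
  -- a maximal linearly independent subfamily is orthogonal, and spans
  obtain ⟨κ', s, hs, hspan, hli⟩ := exists_linearIndependent' ℝ v
  have hspan_top : Submodule.span ℝ (Set.range v) = ⊤ := by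
    refine Submodule.eq_top_iff'.2 fun x => ?_
    rw [← h x]
    exact Submodule.sum_mem _ fun i _ =>
      Submodule.smul_mem _ _ (Submodule.subset_span (Set.mem_range_self i))
  rw [hspan_top] at hspan
  have hfin : Finite κ' := hli.finite
  have := Fintype.ofFinite κ'
  have hcard : Fintype.card κ' = finrank ℝ V := by
    rw [← finrank_span_eq_card hli, hspan, finrank_top]
  obtain ⟨e⟩ : Nonempty (κ ≃ κ') := Fintype.card_eq.1 (hκ.trans hcard.symm)
  have horth : Orthonormal ℝ fun a => r⁻¹ • v (s (e a)) := by
    refine ⟨fun a => ?_, fun a a' haa' => ?_⟩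
    · rw [norm_smul, hnorm, Real.norm_eq_abs, abs_of_pos (inv_pos.2 hr), inv_mul_cancel₀ hr.ne']
    · have hne : e a ≠ e a' := fun hh => haa' (e.injective hh)
      have hpair : ∀ p q : ℝ, p • v (s (e a)) + q • v (s (e a')) = 0 → p = 0 ∧ q = 0 := by
        refine LinearIndependent.pair_iff.1 ?_
        have hinj : Function.Injective ![e a, e a'] := by
          intro p q
          fin_cases p <;> fin_cases q <;> simp [hne, hne.symm]
        have he : (v ∘ s) ∘ ![e a, e a'] = ![v (s (e a)), v (s (e a'))] := by
          ext p
          fin_cases p <;> rfl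
        exact he ▸ hli.comp _ hinj
      change ⟪r⁻¹ • v (s (e a)), r⁻¹ • v (s (e a'))⟫ = 0
      rw [real_inner_smul_left, real_inner_smul_right]
      rcases hij (s (e a)) (s (e a')) with h0 | h0 | h0
      · rw [h0]; ring
      · have := hpair 1 (-1) (by simp [h0])
        exact absurd this.1 one_ne_zero
      · have := hpair 1 1 (by simp [h0])
        exact absurd this.1 one_ne_zero
  have htop : ⊤ ≤ Submodule.span ℝ (Set.range fun a => r⁻¹ • v (s (e a))) := by
    rw [← hspan]
    refine Submodule.span_le.2 ?_
    rintro _ ⟨a, rfl⟩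
    have h1 : r • (r⁻¹ • v (s (e (e.symm a)))) ∈
        Submodule.span ℝ (Set.range fun a => r⁻¹ • v (s (e a))) :=
      Submodule.smul_mem _ _ (Submodule.subset_span ⟨e.symm a, rfl⟩)
    rwa [smul_inv_smul₀ hr.ne', e.apply_symm_apply] at h1
  have hb : ∀ a, v (s (e a)) = r • OrthonormalBasis.mk horth htop a := fun a => by
    rw [OrthonormalBasis.coe_mk, smul_inv_smul₀ hr.ne']
  refine ⟨OrthonormalBasis.mk horth htop, fun a => s (e a), hb, fun i => ?_⟩
  by_contra hcon
  push Not at hcon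
  have hzero : ∀ a, ⟪OrthonormalBasis.mk horth htop a, v i⟫ = 0 := by
    intro a
    have h1 := hij (s (e a)) i
    rw [hb] at h1
    rcases h1 with h1 | h1 | h1
    · rw [real_inner_smul_left] at h1
      exact (mul_eq_zero.1 h1).resolve_left hr.ne'
    · exact absurd h1 (hcon a).1
    · exact absurd h1 (hcon a).2
  have hvi : v i = 0 := by
    rw [← (OrthonormalBasis.mk horth htop).sum_repr' (v i)]
    simp only [hzero, zero_smul, Finset.sum_const_zero]
  have := hnorm i
  rw [hvi, norm_zero] at this
  exact hr.ne this

/-- Two decompositions of the identity with the same weights and the same Gram matrix differ by a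
linear isometry. -/
theorem exists_linearIsometryEquiv_of_inner_eq {V' : Type*} [NormedAddCommGroup V']
    [InnerProductSpace ℝ V'] [FiniteDimensional ℝ V'] {v' : ι → V'}
    (h : IsIdentityDecomposition c v) (h' : IsIdentityDecomposition c v')
    (hinner : ∀ i j, ⟪v i, v j⟫ = ⟪v' i, v' j⟫) :
    ∃ φ : V ≃ₗᵢ[ℝ] V', ∀ i, φ (v i) = v' i := by
  -- the map `x ↦ ∑ cᵢ ⟨x, vᵢ⟩ vᵢ'`
  let f : V →ₗ[ℝ] V' := ∑ i, c i • (innerₗ V (v i)).smulRight (v' i)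
  have hf : ∀ x, f x = ∑ i, (c i * ⟪x, v i⟫) • v' i := fun x => by
    simp [f, smul_smul, real_inner_comm]
  have hfv : ∀ j, f (v j) = v' j := fun j => by
    rw [hf]
    conv_rhs => rw [← h' (v' j)]
    simp only [hinner]
  have hnorm : ∀ x, ‖f x‖ = ‖x‖ := by
    intro x
    have h1 : ⟪f x, f x⟫ = ⟪x, x⟫ := by
      have e : ⟪x, x⟫ = ⟪∑ i, (c i * ⟪x, v i⟫) • v i, ∑ i, (c i * ⟪x, v i⟫) • v i⟫ := by rw [h x]
      rw [e, hf]
      simp only [sum_inner, inner_sum, real_inner_smul_left, real_inner_smul_right, hinner]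
    rw [real_inner_self_eq_norm_sq, real_inner_self_eq_norm_sq] at h1
    exact (pow_left_inj₀ (norm_nonneg _) (norm_nonneg _) two_ne_zero).1 h1
  have hdim : finrank ℝ V = finrank ℝ V' := by
    have h1 := h.sum_norm_sq
    have h2 := h'.sum_norm_sq
    simp only [← real_inner_self_eq_norm_sq, hinner] at h1 h2
    exact_mod_cast h1.symm.trans h2
  exact ⟨LinearIsometry.toLinearIsometryEquiv ⟨f, hnorm⟩ hdim, hfv⟩

end Configuration

/-! ### The cross-polytope -/

section CrossPolytope

theorem convex_crossPolytope (k : ℕ) : Convex ℝ (crossPolytope k) := by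
  have : ConvexOn ℝ Set.univ fun x : EuclideanSpace ℝ (Fin k) => ∑ i, |x i| := by
    refine ⟨convex_univ, fun x _ y _ a b ha hb _ => ?_⟩
    rw [smul_eq_mul, smul_eq_mul, Finset.mul_sum, Finset.mul_sum, ← Finset.sum_add_distrib]
    refine Finset.sum_le_sum fun i _ => ?_
    simpa [abs_mul, abs_of_nonneg ha, abs_of_nonneg hb] using abs_add_le (a * x i) (b * y i)
  simpa [crossPolytope] using this.convex_le 1

/-- The cross-polytope is the convex hull of the vectors `±eᵢ`: the two sets have the same support
function. -/
theorem crossPolytope_eq_convexHull (k : ℕ) [NeZero k] :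
    crossPolytope k = convexHull ℝ (Set.range (EuclideanSpace.basisFun (Fin k) ℝ) ∪
      -Set.range (EuclideanSpace.basisFun (Fin k) ℝ)) := by
  set b := EuclideanSpace.basisFun (Fin k) ℝ with hb
  have hfin : (Set.range b ∪ -Set.range b).Finite :=
    (Set.finite_range b).union (Set.finite_range b).neg
  have hne : (Set.range b ∪ -Set.range b).Nonempty :=
    (Set.range_nonempty b).mono Set.subset_union_left
  apply Set.Subset.antisymm
  · intro z hz
    refine mem_of_forall_inner_le_supportFn (hfin.isCompact_convexHull ℝ) (convex_convexHull ℝ _)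
      (hne.mono (subset_convexHull ℝ _)) fun x => ?_
    rw [supportFn_convexHull (hfin.isCompact_convexHull ℝ) hne, supportFn_range_union_neg]
    have hM : ∀ i, |x i| ≤ gaugeMax abs b x := fun i => by
      simpa [hb, EuclideanSpace.inner_single_right] using le_gaugeMax abs b x i
    have hM0 : 0 ≤ gaugeMax abs b x := (abs_nonneg _).trans (hM 0)
    calc ⟪x, z⟫ = ∑ i, z i * x i := by simp [PiLp.inner_apply]
      _ ≤ ∑ i, |z i| * gaugeMax abs b x := Finset.sum_le_sum fun i _ =>
          (le_abs_self _).trans ((abs_mul _ _).trans_le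
            (mul_le_mul_of_nonneg_left (hM i) (abs_nonneg _)))
      _ = (∑ i, |z i|) * gaugeMax abs b x := by rw [Finset.sum_mul]
      _ ≤ gaugeMax abs b x := mul_le_of_le_one_left hM0 hz
  · refine convexHull_min ?_ (convex_crossPolytope k)
    have hmem : ∀ i, ∑ j, |b i j| ≤ 1 := fun i => by
      simp [hb, apply_ite abs]
    rintro y (⟨i, rfl⟩ | ⟨i, hi⟩)
    · exact hmem i
    · have := hmem i
      rw [hi] at this
      simpa [crossPolytope] using this

theorem isCompact_crossPolytope (k : ℕ) [NeZero k] : IsCompact (crossPolytope k) := by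
  rw [crossPolytope_eq_convexHull]
  exact ((Set.finite_range _).union (Set.finite_range _).neg).isCompact_convexHull ℝ

theorem nonempty_crossPolytope (k : ℕ) : (crossPolytope k).Nonempty := ⟨0, by simp [crossPolytope]⟩

theorem integral_supportFn_crossPolytope (k : ℕ) [NeZero k] :
    ∫ x, supportFn (crossPolytope k) x ∂(stdGaussian (EuclideanSpace ℝ (Fin k))) =
      gaussianMax abs (Fin k) := by
  rw [crossPolytope_eq_convexHull, gaussianMax]
  refine integral_congr_ae (ae_of_all _ fun x => ?_)
  have hfin := (Set.finite_range (EuclideanSpace.basisFun (Fin k) ℝ)).union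
    (Set.finite_range (EuclideanSpace.basisFun (Fin k) ℝ)).neg
  rw [supportFn_convexHull (hfin.isCompact_convexHull ℝ)
    ((Set.range_nonempty _).mono Set.subset_union_left), supportFn_range_union_neg]

/-- The maximum has positive expectation if it dominates a linear function, whose expectation is
zero, without being equal to it. -/
theorem gaussianMax_pos_of_exists_lt {g : ℝ → ℝ} (hg : IsSlabGauge g) {ι : Type*} [Fintype ι]
    [Nonempty ι] (y : EuclideanSpace ℝ ι)
    (hle : ∀ x, ⟪x, y⟫ ≤ gaugeMax g (EuclideanSpace.basisFun ι ℝ) x)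
    (hlt : ∃ x, ⟪x, y⟫ < gaugeMax g (EuclideanSpace.basisFun ι ℝ) x) : 0 < gaussianMax g ι := by
  set M := gaugeMax g (EuclideanSpace.basisFun ι ℝ) with hM
  have hMint : Integrable M (stdGaussian (EuclideanSpace ℝ ι)) := hg.integrable_gaugeMax _
  have hMc : Continuous M := continuous_gaugeMax hg.continuous _
  have hpos : 0 < ∫ x, (M x - ⟪x, y⟫) ∂(stdGaussian (EuclideanSpace ℝ ι)) := by
    rw [integral_pos_iff_support_of_nonneg (fun x => sub_nonneg.2 (hle x))
      (hMint.sub (integrable_inner_stdGaussian y))]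
    obtain ⟨x, hx⟩ := hlt
    refine IsOpen.measure_pos _ ?_ ⟨x, (sub_pos.2 hx).ne'⟩
    exact isOpen_ne_fun (hMc.sub (by fun_prop)) continuous_const
  rw [integral_sub hMint (integrable_inner_stdGaussian y), integral_inner_stdGaussian,
    sub_zero] at hpos
  exact hpos

theorem gaussianMax_abs_pos (ι : Type*) [Fintype ι] [Nonempty ι] : 0 < gaussianMax abs ι := by
  classical
  have i : ι := Classical.arbitrary ι
  refine gaussianMax_pos_of_exists_lt isSlabGauge_abs 0 (fun x => ?_)
    ⟨EuclideanSpace.single i 1, ?_⟩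
  · rw [inner_zero_right]
    exact (abs_nonneg _).trans (le_gaugeMax abs _ x i)
  · rw [inner_zero_right]
    refine lt_of_lt_of_le ?_ (le_gaugeMax abs _ _ i)
    simp

theorem gaussianMax_id_pos (ι : Type*) [Fintype ι] [Nontrivial ι] : 0 < gaussianMax id ι := by
  classical
  obtain ⟨i, j, hij⟩ := exists_pair_ne ι
  refine gaussianMax_pos_of_exists_lt isSlabGauge_id (EuclideanSpace.basisFun ι ℝ i)
    (fun x => le_gaugeMax id _ x i) ⟨EuclideanSpace.single j 1, ?_⟩
  refine lt_of_lt_of_le ?_ (le_gaugeMax id _ _ j)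
  simp [EuclideanSpace.inner_single_left, hij]

variable {F : Type*} [NormedAddCommGroup F] [InnerProductSpace ℝ F] [FiniteDimensional ℝ F]
  [MeasurableSpace F] [BorelSpace F] {ι : Type*} [Fintype ι] {c : ι → ℝ} {y : ι → F}

/-- The mean width inequality for a convex body that contains the vectors of a decomposition of the
identity and their opposites. The vectors may vanish; a vanishing vector only adds to the total
weight, so that there are none in the case of equality. -/
theorem crossPolytope_le_of_symmetric_decomposition {k : ℕ} [NeZero k] (hk : finrank ℝ F = k)
    (h : IsIdentityDecomposition c y) (hc : ∀ i, 0 < c i) {L : Set F} (hL : IsCompact L)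
    (hLconv : Convex ℝ L) (hy : ∀ i, y i ∈ L) (hy' : ∀ i, -y i ∈ L) :
    √((k : ℝ) / ∑ i, c i) *
        ∫ x, supportFn (crossPolytope k) x ∂(stdGaussian (EuclideanSpace ℝ (Fin k))) ≤
      ∫ x, supportFn L x ∂(stdGaussian F) ∧
    (∫ x, supportFn L x ∂(stdGaussian F) = √((k : ℝ) / ∑ i, c i) *
        ∫ x, supportFn (crossPolytope k) x ∂(stdGaussian (EuclideanSpace ℝ (Fin k))) ↔
      IsCopyOf L (√((k : ℝ) / ∑ i, c i) • crossPolytope k)) := by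
  classical
  have hk0 : (0 : ℝ) < k := by exact_mod_cast Nat.pos_of_ne_zero (NeZero.ne k)
  -- discard the vectors that vanish
  let c' : {i // y i ≠ 0} → ℝ := fun i => c i
  let y' : {i // y i ≠ 0} → F := fun i => y i
  have h' : IsIdentityDecomposition c' y' := by
    intro x
    conv_rhs => rw [← h x]
    rw [← Finset.sum_filter_of_ne (p := fun i => y i ≠ 0) fun i _ hi hy0 => hi (by simp [hy0])]
    exact (Finset.sum_subtype _ (by simp) fun i => (c i * ⟪x, y i⟫) • y i).symm
  have hne : Nonempty {i // y i ≠ 0} := by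
    by_contra hcon
    rw [not_nonempty_iff] at hcon
    have h1 := h'.sum_norm_sq
    rw [Finset.univ_eq_empty, Finset.sum_empty, hk] at h1
    exact hk0.ne h1
  have hN' : 0 < ∑ i, c' i := Finset.sum_pos (fun i _ => hc i) Finset.univ_nonempty
  have hle : ∑ i, c' i ≤ ∑ i, c i := by
    refine le_trans (le_of_eq ?_) (Finset.sum_le_univ_sum_of_nonneg (s := {i | y i ≠ 0})
      fun i => (hc i).le)
    exact (Finset.sum_subtype _ (by simp) c).symm
  have hcmp := sqrt_mul_gaussianMax_le_integral_gaugeMax isSlabGauge_abs h' (fun i => hc i)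
    (fun i => i.2) (κ := Fin k) (by simp [hk]) (gaussianMax_abs_pos _)
  have hM := gaussianMax_abs_pos (Fin k)
  rw [hk] at hcmp
  set A := Set.range y' ∪ -Set.range y' with hA
  have hAfin : A.Finite := (Set.finite_range y').union (Set.finite_range y').neg
  have hAne : A.Nonempty := (Set.range_nonempty y').mono Set.subset_union_left
  have hAc := hAfin.isCompact_convexHull ℝ
  have hAL : convexHull ℝ A ⊆ L := by
    refine convexHull_min ?_ hLconv
    rintro z (⟨i, rfl⟩ | ⟨i, hi⟩)
    · exact hy i
    · rw [← neg_neg z, ← hi]; exact hy' i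
  have hint : ∫ x, gaugeMax abs y' x ∂(stdGaussian F) =
      ∫ x, supportFn (convexHull ℝ A) x ∂(stdGaussian F) := by
    refine integral_congr_ae (ae_of_all _ fun x => ?_)
    rw [supportFn_convexHull hAc hAne, hA, supportFn_range_union_neg]
  have hmono := integral_supportFn_mono hAc hL (hAne.mono (subset_convexHull ℝ A)) hAL
  have hsqrt : √((k : ℝ) / ∑ i, c i) ≤ √((k : ℝ) / ∑ i, c' i) := by gcongr
  have hsqrtM := mul_le_mul_of_nonneg_right hsqrt hM.le
  rw [hint] at hcmp
  rw [integral_supportFn_crossPolytope]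
  refine ⟨hsqrtM.trans (hcmp.1.trans hmono), fun heq => ?_, fun hcopy => ?_⟩
  · have hr : √((k : ℝ) / ∑ i, c i) = √((k : ℝ) / ∑ i, c' i) :=
      mul_right_cancel₀ hM.ne' (le_antisymm hsqrtM (heq ▸ hcmp.1.trans hmono))
    have hLA : L = convexHull ℝ A := eq_of_integral_supportFn_le hAc (convex_convexHull ℝ A) hL
      (hAne.mono (subset_convexHull ℝ A)) hAL (by rw [heq, hr]; exact hcmp.1)
    obtain ⟨hnorm, hij⟩ := hcmp.2 (le_antisymm hcmp.1 (by rw [← hr, ← heq]; exact hmono))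
    have hr0 : 0 < √((k : ℝ) / ∑ i, c' i) := Real.sqrt_pos.2 (by positivity)
    rw [hr]
    set r := √((k : ℝ) / ∑ i, c' i)
    obtain ⟨b, σ, hσ, hb⟩ := exists_orthonormalBasis_of_orthogonal_or_parallel h' hr0 hnorm
      (fun i j => (hij i j).imp_right (Or.imp_right And.left)) (κ := Fin k) (by simp [hk])
    refine ⟨b.repr.symm, ?_⟩
    have hAb : A = r • ((b.repr.symm : EuclideanSpace ℝ (Fin k) → F) ''
        (Set.range (EuclideanSpace.basisFun (Fin k) ℝ) ∪
          -Set.range (EuclideanSpace.basisFun (Fin k) ℝ))) := by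
      have himg : (b.repr.symm : EuclideanSpace ℝ (Fin k) → F) ''
          (Set.range (EuclideanSpace.basisFun (Fin k) ℝ) ∪
            -Set.range (EuclideanSpace.basisFun (Fin k) ℝ)) = Set.range b ∪ -Set.range b := by
        have h1 : (b.repr.symm : EuclideanSpace ℝ (Fin k) → F) ''
            Set.range (EuclideanSpace.basisFun (Fin k) ℝ) = Set.range b := by
          rw [← Set.range_comp]
          exact congrArg Set.range (funext fun a => by simp)
        rw [Set.image_union, ← h1]
        congr 1
        ext z
        simp only [Set.mem_image, Set.mem_neg, Set.mem_range]
        constructor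
        · rintro ⟨x, ⟨a, ha⟩, rfl⟩
          exact ⟨-x, ⟨a, ha⟩, by simp⟩
        · rintro ⟨x, ⟨a, ha⟩, hz⟩
          exact ⟨-x, ⟨a, by simpa using ha⟩, by simp [hz]⟩
      rw [himg]
      ext z
      rw [hA, Set.mem_smul_set]
      constructor
      · rintro (⟨i, rfl⟩ | ⟨i, hi⟩)
        · obtain ⟨a, ha | ha⟩ := hb i
          · exact ⟨b a, Or.inl ⟨a, rfl⟩, ha.symm⟩
          · exact ⟨-b a, Or.inr ⟨a, by simp⟩, by rw [smul_neg, ← ha]⟩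
        · obtain ⟨a, ha | ha⟩ := hb i
          · exact ⟨-b a, Or.inr ⟨a, by simp⟩, by rw [smul_neg, ← ha, hi, neg_neg]⟩
          · exact ⟨b a, Or.inl ⟨a, rfl⟩, by rw [← neg_eq_iff_eq_neg.2 ha, hi, neg_neg]⟩
      · rintro ⟨w, ⟨a, rfl⟩ | ⟨a, ha⟩, rfl⟩
        · exact Or.inl ⟨σ a, hσ a⟩
        · refine Or.inr ⟨σ a, ?_⟩
          rw [hσ a, ha, smul_neg]
    rw [hLA, hAb, crossPolytope_eq_convexHull, convexHull_smul, Set.image_smul_comm]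
    · congr 1
      exact ((b.repr.symm.toLinearEquiv : EuclideanSpace ℝ (Fin k) →ₗ[ℝ] F).image_convexHull _).symm
    · exact fun x => map_smul _ _ _
  · rw [hcopy.integral_supportFn_eq (Real.sqrt_nonneg _), integral_supportFn_crossPolytope]

end CrossPolytope

/-! ### The lift of a centred decomposition -/

section SimplexLift

variable {F : Type*} [NormedAddCommGroup F] [InnerProductSpace ℝ F]

/-- The lift `y ↦ (y, 1/√N)` to the product with a line. It makes the vertices of a regular simplex
centred at the origin orthogonal. -/
noncomputable def simplexLift (N : ℝ) (y : F) : WithLp 2 (F × ℝ) := WithLp.toLp 2 (y, (√N)⁻¹)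

theorem inner_simplexLift {N : ℝ} (hN : 0 < N) (y z : F) :
    ⟪simplexLift N y, simplexLift N z⟫ = ⟪y, z⟫ + N⁻¹ := by
  rw [WithLp.prod_inner_apply]
  simp only [simplexLift, RCLike.inner_apply, conj_trivial]
  rw [← mul_inv, Real.mul_self_sqrt hN.le]

/-- The lift at height `1/√N`, with `N` the total weight, turns a centred decomposition of the
identity of `F` into one of `F × ℝ`: the mixed terms vanish because the vectors are centred. -/
theorem isIdentityDecomposition_simplexLift {ι : Type*} [Fintype ι] {c : ι → ℝ} {y : ι → F}
    (h : IsIdentityDecomposition c y) (h0 : ∑ i, c i • y i = 0) (hN : 0 < ∑ i, c i) :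
    IsIdentityDecomposition c fun i => simplexLift (∑ i, c i) (y i) := by
  set N := ∑ i, c i with hNdef
  intro x
  have hinner : ∀ i, ⟪x, simplexLift N (y i)⟫ = ⟪x.fst, y i⟫ + x.snd * (√N)⁻¹ := fun i => by
    rw [WithLp.prod_inner_apply]
    simp [simplexLift, mul_comm]
  have h0' : ∀ z : F, ∑ i, c i * ⟪z, y i⟫ = 0 := fun z => by
    have := congrArg (fun w => ⟪z, w⟫) h0
    simpa [inner_sum, real_inner_smul_right] using this
  simp only [hinner]
  have hfst : ∑ i, (c i * (⟪x.fst, y i⟫ + x.snd * (√N)⁻¹)) • y i = x.fst := by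
    have e : ∀ i ∈ Finset.univ, (c i * (⟪x.fst, y i⟫ + x.snd * (√N)⁻¹)) • y i =
        (c i * ⟪x.fst, y i⟫) • y i + (x.snd * (√N)⁻¹) • (c i • y i) := fun i _ => by
      module
    rw [Finset.sum_congr rfl e, Finset.sum_add_distrib, ← Finset.smul_sum, h0, smul_zero, add_zero]
    exact h x.fst
  have hsnd : ∑ i, (c i * (⟪x.fst, y i⟫ + x.snd * (√N)⁻¹)) * (√N)⁻¹ = x.snd := by
    have e : ∀ i ∈ Finset.univ, (c i * (⟪x.fst, y i⟫ + x.snd * (√N)⁻¹)) * (√N)⁻¹ =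
        (√N)⁻¹ * (c i * ⟪x.fst, y i⟫) + x.snd * ((√N)⁻¹ * (√N)⁻¹) * c i := fun i _ => by ring
    rw [Finset.sum_congr rfl e, Finset.sum_add_distrib, ← Finset.mul_sum, ← Finset.mul_sum, h0',
      ← hNdef, ← mul_inv, Real.mul_self_sqrt hN.le, mul_zero, zero_add, mul_assoc,
      inv_mul_cancel₀ hN.ne', mul_one]
  refine WithLp.ofLp_injective 2 (Prod.ext ?_ ?_)
  · simpa [simplexLift, WithLp.ofLp_sum, Prod.fst_sum] using hfst
  · simpa [simplexLift, WithLp.ofLp_sum, Prod.snd_sum] using hsnd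

variable [FiniteDimensional ℝ F]

theorem finrank_withLp_prod_real : finrank ℝ (WithLp 2 (F × ℝ)) = finrank ℝ F + 1 := by
  rw [(WithLp.linearEquiv 2 ℝ (F × ℝ)).finrank_eq, Module.finrank_prod, finrank_self]

section Measure

variable [MeasurableSpace F] [BorelSpace F]

/-- The marginal of the standard Gaussian measure on the first factor. -/
theorem map_fst_stdGaussian :
    (stdGaussian (WithLp 2 (F × ℝ))).map (fun x => x.fst) = stdGaussian F := by
  have hm : Measurable fun x : WithLp 2 (F × ℝ) => x.fst :=
    (WithLp.prod_continuous_ofLp 2 F ℝ).fst.measurable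
  refine Measure.ext_of_charFun ?_
  ext t
  have h := charFun_stdGaussian (E := WithLp 2 (F × ℝ)) (WithLp.toLp 2 (t, 0))
  rw [charFun_stdGaussian, charFun_apply, integral_map hm.aemeasurable (by fun_prop)]
  rw [charFun_apply] at h
  have hn : ‖(WithLp.toLp 2 (t, (0 : ℝ)) : WithLp 2 (F × ℝ))‖ = ‖t‖ := by
    rw [WithLp.prod_norm_eq_of_L2]
    simp
  rw [hn] at h
  rw [← h]
  refine integral_congr_ae (ae_of_all _ fun x => ?_)
  simp only
  rw [WithLp.prod_inner_apply]
  simp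

/-- The lift to the product with a line does not change the expectation of the maximum. -/
theorem integral_gaugeMax_simplexLift {ι : Type*} [Fintype ι] [Nonempty ι] (N : ℝ) (y : ι → F) :
    ∫ x, gaugeMax id (fun i => simplexLift N (y i)) x ∂(stdGaussian (WithLp 2 (F × ℝ))) =
      ∫ x, gaugeMax id y x ∂(stdGaussian F) := by
  have hcont : Continuous fun x : WithLp 2 (F × ℝ) => x.fst :=
    (WithLp.prod_continuous_ofLp 2 F ℝ).fst
  set e : WithLp 2 (F × ℝ) := WithLp.toLp 2 (0, (√N)⁻¹) with he
  have hadd : ∀ x : WithLp 2 (F × ℝ), gaugeMax id (fun i => simplexLift N (y i)) x =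
      gaugeMax id y x.fst + ⟪x, e⟫ := by
    intro x
    have hi : ∀ i, ⟪x, simplexLift N (y i)⟫ = ⟪x.fst, y i⟫ + ⟪x, e⟫ := fun i => by
      rw [WithLp.prod_inner_apply, WithLp.prod_inner_apply]
      simp [simplexLift, he]
    simp only [gaugeMax, hi, id]
    exact (Finset.sup'_add _ _ _ _).symm
  have hMint : Integrable (gaugeMax id y) (stdGaussian F) := isSlabGauge_id.integrable_gaugeMax y
  rw [← map_fst_stdGaussian (F := F)] at hMint
  have hc := continuous_gaugeMax continuous_id y
  rw [← map_fst_stdGaussian (F := F), integral_map hcont.measurable.aemeasurable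
    hc.aestronglyMeasurable]
  simp only [hadd]
  have hMint' : Integrable (fun x : WithLp 2 (F × ℝ) => gaugeMax id y x.fst)
      (stdGaussian (WithLp 2 (F × ℝ))) := hMint.comp_measurable hcont.measurable
  rw [integral_add hMint' (integrable_inner_stdGaussian e), integral_inner_stdGaussian, add_zero]

end Measure

end SimplexLift

/-! ### The regular simplex -/

section RegularSimplex

variable {F : Type*} [NormedAddCommGroup F] [InnerProductSpace ℝ F] {k : ℕ}

/-- The Gram matrix of the vertices of a regular simplex of circumradius `√(k/N)` centred at the
origin. -/
def IsRegularSimplexGram (N : ℝ) (p : Fin (k + 1) → F) : Prop :=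
  ∀ i j, ⟪p i, p j⟫ = (if i = j then (k + 1) / N else 0) - N⁻¹

theorem IsRegularSimplexGram.smul {N : ℝ} {p : Fin (k + 1) → F}
    (hp : IsRegularSimplexGram N p) {s M : ℝ} (hs : s ^ 2 = N / M) (hN : N ≠ 0) :
    IsRegularSimplexGram M fun i => s • p i := by
  intro i j
  rw [real_inner_smul_left, real_inner_smul_right, hp, ← mul_assoc, ← sq, hs]
  split_ifs <;> field_simp
  ring

variable [FiniteDimensional ℝ F]

/-- The lifted vertices of a regular simplex form an orthogonal basis. -/
theorem IsRegularSimplexGram.exists_orthonormalBasis {N : ℝ} (hN : 0 < N) {p : Fin (k + 1) → F}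
    (hp : IsRegularSimplexGram N p) (hk : finrank ℝ F = k) :
    ∃ b : OrthonormalBasis (Fin (k + 1)) ℝ (WithLp 2 (F × ℝ)),
      ∀ i, simplexLift N (p i) = √((k + 1) / N) • b i := by
  set r := √((k + 1) / N) with hr
  have hr0 : 0 < r := Real.sqrt_pos.2 (by positivity)
  have hr2 : r * r = (k + 1) / N := Real.mul_self_sqrt (by positivity)
  have horth : Orthonormal ℝ fun i => r⁻¹ • simplexLift N (p i) := by
    rw [orthonormal_iff_ite]
    intro i j
    rw [real_inner_smul_left, real_inner_smul_right, inner_simplexLift hN, hp, sub_add_cancel,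
      ← hr2]
    split_ifs
    · field_simp
    · simp
  have hcard : Fintype.card (Fin (k + 1)) = finrank ℝ (WithLp 2 (F × ℝ)) := by
    rw [finrank_withLp_prod_real, hk, Fintype.card_fin]
  have hspan : ⊤ ≤ Submodule.span ℝ (Set.range fun i => r⁻¹ • simplexLift N (p i)) :=
    (horth.linearIndependent.span_eq_top_of_card_eq_finrank' hcard).ge
  refine ⟨OrthonormalBasis.mk horth hspan, fun i => ?_⟩
  rw [OrthonormalBasis.coe_mk, smul_inv_smul₀ hr0.ne']

/-- The vertices of a regular simplex, with equal weights, decompose the identity: this is the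
expansion of `(x, 0)` in the orthonormal basis of the lifted vertices. -/
theorem IsRegularSimplexGram.isIdentityDecomposition {N : ℝ} (hN : 0 < N) {p : Fin (k + 1) → F}
    (hp : IsRegularSimplexGram N p) (hk : finrank ℝ F = k) :
    IsIdentityDecomposition (fun _ => N / (k + 1)) p := by
  obtain ⟨b, hb⟩ := hp.exists_orthonormalBasis hN hk
  set r := √((k + 1) / N) with hr
  have hr0 : 0 < r := Real.sqrt_pos.2 (by positivity)
  have hr2 : r * r = (k + 1) / N := Real.mul_self_sqrt (by positivity)
  have hbi : ∀ i, b i = r⁻¹ • simplexLift N (p i) := fun i => by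
    rw [hb, inv_smul_smul₀ hr0.ne']
  intro x
  have h1 := congrArg (fun z : WithLp 2 (F × ℝ) => (WithLp.ofLp z).1)
    (b.sum_repr' (WithLp.toLp 2 (x, (0 : ℝ))))
  simp only [hbi, real_inner_smul_left] at h1
  have hin : ∀ i, ⟪simplexLift N (p i), (WithLp.toLp 2 (x, (0 : ℝ)))⟫ = ⟪x, p i⟫ := fun i => by
    rw [WithLp.prod_inner_apply]
    simp [simplexLift, real_inner_comm]
  simp only [hin] at h1
  have hinv : r⁻¹ * r⁻¹ = N / (k + 1) := by rw [← mul_inv, hr2, inv_div]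
  have h2 : ∑ i, (r⁻¹ * ⟪x, p i⟫) • (r⁻¹ • p i) = x := by
    simpa only [WithLp.ofLp_sum, Prod.fst_sum, WithLp.ofLp_smul, Prod.smul_fst, simplexLift]
      using h1
  refine Eq.trans (Finset.sum_congr rfl fun i _ => ?_) h2
  rw [smul_smul, ← hinv]
  congr 1
  ring

/-- The vertices of a regular simplex inscribed in the unit sphere have pairwise inner products
`-1/k`. -/
theorem isRegularSimplexGram_of_equilateral (hk : finrank ℝ F = k) (hk1 : 1 ≤ k)
    {s : Affine.Simplex ℝ F k} (hs : s.Equilateral) (hnorm : ∀ i, ‖s.points i‖ = 1) :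
    IsRegularSimplexGram (k : ℝ) s.points := by
  have hk0 : (0 : ℝ) < k := by exact_mod_cast hk1
  obtain ⟨l, hl⟩ := hs
  set a := 1 - l ^ 2 / 2 with ha
  have hinner : ∀ i j, i ≠ j → ⟪s.points i, s.points j⟫ = a := by
    intro i j hij
    have h1 := norm_sub_sq_real (s.points i) (s.points j)
    rw [← dist_eq_norm, hl i j hij, hnorm, hnorm] at h1
    rw [ha]
    linarith
  have hself : ∀ i, ⟪s.points i, s.points i⟫ = 1 := fun i => by
    rw [real_inner_self_eq_norm_sq, hnorm, one_pow]
  have ha1 : a ≠ 1 := by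
    intro h
    have h01 : (0 : Fin (k + 1)) ≠ Fin.last k := by
      rw [Ne, Fin.ext_iff]; simp; omega
    have h2 := hl _ _ h01
    have h3 : l = 0 := by
      rw [ha] at h
      exact pow_eq_zero_iff two_ne_zero |>.1 (by linarith)
    rw [h3, dist_eq_zero] at h2
    exact h01 (s.independent.injective h2)
  -- the `k + 1` vertices are linearly dependent, which determines their inner product
  have hdep : ¬ LinearIndependent ℝ s.points := fun h => by
    have := h.fintype_card_le_finrank
    rw [hk, Fintype.card_fin] at this
    omega
  obtain ⟨w, hw, i₀, hi₀⟩ := Fintype.not_linearIndependent_iff.1 hdep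
  have hrel : ∀ j, w j * (1 - a) = -(a * ∑ i, w i) := by
    intro j
    have h1 := congrArg (fun x => ⟪x, s.points j⟫) hw
    simp only [sum_inner, real_inner_smul_left, inner_zero_left] at h1
    have e : ∀ i ∈ Finset.univ, w i * ⟪s.points i, s.points j⟫ =
        (if i = j then w i * (1 - a) else 0) + a * w i := by
      intro i _
      split_ifs with hij
      · rw [hij, hself]; ring
      · rw [hinner i j hij]; ring
    rw [Finset.sum_congr rfl e, Finset.sum_add_distrib, Finset.sum_ite_eq' Finset.univ j,
      if_pos (Finset.mem_univ j), ← Finset.mul_sum] at h1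
    linarith
  have hsum : (∑ i, w i) * (1 + k * a) = 0 := by
    have h1 := Finset.sum_congr rfl fun j (_ : j ∈ Finset.univ) => hrel j
    rw [← Finset.sum_mul, Finset.sum_const, Finset.card_univ, Fintype.card_fin, nsmul_eq_mul] at h1
    push_cast at h1
    linear_combination h1
  have hS : ∑ i, w i ≠ 0 := fun h => by
    have h1 := hrel i₀
    rw [h, mul_zero, neg_zero] at h1
    exact hi₀ ((mul_eq_zero.1 h1).resolve_right (sub_ne_zero.2 ha1.symm))
  have hak : a = -(k : ℝ)⁻¹ := by
    have h1 := (mul_eq_zero.1 hsum).resolve_left hS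
    field_simp
    linarith
  intro i j
  split_ifs with hij
  · rw [hij, hself]; field_simp; ring
  · rw [hinner i j hij, hak]; ring

variable [MeasurableSpace F]

theorem integral_supportFn_convexHull_range {ι : Type*} [Fintype ι] [Nonempty ι] (p : ι → F) :
    ∫ x, supportFn (convexHull ℝ (Set.range p)) x ∂(stdGaussian F) =
      ∫ x, gaugeMax id p x ∂(stdGaussian F) := by
  refine integral_congr_ae (ae_of_all _ fun x => ?_)
  rw [supportFn_convexHull ((Set.finite_range p).isCompact_convexHull ℝ) (Set.range_nonempty p),
    supportFn_range]

variable [BorelSpace F]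

theorem IsRegularSimplexGram.integral_gaugeMax {N : ℝ} (hN : 0 < N) {p : Fin (k + 1) → F}
    (hp : IsRegularSimplexGram N p) (hk : finrank ℝ F = k) :
    ∫ x, gaugeMax id p x ∂(stdGaussian F) = √((k + 1) / N) * gaussianMax id (Fin (k + 1)) := by
  obtain ⟨b, hb⟩ := hp.exists_orthonormalBasis hN hk
  rw [← integral_gaugeMax_simplexLift N, ← integral_gaugeMax_orthonormalBasis id b,
    ← integral_const_mul]
  simp only [hb]
  exact integral_congr_ae (ae_of_all _ fun x =>
    isSlabGauge_id.gaugeMax_smul (Real.sqrt_nonneg _) _ x)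

/-- The mean width inequality for a convex body that contains the vectors of a centred
decomposition of the identity. The lifted vectors decompose the identity of `F × ℝ`, have the same
expected maximum, and never vanish. -/
theorem simplex_le_of_centred_decomposition (hk1 : 1 ≤ k) (hk : finrank ℝ F = k) {ι : Type*}
    [Fintype ι] {c : ι → ℝ} {y : ι → F} (h : IsIdentityDecomposition c y) (hc : ∀ i, 0 < c i)
    (h0 : ∑ i, c i • y i = 0) {L : Set F} (hL : IsCompact L) (hLconv : Convex ℝ L)
    (hy : ∀ i, y i ∈ L) {Δ : Set (EuclideanSpace ℝ (Fin k))} (hΔ : IsInscribedRegularSimplex k Δ) :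
    √((k : ℝ) / ∑ i, c i) * ∫ x, supportFn Δ x ∂(stdGaussian (EuclideanSpace ℝ (Fin k))) ≤
      ∫ x, supportFn L x ∂(stdGaussian F) ∧
    (∫ x, supportFn L x ∂(stdGaussian F) = √((k : ℝ) / ∑ i, c i) *
        ∫ x, supportFn Δ x ∂(stdGaussian (EuclideanSpace ℝ (Fin k))) ↔
      IsCopyOf L (√((k : ℝ) / ∑ i, c i) • Δ)) := by
  have hk0 : (0 : ℝ) < k := by exact_mod_cast hk1
  obtain ⟨s, hs, hsnorm, rfl⟩ := hΔ
  have hdim : finrank ℝ (EuclideanSpace ℝ (Fin k)) = k := by simp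
  have hq := isRegularSimplexGram_of_equilateral hdim hk1 hs hsnorm
  have hne : Nonempty ι := by
    by_contra hcon
    rw [not_nonempty_iff] at hcon
    have h1 := h.sum_norm_sq
    rw [Finset.univ_eq_empty, Finset.sum_empty, hk] at h1
    exact hk0.ne h1
  have hN : 0 < ∑ i, c i := Finset.sum_pos (fun i _ => hc i) Finset.univ_nonempty
  have hcmp := sqrt_mul_gaussianMax_le_integral_gaugeMax isSlabGauge_id
    (isIdentityDecomposition_simplexLift h h0 hN) hc (fun i hi => ?_) (κ := Fin (k + 1))
    (by rw [finrank_withLp_prod_real, hk, Fintype.card_fin]) ?_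
  rotate_left
  · have h1 := inner_simplexLift hN (y i) (y i)
    rw [hi, inner_zero_left, real_inner_self_eq_norm_sq] at h1
    have : 0 < ‖y i‖ ^ 2 + (∑ i, c i)⁻¹ := by positivity
    exact this.ne h1
  · have : Nontrivial (Fin (k + 1)) := Fin.nontrivial_iff_two_le.2 (by omega)
    exact gaussianMax_id_pos _
  set N := ∑ i, c i with hNdef
  rw [integral_gaugeMax_simplexLift, finrank_withLp_prod_real, hk,
    ← integral_supportFn_convexHull_range] at hcmp
  push_cast at hcmp
  have hΔint : √((k : ℝ) / N) * ∫ x, supportFn (convexHull ℝ (Set.range s.points)) x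
      ∂(stdGaussian (EuclideanSpace ℝ (Fin k))) =
      √(((k : ℝ) + 1) / N) * gaussianMax id (Fin (k + 1)) := by
    rw [integral_supportFn_convexHull_range, hq.integral_gaugeMax hk0 hdim, ← mul_assoc,
      ← Real.sqrt_mul (by positivity)]
    congr 2
    field_simp
  have hCc := (Set.finite_range y).isCompact_convexHull ℝ
  have hCn : (convexHull ℝ (Set.range y)).Nonempty :=
    (Set.range_nonempty y).mono (subset_convexHull ℝ _)
  have hCL : convexHull ℝ (Set.range y) ⊆ L :=
    convexHull_min (Set.range_subset_iff.2 hy) hLconv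
  have hmono := integral_supportFn_mono hCc hL hCn hCL
  rw [hΔint]
  refine ⟨hcmp.1.trans hmono, fun heq => ?_, fun hcopy => ?_⟩
  · have hLC : L = convexHull ℝ (Set.range y) := eq_of_integral_supportFn_le hCc
      (convex_convexHull ℝ _) hL hCn hCL (heq ▸ hcmp.1)
    obtain ⟨hnorm, hij⟩ := hcmp.2 (le_antisymm hcmp.1 (heq ▸ hmono))
    set r := √(((k : ℝ) + 1) / N) with hr
    have hr0 : 0 < r := Real.sqrt_pos.2 (by positivity)
    -- opposite lifted vectors do not occur, since the gauge `id` is negative at `-1`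
    have hij' : ∀ i j, ⟪simplexLift N (y i), simplexLift N (y j)⟫ = 0 ∨
        simplexLift N (y j) = simplexLift N (y i) := fun i j => by
      rcases hij i j with h1 | h1 | ⟨-, h1⟩
      · exact Or.inl h1
      · exact Or.inr h1
      · norm_num at h1
    obtain ⟨b, σ, hσ, hb⟩ := exists_orthonormalBasis_of_orthogonal_or_parallel
      (isIdentityDecomposition_simplexLift h h0 hN) hr0 hnorm
      (fun i j => (hij' i j).imp_right Or.inl) (κ := Fin (k + 1))
      (by rw [finrank_withLp_prod_real, hk, Fintype.card_fin])
    have hgram : IsRegularSimplexGram N fun a => y (σ a) := by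
      intro a a'
      have h1 := inner_simplexLift hN (y (σ a)) (y (σ a'))
      rw [hσ, hσ, real_inner_smul_left, real_inner_smul_right, orthonormal_iff_ite.1 b.orthonormal,
        ← mul_assoc, hr, Real.mul_self_sqrt (by positivity)] at h1
      rw [eq_sub_iff_add_eq, ← h1]
      split_ifs <;> simp
    have hinj : ∀ x z : F, simplexLift N x = simplexLift N z → x = z := fun x z hxz =>
      congrArg (fun w : WithLp 2 (F × ℝ) => w.fst) hxz
    have hrange : Set.range y = Set.range fun a => y (σ a) := by
      apply Set.Subset.antisymm
      · rintro _ ⟨i, rfl⟩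
        obtain ⟨a, ha⟩ := hb i
        refine ⟨a, hinj _ _ ?_⟩
        rcases ha with ha | ha
        · rw [hσ, ha]
        · rcases hij' (σ a) i with h1 | h1
          · rw [ha, hσ, inner_neg_right, real_inner_self_eq_norm_sq, norm_smul, b.orthonormal.1,
              Real.norm_eq_abs, abs_of_pos hr0] at h1
            have : 0 < (r * 1) ^ 2 := by positivity
            linarith
          · exact h1.symm
      · rintro _ ⟨a, rfl⟩
        exact Set.mem_range_self _
    have hscale : √((k : ℝ) / N) ^ 2 = k / N := Real.sq_sqrt (by positivity)
    have hq' := hq.smul hscale hk0.ne'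
    obtain ⟨φ, hφ⟩ := exists_linearIsometryEquiv_of_inner_eq
      (hq'.isIdentityDecomposition hN hdim) (hgram.isIdentityDecomposition hN hk)
      fun i j => by rw [hq', hgram]
    refine ⟨φ, ?_⟩
    rw [hLC, hrange, ← convexHull_smul]
    have h1 : (√((k : ℝ) / N) • Set.range s.points) =
        Set.range fun i => √((k : ℝ) / N) • s.points i := by
      rw [← Set.image_smul, ← Set.range_comp]
      rfl
    have h2 := (φ.toLinearEquiv : EuclideanSpace ℝ (Fin k) →ₗ[ℝ] F).image_convexHull
      (Set.range fun i => √((k : ℝ) / N) • s.points i)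
    rw [h1]
    refine Eq.trans ?_ h2.symm
    congr 1
    rw [← Set.range_comp]
    exact congrArg Set.range (funext fun a => (hφ a).symm)
  · rw [hcopy.integral_supportFn_eq (Real.sqrt_nonneg _), hΔint]

end RegularSimplex

/-! ### The cube -/

section UnitCube

theorem map_inner_stdGaussian {F : Type*} [NormedAddCommGroup F] [InnerProductSpace ℝ F]
    [FiniteDimensional ℝ F] [MeasurableSpace F] [BorelSpace F] {y : F} (hy : ‖y‖ = 1) :
    (stdGaussian F).map (fun x => ⟪x, y⟫) = gaussianReal 0 1 := by
  refine Measure.ext_of_charFun ?_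
  ext t
  have h := charFun_stdGaussian (E := F) (t • y)
  rw [charFun_apply] at h
  rw [charFun_gaussianReal, charFun_apply, integral_map (by fun_prop) (by fun_prop)]
  have e : ∀ x : F, ⟪x, t • y⟫ = ⟪⟪x, y⟫, t⟫ := fun x => by
    rw [real_inner_smul_right]; simp
  simp only [e] at h
  rw [h, norm_smul, hy, mul_one, Real.norm_eq_abs]
  congr 1
  push_cast
  rw [← Complex.ofReal_pow, sq_abs]
  push_cast
  ring

theorem integral_abs_inner_stdGaussian {F : Type*} [NormedAddCommGroup F] [InnerProductSpace ℝ F]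
    [FiniteDimensional ℝ F] [MeasurableSpace F] [BorelSpace F] (y : F) :
    ∫ x, |⟪x, y⟫| ∂(stdGaussian F) = ‖y‖ * ∫ s, |s| ∂(gaussianReal 0 1) := by
  rcases eq_or_ne y 0 with rfl | hy
  · simp
  have hy0 : ‖y‖ ≠ 0 := norm_ne_zero_iff.2 hy
  have hu : ‖‖y‖⁻¹ • y‖ = 1 := norm_smul_inv_norm (𝕜 := ℝ) hy
  rw [← map_inner_stdGaussian hu, integral_map (by fun_prop) (by fun_prop), ← integral_const_mul]
  refine integral_congr_ae (ae_of_all _ fun x => ?_)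
  simp only
  rw [real_inner_smul_right, abs_mul, abs_of_nonneg (inv_nonneg.2 (norm_nonneg y)),
    mul_inv_cancel_left₀ hy0]

theorem integrable_abs_inner_stdGaussian {F : Type*} [NormedAddCommGroup F]
    [InnerProductSpace ℝ F] [FiniteDimensional ℝ F] [MeasurableSpace F] [BorelSpace F] (y : F) :
    Integrable (fun x => |⟪x, y⟫|) (stdGaussian F) := (integrable_inner_stdGaussian y).abs

theorem integral_abs_gaussianReal_pos : 0 < ∫ s, |s| ∂(gaussianReal 0 1) := by
  have hint : Integrable (fun s : ℝ => |s|) (gaussianReal 0 1) :=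
    (IsGaussian.integrable_id (μ := gaussianReal 0 1)).abs
  rw [integral_pos_iff_support_of_nonneg (fun s => abs_nonneg s) hint]
  have h := gaussianReal_real_pos_of_isOpen (J := Function.support fun s : ℝ => |s|)
    (isOpen_ne_fun continuous_abs continuous_const) ⟨1, by simp⟩
  exact (ENNReal.toReal_pos_iff.1 h).1

theorem isCompact_unitCube (k : ℕ) : IsCompact (unitCube k) := by
  refine Metric.isCompact_of_isClosed_isBounded ?_ ?_
  · have : unitCube k = ⋂ i, {x : EuclideanSpace ℝ (Fin k) | |x i| ≤ 1} := by
      ext; simp [unitCube]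
    rw [this]
    exact isClosed_iInter fun i => isClosed_le (by fun_prop) continuous_const
  · refine (Metric.isBounded_iff_subset_closedBall 0).2 ⟨√k, fun x hx => ?_⟩
    rw [mem_closedBall_zero_iff, EuclideanSpace.norm_eq]
    refine Real.sqrt_le_sqrt ?_
    calc ∑ i, ‖x i‖ ^ 2 ≤ ∑ _i : Fin k, (1 : ℝ) :=
          Finset.sum_le_sum fun i _ => pow_le_one₀ (norm_nonneg _) (hx i)
      _ = k := by simp

theorem nonempty_unitCube (k : ℕ) : (unitCube k).Nonempty := ⟨0, by simp [unitCube]⟩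

theorem supportFn_unitCube (k : ℕ) (x : EuclideanSpace ℝ (Fin k)) :
    supportFn (unitCube k) x = ∑ i, |x i| := by
  refine le_antisymm (supportFn_le (nonempty_unitCube k) fun z hz => ?_) ?_
  · calc ⟪x, z⟫ = ∑ i, x i * z i := by simp [PiLp.inner_apply, mul_comm]
      _ ≤ ∑ i, |x i| := Finset.sum_le_sum fun i _ => (le_abs_self _).trans
          ((abs_mul _ _).trans_le (mul_le_of_le_one_right (abs_nonneg _) (hz i)))
  · set z : EuclideanSpace ℝ (Fin k) := WithLp.toLp 2 fun i => (SignType.sign (x i) : ℝ) with hz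
    have hzc : z ∈ unitCube k := fun i => by
      simp only [hz]
      rcases lt_trichotomy (x i) 0 with h | h | h
      · simp [sign_neg h]
      · simp [h]
      · simp [sign_pos h]
    refine le_trans (le_of_eq ?_) ((isCompact_unitCube k).le_supportFn x hzc)
    rw [PiLp.inner_apply]
    refine Finset.sum_congr rfl fun i _ => ?_
    simp only [hz, RCLike.inner_apply, conj_trivial]
    exact (sign_mul_self (x i)).symm

theorem integral_supportFn_unitCube (k : ℕ) :
    ∫ x, supportFn (unitCube k) x ∂(stdGaussian (EuclideanSpace ℝ (Fin k))) =
      k * ∫ s, |s| ∂(gaussianReal 0 1) := by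
  have e : ∀ x : EuclideanSpace ℝ (Fin k), supportFn (unitCube k) x =
      ∑ i, |⟪x, EuclideanSpace.basisFun (Fin k) ℝ i⟫| := fun x => by
    rw [supportFn_unitCube]
    exact Finset.sum_congr rfl fun i _ => by simp [EuclideanSpace.inner_single_right]
  simp only [e]
  rw [integral_finsetSum _ fun i _ => integrable_abs_inner_stdGaussian _]
  simp only [integral_abs_inner_stdGaussian, (EuclideanSpace.basisFun (Fin k) ℝ).orthonormal.1]
  simp

variable {F : Type*} [NormedAddCommGroup F] [InnerProductSpace ℝ F] {ι : Type*} {c : ι → ℝ}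
  {y : ι → F}

/-- The intersection of the symmetric slabs `{|⟨x, yᵢ⟩| ≤ 1}`. -/
def slabIntersection (y : ι → F) : Set F := {x | ∀ i, |⟪x, y i⟫| ≤ 1}

theorem nonempty_slabIntersection (y : ι → F) : (slabIntersection y).Nonempty :=
  ⟨0, by simp [slabIntersection]⟩

variable [Fintype ι]

/-- For `z` in all the slabs, `⟨x, z⟩ = ∑ cᵢ ⟨x, yᵢ⟩ ⟨z, yᵢ⟩ ≤ ∑ cᵢ |⟨x, yᵢ⟩|`. -/
theorem supportFn_slabIntersection_le (h : IsIdentityDecomposition c y) (hc : ∀ i, 0 < c i)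
    (x : F) : supportFn (slabIntersection y) x ≤ ∑ i, c i * |⟪x, y i⟫| := by
  refine supportFn_le (nonempty_slabIntersection y) fun z hz => ?_
  rw [← h.sum_inner_mul_inner x z]
  refine Finset.sum_le_sum fun i _ => ?_
  rw [mul_assoc]
  refine mul_le_mul_of_nonneg_left ((le_abs_self _).trans ?_) (hc i).le
  rw [abs_mul]
  exact mul_le_of_le_one_right (abs_nonneg _) (hz i)

/-- If the support function of the intersection of slabs attains the upper bound at `yⱼ`, then
each `yᵢ` is orthogonal or parallel to `yⱼ`: the numbers `aᵢ = |⟨yⱼ, yᵢ⟩| ≤ r²` satisfy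
`∑ cᵢ aᵢ ≤ 1` and `∑ cᵢ aᵢ² = r²`. -/
theorem orthogonal_or_parallel_of_supportFn_slabIntersection_eq (h : IsIdentityDecomposition c y)
    (hc : ∀ i, 0 < c i) {r : ℝ} (hnorm : ∀ i, ‖y i‖ = r) (j : ι)
    (heq : supportFn (slabIntersection y) (y j) = ∑ i, c i * |⟪y j, y i⟫|) (i : ι) :
    ⟪y j, y i⟫ = 0 ∨ y i = y j ∨ y i = -y j := by
  have h1 : ∑ i, c i * |⟪y j, y i⟫| ≤ 1 := by
    rw [← heq]
    refine supportFn_le (nonempty_slabIntersection y) fun z hz => ?_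
    rw [real_inner_comm]
    exact (le_abs_self _).trans (hz j)
  have h2 := h.sum_inner_sq (y j)
  rw [hnorm] at h2
  have hle : ∀ i, |⟪y j, y i⟫| ≤ r ^ 2 := fun i => by
    have := abs_real_inner_le_norm (y j) (y i)
    rwa [hnorm, hnorm, ← sq] at this
  have hterm : ∀ i, 0 ≤ c i * (|⟪y j, y i⟫| * (r ^ 2 - |⟪y j, y i⟫|)) := fun i =>
    mul_nonneg (hc i).le (mul_nonneg (abs_nonneg _) (sub_nonneg.2 (hle i)))
  have hsum : ∑ i, c i * (|⟪y j, y i⟫| * (r ^ 2 - |⟪y j, y i⟫|)) = 0 := by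
    refine le_antisymm ?_ (Finset.sum_nonneg fun i _ => hterm i)
    have e : ∀ i ∈ Finset.univ, c i * (|⟪y j, y i⟫| * (r ^ 2 - |⟪y j, y i⟫|)) =
        r ^ 2 * (c i * |⟪y j, y i⟫|) - c i * ⟪y j, y i⟫ ^ 2 := fun i _ => by
      rw [← sq_abs ⟪y j, y i⟫]; ring
    rw [Finset.sum_congr rfl e, Finset.sum_sub_distrib, ← Finset.mul_sum, h2]
    nlinarith [sq_nonneg r]
  have h3 := (Finset.sum_eq_zero_iff_of_nonneg fun i _ => hterm i).1 hsum i (Finset.mem_univ i)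
  have h4 := (mul_eq_zero.1 h3).resolve_left (hc i).ne'
  rcases mul_eq_zero.1 h4 with h5 | h5
  · exact Or.inl (abs_eq_zero.1 h5)
  · right
    have h6 : |⟪y j, y i⟫| = r ^ 2 := (sub_eq_zero.1 h5).symm
    rcases (abs_eq (sq_nonneg r)).1 h6 with h7 | h7
    · left
      have h8 := norm_sub_sq_real (y j) (y i)
      rw [h7, hnorm, hnorm] at h8
      have h9 : ‖y j - y i‖ ^ 2 = 0 := by linarith
      exact (sub_eq_zero.1 (norm_eq_zero.1 (pow_eq_zero_iff two_ne_zero |>.1 h9))).symm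
    · right
      have h8 := norm_add_sq_real (y j) (y i)
      rw [h7, hnorm, hnorm] at h8
      have h9 : ‖y j + y i‖ ^ 2 = 0 := by linarith
      exact (neg_eq_of_add_eq_zero_right
        (norm_eq_zero.1 (pow_eq_zero_iff two_ne_zero |>.1 h9))).symm

variable [FiniteDimensional ℝ F]

theorem isCompact_slabIntersection (h : IsIdentityDecomposition c y) (hc : ∀ i, 0 < c i) :
    IsCompact (slabIntersection y) := by
  refine Metric.isCompact_of_isClosed_isBounded ?_ ?_
  · have : slabIntersection y = ⋂ i, {x : F | |⟪x, y i⟫| ≤ 1} := by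
      ext; simp [slabIntersection]
    rw [this]
    exact isClosed_iInter fun i => isClosed_le (by fun_prop) continuous_const
  · refine (Metric.isBounded_iff_subset_closedBall 0).2 ⟨√(∑ i, c i), fun x hx => ?_⟩
    rw [mem_closedBall_zero_iff]
    refine Real.le_sqrt_of_sq_le ?_
    rw [← h.sum_inner_sq]
    refine Finset.sum_le_sum fun i _ => mul_le_of_le_one_right (hc i).le ?_
    rw [← sq_abs]
    exact pow_le_one₀ (abs_nonneg _) (hx i)

variable [MeasurableSpace F] [BorelSpace F]

/-- The mean width inequality for a convex body inside the slabs given by a decomposition of the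
identity. The Gaussian mean of the support function is at most `E|s| ∑ cᵢ |yᵢ|` with `s` a standard
Gaussian variable, and the Cauchy-Schwarz inequality with `∑ cᵢ |yᵢ|² = k` bounds the sum. -/
theorem le_unitCube_of_subset_slabIntersection {k : ℕ} [NeZero k] (hk : finrank ℝ F = k)
    (h : IsIdentityDecomposition c y) (hc : ∀ i, 0 < c i) {L : Set F} (hL : IsCompact L)
    (hLconv : Convex ℝ L) (hLn : L.Nonempty) (hLy : L ⊆ slabIntersection y) :
    ∫ x, supportFn L x ∂(stdGaussian F) ≤ √((∑ i, c i) / (k : ℝ)) *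
        ∫ x, supportFn (unitCube k) x ∂(stdGaussian (EuclideanSpace ℝ (Fin k))) ∧
    (∫ x, supportFn L x ∂(stdGaussian F) = √((∑ i, c i) / (k : ℝ)) *
        ∫ x, supportFn (unitCube k) x ∂(stdGaussian (EuclideanSpace ℝ (Fin k))) ↔
      IsCopyOf L (√((∑ i, c i) / (k : ℝ)) • unitCube k)) := by
  have hk0 : (0 : ℝ) < k := by exact_mod_cast Nat.pos_of_ne_zero (NeZero.ne k)
  have hsum := h.sum_norm_sq
  rw [hk] at hsum
  have hne : Nonempty ι := by
    by_contra hcon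
    rw [not_nonempty_iff] at hcon
    rw [Finset.univ_eq_empty, Finset.sum_empty] at hsum
    exact hk0.ne hsum
  have hN : 0 < ∑ i, c i := Finset.sum_pos (fun i _ => hc i) Finset.univ_nonempty
  set N := ∑ i, c i with hNdef
  set R := √(N / k) with hR
  have hR0 : 0 < R := Real.sqrt_pos.2 (by positivity)
  have hR2 : R ^ 2 * k = N := by
    rw [hR, Real.sq_sqrt (by positivity)]; field_simp
  set κ := ∫ s, |s| ∂(gaussianReal 0 1) with hκ
  have hκ0 : 0 < κ := integral_abs_gaussianReal_pos
  rw [integral_supportFn_unitCube, ← hκ]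
  set U : F → ℝ := fun x => ∑ i, c i * |⟪x, y i⟫| with hU
  have hUint : Integrable U (stdGaussian F) :=
    integrable_finsetSum _ fun i _ => (integrable_abs_inner_stdGaussian _).const_mul _
  have hUc : Continuous U := by fun_prop
  have hUval : ∫ x, U x ∂(stdGaussian F) = (∑ i, c i * ‖y i‖) * κ := by
    rw [hU, integral_finsetSum _ fun i _ => (integrable_abs_inner_stdGaussian _).const_mul _,
      Finset.sum_mul]
    refine Finset.sum_congr rfl fun i _ => ?_
    rw [integral_const_mul, integral_abs_inner_stdGaussian, mul_assoc]
  -- the Cauchy-Schwarz inequality, with its defect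
  have hCS : 2 * (R * k - ∑ i, c i * ‖y i‖) = R * ∑ i, c i * (‖y i‖ - R⁻¹) ^ 2 := by
    have e : ∀ i ∈ Finset.univ, c i * (‖y i‖ - R⁻¹) ^ 2 =
        c i * ‖y i‖ ^ 2 - 2 * R⁻¹ * (c i * ‖y i‖) + R⁻¹ ^ 2 * c i := fun i _ => by ring
    rw [Finset.sum_congr rfl e, Finset.sum_add_distrib, Finset.sum_sub_distrib, ← Finset.mul_sum,
      ← Finset.mul_sum, hsum, ← hNdef, ← hR2]
    field_simp
    ring
  have hterm : ∀ i, 0 ≤ c i * (‖y i‖ - R⁻¹) ^ 2 := fun i => mul_nonneg (hc i).le (sq_nonneg _)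
  have hCSle : ∑ i, c i * ‖y i‖ ≤ R * k := by
    have := mul_nonneg hR0.le (Finset.sum_nonneg fun i (_ : i ∈ Finset.univ) => hterm i)
    linarith
  have hZ := isCompact_slabIntersection h hc
  have hZn := nonempty_slabIntersection y
  have hZU : ∫ x, supportFn (slabIntersection y) x ∂(stdGaussian F) ≤ ∫ x, U x ∂(stdGaussian F) :=
    integral_mono (hZ.integrable_supportFn hZn) hUint fun x => supportFn_slabIntersection_le h hc x
  have hUle : ∫ x, U x ∂(stdGaussian F) ≤ R * (k * κ) := by
    rw [hUval, ← mul_assoc]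
    exact mul_le_mul_of_nonneg_right hCSle hκ0.le
  have hLZ := integral_supportFn_mono hL hZ hLn hLy
  refine ⟨hLZ.trans (hZU.trans hUle), fun heq => ?_, fun hcopy => ?_⟩
  · have hZL : slabIntersection y = L :=
      eq_of_integral_supportFn_le hL hLconv hZ hLn hLy (heq ▸ hZU.trans hUle)
    have hUeq : ∫ x, U x ∂(stdGaussian F) = R * (k * κ) := le_antisymm hUle (heq ▸ hLZ.trans hZU)
    have hnorm : ∀ i, ‖y i‖ = R⁻¹ := by
      have h1 : ∑ i, c i * ‖y i‖ = R * k := by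
        rw [hUval, ← mul_assoc] at hUeq
        exact mul_right_cancel₀ hκ0.ne' hUeq
      have h2 : ∑ i, c i * (‖y i‖ - R⁻¹) ^ 2 = 0 := by
        have h3 : R * ∑ i, c i * (‖y i‖ - R⁻¹) ^ 2 = 0 := by rw [← hCS, h1]; ring
        exact (mul_eq_zero.1 h3).resolve_left hR0.ne'
      intro i
      have h3 := (Finset.sum_eq_zero_iff_of_nonneg fun i _ => hterm i).1 h2 i (Finset.mem_univ i)
      have h4 := (mul_eq_zero.1 h3).resolve_left (hc i).ne'
      exact sub_eq_zero.1 (pow_eq_zero_iff two_ne_zero |>.1 h4)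
    have hsupp : ∀ x, supportFn (slabIntersection y) x = U x := by
      have hnn : 0 ≤ fun x => U x - supportFn (slabIntersection y) x := fun x =>
        sub_nonneg.2 (supportFn_slabIntersection_le h hc x)
      have hint := hUint.sub (hZ.integrable_supportFn hZn)
      have hz : (fun x => U x - supportFn (slabIntersection y) x) =ᵐ[stdGaussian F] 0 := by
        refine (integral_eq_zero_iff_of_nonneg hnn hint).1 (le_antisymm ?_ (integral_nonneg hnn))
        rw [integral_sub hUint (hZ.integrable_supportFn hZn), hUeq, ← heq]
        linarith
      have hall := (hUc.sub hZ.continuous_supportFn).ae_eq_iff_eq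
        (stdGaussian F) continuous_zero |>.1 hz
      intro x
      have := congrFun hall x
      simp only [Pi.sub_apply, Pi.zero_apply] at this
      linarith
    have hRi : 0 < R⁻¹ := inv_pos.2 hR0
    obtain ⟨b, σ, hσ, hb⟩ := exists_orthonormalBasis_of_orthogonal_or_parallel h hRi hnorm
      (fun j i => orthogonal_or_parallel_of_supportFn_slabIntersection_eq h hc hnorm j
        (hsupp (y j)) i) (κ := Fin k) (by simp [hk])
    have hmem : ∀ x, x ∈ L ↔ ∀ a, |⟪x, b a⟫| ≤ R := by
      intro x
      have hi : ∀ a, |⟪x, R⁻¹ • b a⟫| ≤ 1 ↔ |⟪x, b a⟫| ≤ R := fun a => by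
        rw [real_inner_smul_right, abs_mul, abs_of_pos hRi, inv_mul_le_iff₀ hR0, mul_one]
      rw [← hZL]
      constructor
      · intro hx a
        rw [← hi, ← hσ]
        exact hx (σ a)
      · intro hx i
        obtain ⟨a, ha | ha⟩ := hb i
        · rw [ha, hi]; exact hx a
        · rw [ha, inner_neg_right, abs_neg, hi]; exact hx a
    refine ⟨b.repr.symm, ?_⟩
    ext x
    rw [hmem, LinearIsometryEquiv.image_eq_preimage_symm, Set.mem_preimage,
      Set.mem_smul_set_iff_inv_smul_mem₀ hR0.ne']
    refine forall_congr' fun a => ?_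
    have e : (R⁻¹ • b.repr.symm.symm x) a = R⁻¹ * ⟪x, b a⟫ := by
      simp [b.repr_apply_apply, real_inner_comm]
    rw [e, abs_mul, abs_of_pos hRi, inv_mul_le_iff₀ hR0, mul_one]
  · rw [hcopy.integral_supportFn_eq hR0.le, integral_supportFn_unitCube]

end UnitCube

/-! ### Convex hulls of compact sets -/

section CompactHull

/-- The convex hull of a compact set of a finite-dimensional space is compact: by Carathéodory's
theorem it is the image of a compact set of weights and points under a continuous map. -/
theorem IsCompact.isCompact_convexHull_of_finiteDimensional {V : Type*} [NormedAddCommGroup V]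
    [NormedSpace ℝ V] [FiniteDimensional ℝ V] {s : Set V} (hs : IsCompact s) :
    IsCompact (convexHull ℝ s) := by
  rcases s.eq_empty_or_nonempty with rfl | ⟨z₀, hz₀⟩
  · simp
  set m := finrank ℝ V + 1
  have hc : IsCompact ((fun p : (Fin m → ℝ) × (Fin m → V) => ∑ i, p.1 i • p.2 i) ''
      (stdSimplex ℝ (Fin m) ×ˢ Set.univ.pi fun _ => s)) :=
    ((isCompact_stdSimplex ℝ (Fin m)).prod (isCompact_univ_pi fun _ => hs)).image (by fun_prop)
  convert hc using 1
  apply subset_antisymm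
  · intro x hx
    obtain ⟨ι, _, z, w, hz, hi, hw, hw1, rfl⟩ := eq_pos_convex_span_of_mem_convexHull hx
    have hcard : Fintype.card ι ≤ Fintype.card (Fin m) := by
      rw [Fintype.card_fin]
      exact hi.card_le_finrank_succ.trans
        (Nat.succ_le_succ (Submodule.finrank_le (vectorSpan ℝ (Set.range z))))
    obtain ⟨e⟩ := Function.Embedding.nonempty_of_card_le hcard
    refine ⟨(Function.extend e w 0, Function.extend e z fun _ => z₀), ⟨⟨fun j => ?_, ?_⟩, ?_⟩, ?_⟩
    · by_cases h : ∃ i, e i = j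
      · obtain ⟨i, rfl⟩ := h
        simpa [e.injective.extend_apply] using (hw i).le
      · simp [Function.extend_apply' _ _ _ h]
    · rw [← hw1]
      refine (Fintype.sum_of_injective e e.injective _ _ (fun j hj => ?_) fun i => ?_).symm
      · simp [Function.extend_apply' _ (0 : Fin m → ℝ) j hj]
      · simp [e.injective.extend_apply]
    · intro j _
      by_cases h : ∃ i, e i = j
      · obtain ⟨i, rfl⟩ := h
        simpa [e.injective.extend_apply] using hz ⟨i, rfl⟩
      · simpa [Function.extend_apply' _ _ _ h] using hz₀
    · refine (Fintype.sum_of_injective e e.injective _ _ (fun j hj => ?_) fun i => ?_).symm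
      · simp [Function.extend_apply' _ (0 : Fin m → ℝ) j hj]
      · simp [e.injective.extend_apply]
  · rintro _ ⟨⟨w, z⟩, ⟨⟨hw0, hw1⟩, hz⟩, rfl⟩
    exact (convex_convexHull ℝ s).sum_mem (fun i _ => hw0 i) hw1
      fun i _ => subset_convexHull ℝ s (hz i trivial)

end CompactHull

/-! ### Isotropic measures with finite support -/

section Discretisation

universe u

variable {E : Type u} [NormedAddCommGroup E] [InnerProductSpace ℝ E] [MeasurableSpace E]
  [BorelSpace E]

theorem neg_mem_support_of_isEvenMeasure {μ : Measure (sphere (0 : E) 1)} (hμ : IsEvenMeasure μ)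
    {u : sphere (0 : E) 1} (hu : u ∈ μ.support) : -u ∈ μ.support := by
  rw [Measure.mem_support_iff_forall] at hu ⊢
  intro U hU
  obtain ⟨V, hVU, hV, huV⟩ := _root_.mem_nhds_iff.1 hU
  have hV' : IsOpen (-V) := hV.preimage continuous_neg
  calc 0 < μ (-V) := hu _ (hV'.mem_nhds (by simpa using huV))
    _ = μ V := hμ V hV.measurableSet
    _ ≤ μ U := measure_mono hVU

variable [FiniteDimensional ℝ E]

/-- A centred isotropic measure on the sphere can be replaced by one which is supported on finitely
many points of its support: the average of `(u ⊗ u, u)` is in the convex hull of the values on the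
support, as this hull is compact. -/
theorem exists_isIdentityDecomposition_of_isIsotropic [Nontrivial E]
    {μ : Measure (sphere (0 : E) 1)} [IsFiniteMeasure μ] (hμ : IsIsotropic μ)
    (hcentroid : sphereCentroid μ = 0) :
    ∃ (ι : Type u) (_ : Fintype ι) (c : ι → ℝ) (u : ι → sphere (0 : E) 1),
      (∀ i, 0 < c i) ∧ (∀ i, u i ∈ μ.support) ∧ ∑ i, c i • (u i : E) = 0 ∧
      ∑ i, c i = finrank ℝ E ∧ IsIdentityDecomposition c fun i => (u i : E) := by
  have hμ0 : μ ≠ 0 := by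
    rintro rfl
    obtain ⟨x, hx⟩ := exists_ne (0 : E)
    have := congrArg (fun A : E →L[ℝ] E => A x) hμ
    simp at this
    exact hx this.symm
  have : NeZero μ := ⟨hμ0⟩
  set f : sphere (0 : E) 1 → (E →L[ℝ] E) × E :=
    fun u => (InnerProductSpace.rankOne ℝ (u : E) (u : E), (u : E)) with hf
  have hf1 : Continuous fun u : sphere (0 : E) 1 =>
      InnerProductSpace.rankOne ℝ (u : E) (u : E) :=
    ((InnerProductSpace.rankOne ℝ (E := E) (F := E)).continuous.comp
      continuous_subtype_val).clm_apply continuous_subtype_val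
  have hfc : Continuous f := hf1.prodMk continuous_subtype_val
  have hfi : ∀ {V : Type _} [NormedAddCommGroup V] {g : sphere (0 : E) 1 → V}, Continuous g →
      Integrable g μ := fun hg =>
    hg.integrable_of_hasCompactSupport (HasCompactSupport.of_compactSpace _)
  have hfs : IsCompact (f '' μ.support) := Measure.isClosed_support.isCompact.image hfc
  have hmem := (convex_convexHull ℝ (f '' μ.support)).average_mem
    hfs.isCompact_convexHull_of_finiteDimensional.isClosed
    (by filter_upwards [Measure.support_mem_ae (μ := μ)] with u hu
        exact subset_convexHull ℝ _ ⟨u, hu, rfl⟩) (hfi hfc)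
  obtain ⟨ι, _, z, w, hz, -, hw, -, hwz⟩ := eq_pos_convex_span_of_mem_convexHull hmem
  choose u hu huz using fun i => hz ⟨i, rfl⟩
  have hM : 0 < μ.real Set.univ := by
    simpa [Measure.real, ENNReal.toReal_pos_iff, Measure.measure_univ_pos] using hμ0
  have hint : ∫ u, (u : E) ∂μ = 0 := by
    simpa [sphereCentroid, hM.ne'] using hcentroid
  have hsum : ∑ i, (μ.real Set.univ * w i) • f (u i) = (ContinuousLinearMap.id ℝ E, 0) := by
    have : ∫ u, f u ∂μ = (ContinuousLinearMap.id ℝ E, 0) := by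
      rw [hf, integral_pair (hfi hf1) (hfi continuous_subtype_val), hint, hμ]
    rw [← this, ← measure_smul_average, ← hwz, Finset.smul_sum]
    exact Finset.sum_congr rfl fun i _ => by rw [huz, mul_smul]
  have hid : IsIdentityDecomposition (fun i => μ.real Set.univ * w i) fun i => (u i : E) := by
    intro x
    have := congrArg (fun p : (E →L[ℝ] E) × E => p.1 x) hsum
    simpa [Prod.fst_sum, hf, mul_smul, real_inner_comm x] using this
  refine ⟨ι, inferInstance, fun i => μ.real Set.univ * w i, u, fun i => mul_pos hM (hw i), hu, ?_,
    ?_, hid⟩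
  · have := congrArg Prod.snd hsum
    simpa [Prod.snd_sum, hf] using this
  · have := hid.sum_norm_sq
    simpa using this

end Discretisation

/-! ### Projections and sections -/

section ProjectionAndSection

variable {E : Type*} [NormedAddCommGroup E] [InnerProductSpace ℝ E] (H : Submodule ℝ E)

theorem isClosed_sectionBody_polarBody (K : Set E) : IsClosed (sectionBody H (polarBody K)) := by
  have : sectionBody H (polarBody K) = ⋂ y ∈ K, {x : H | ⟪(x : E), y⟫ ≤ 1} := by
    ext x; simp [sectionBody, polarBody]
  rw [this]
  exact isClosed_biInter fun y _ => isClosed_le (by fun_prop) continuous_const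

theorem convex_sectionBody_polarBody (K : Set E) : Convex ℝ (sectionBody H (polarBody K)) := by
  intro x hx y hy a b ha hb hab z hz
  have h1 := mul_le_mul_of_nonneg_left (hx z hz) ha
  have h2 := mul_le_mul_of_nonneg_left (hy z hz) hb
  simp only [Submodule.coe_add, Submodule.coe_smul, inner_add_left, real_inner_smul_left]
  linarith

variable [FiniteDimensional ℝ E]

theorem IsIdentityDecomposition.orthogonalProjectionOnto {ι : Type*} [Fintype ι] {c : ι → ℝ}
    {u : ι → E} (h : IsIdentityDecomposition c u) :
    IsIdentityDecomposition c fun i => H.orthogonalProjectionOnto (u i) := by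
  intro x
  have := congrArg H.orthogonalProjectionOnto (h (x : E))
  simpa [H.inner_orthogonalProjectionOnto_eq_of_mem_left] using this

theorem isCompact_projBody {K : Set E} (hK : IsCompact K) : IsCompact (projBody H K) :=
  hK.image H.orthogonalProjectionOnto.continuous

theorem convex_projBody {K : Set E} (hK : Convex ℝ K) : Convex ℝ (projBody H K) :=
  hK.linear_image (H.orthogonalProjectionOnto : E →ₗ[ℝ] H)

theorem sectionBody_polarBody_subset_slabIntersection {K : Set E} {ι : Type*} {u : ι → E}
    (hu : ∀ i, u i ∈ K) (hu' : ∀ i, -u i ∈ K) :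
    sectionBody H (polarBody K) ⊆ slabIntersection fun i => H.orthogonalProjectionOnto (u i) := by
  intro x hx i
  rw [H.inner_orthogonalProjectionOnto_eq_of_mem_left, abs_le]
  have h1 := hx _ (hu i)
  have h2 := hx _ (hu' i)
  rw [inner_neg_right] at h2
  exact ⟨by linarith, h1⟩

end ProjectionAndSection

/-! ### The mean width inequalities -/

section Comparison

variable {F : Type*} [NormedAddCommGroup F] [InnerProductSpace ℝ F] [FiniteDimensional ℝ F]
  [MeasurableSpace F] [BorelSpace F]

/-- A comparison of Gaussian means of support functions is one of mean widths: the factor between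
the two depends only on the dimension. -/
theorem exists_meanWidth_eq_mul_integral_supportFn {k : ℕ} (hk1 : 1 ≤ k) (hk : finrank ℝ F = k) :
    ∃ a : ℝ, 0 < a ∧
      (∀ C : Set F, IsCompact C → C.Nonempty →
        meanWidth C = a * ∫ x, supportFn C x ∂(stdGaussian F)) ∧
      ∀ C : Set (EuclideanSpace ℝ (Fin k)), IsCompact C → C.Nonempty →
        meanWidth C = a * ∫ x, supportFn C x ∂(stdGaussian (EuclideanSpace ℝ (Fin k))) := by
  have : NeZero k := ⟨by omega⟩
  have : Nontrivial F := Module.nontrivial_of_finrank_pos (R := ℝ) (by omega)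
  have hφ := integral_norm_stdGaussian_eq
    (((stdOrthonormalBasis ℝ F).reindex (finCongr hk)).repr)
  refine ⟨2 / ∫ x, ‖x‖ ∂(stdGaussian F), div_pos two_pos integral_norm_stdGaussian_pos,
    fun C hC hn => meanWidth_eq_integral_stdGaussian hC hn, fun C hC hn => ?_⟩
  rw [meanWidth_eq_integral_stdGaussian hC hn, hφ]

end Comparison

theorem mainTheorem1 (n k : ℕ) (hk : 1 ≤ k)
    (μ : Measure (sphere (0 : EuclideanSpace ℝ (Fin n)) 1)) [IsFiniteMeasure μ]
    (hμ : IsIsotropic μ) (hcentroid : sphereCentroid μ = 0)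
    (K : Set (EuclideanSpace ℝ (Fin n)))
    (hKcompact : IsCompact K) (hKconvex : Convex ℝ K) (hKinterior : (interior K).Nonempty)
    (hKμ : convSupport μ ⊆ K)
    (H : Submodule ℝ (EuclideanSpace ℝ (Fin n))) (hH : finrank ℝ H = k) :
    (∀ Δ : Set (EuclideanSpace ℝ (Fin k)), IsInscribedRegularSimplex k Δ →
      meanWidth (projBody H K) ≥ √((k : ℝ) / n) * meanWidth Δ ∧
      (meanWidth (projBody H K) = √((k : ℝ) / n) * meanWidth Δ ↔
        IsCopyOf (projBody H K) (√((k : ℝ) / n) • Δ))) ∧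
    (IsEvenMeasure μ →
      (meanWidth (projBody H K) ≥ √((k : ℝ) / n) * meanWidth (crossPolytope k) ∧
        (meanWidth (projBody H K) = √((k : ℝ) / n) * meanWidth (crossPolytope k) ↔
          IsCopyOf (projBody H K) (√((k : ℝ) / n) • crossPolytope k))) ∧
      (meanWidth (sectionBody H (polarBody K)) ≤ √((n : ℝ) / k) * meanWidth (unitCube k) ∧
        (meanWidth (sectionBody H (polarBody K)) = √((n : ℝ) / k) * meanWidth (unitCube k) ↔
          IsCopyOf (sectionBody H (polarBody K)) (√((n : ℝ) / k) • unitCube k)))) := by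
  have : NeZero k := ⟨by omega⟩
  have hkn : k ≤ n := by simpa [hH] using Submodule.finrank_le H
  have : Nontrivial (EuclideanSpace ℝ (Fin n)) :=
    Module.nontrivial_of_finrank_pos (R := ℝ) (by simp; omega)
  obtain ⟨ι, _, c, u, hc, hu, hcu, hcn, hid⟩ :=
    exists_isIdentityDecomposition_of_isIsotropic hμ hcentroid
  rw [finrank_euclideanSpace_fin] at hcn
  have huK : ∀ i, (u i : EuclideanSpace ℝ (Fin n)) ∈ K :=
    fun i => hKμ (subset_convexHull ℝ _ ⟨u i, hu i, rfl⟩)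
  set y : ι → H := fun i => H.orthogonalProjectionOnto (u i : EuclideanSpace ℝ (Fin n)) with hy
  have hidH : IsIdentityDecomposition c y := hid.orthogonalProjectionOnto H
  have hcy : ∑ i, c i • y i = 0 := by
    have := congrArg H.orthogonalProjectionOnto hcu
    simpa [hy] using this
  have hP := isCompact_projBody H hKcompact
  have hPc := convex_projBody H hKconvex
  have hyP : ∀ i, y i ∈ projBody H K := fun i => ⟨_, huK i, rfl⟩
  have hPn : (projBody H K).Nonempty := (hKinterior.mono interior_subset).image _
  obtain ⟨a, ha, haH, hak⟩ := exists_meanWidth_eq_mul_integral_supportFn hk hH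
  refine ⟨fun Δ hΔ => ?_, fun hev => ?_⟩
  · obtain ⟨h1, h2⟩ := simplex_le_of_centred_decomposition hk hH hidH hc hcy hP hPc hyP hΔ
    rw [hcn] at h1 h2
    obtain ⟨s, -, -, hs⟩ := id hΔ
    have hΔc : IsCompact Δ := hs ▸ (Set.finite_range s.points).isCompact_convexHull ℝ
    have hΔn : Δ.Nonempty := hs ▸ (Set.range_nonempty s.points).convexHull
    rw [haH _ hP hPn, hak _ hΔc hΔn, mul_left_comm, mul_right_inj' ha.ne']
    exact ⟨mul_le_mul_of_nonneg_left h1 ha.le, h2⟩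
  have huK' : ∀ i, -(u i : EuclideanSpace ℝ (Fin n)) ∈ K := fun i =>
    hKμ (subset_convexHull ℝ _ ⟨-u i, neg_mem_support_of_isEvenMeasure hev (hu i), rfl⟩)
  have hyP' : ∀ i, -y i ∈ projBody H K := fun i => ⟨_, huK' i, by simp [hy]⟩
  constructor
  · obtain ⟨h1, h2⟩ := crossPolytope_le_of_symmetric_decomposition hH hidH hc hP hPc hyP hyP'
    rw [hcn] at h1 h2
    rw [haH _ hP hPn, hak _ (isCompact_crossPolytope k) (nonempty_crossPolytope k), mul_left_comm,
      mul_right_inj' ha.ne']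
    exact ⟨mul_le_mul_of_nonneg_left h1 ha.le, h2⟩
  · have hsub := sectionBody_polarBody_subset_slabIntersection H huK huK'
    have hS : IsCompact (sectionBody H (polarBody K)) :=
      (isCompact_slabIntersection hidH hc).of_isClosed_subset
        (isClosed_sectionBody_polarBody H K) hsub
    have hSn : (sectionBody H (polarBody K)).Nonempty :=
      ⟨0, by simp [sectionBody, polarBody]⟩
    obtain ⟨h1, h2⟩ := le_unitCube_of_subset_slabIntersection hH hidH hc hS
      (convex_sectionBody_polarBody H K) hSn hsub
    rw [hcn] at h1 h2
    rw [haH _ hS hSn, hak _ (isCompact_unitCube k) (nonempty_unitCube k), mul_left_comm,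
      mul_right_inj' ha.ne']
    exact ⟨mul_le_mul_of_nonneg_left h1 ha.le, h2⟩
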